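/- Let $\gamma\in(-2,0)$. On $\mathbb R^3$ write $\langle v\rangle=(1+|v|^2)^{1/2}$, $a_{ij}(z)=|z|^{\gamma+2}\bigl(\delta_{ij}-z_iz_j/|z|^2\bigr)$ and $b_i(z)=\sum_j\partial_j a_{ij}(z)=-2|z|^\gamma z_i$, and let $$Q(f,g)=\nabla\cdot\{(a*f)\nabla g-(b*f)g\}$$ be the Landau operator. Write $$\|g\|_{L^2_l}^2=\int_{\mathbb R^3}|\langle v\rangle^l g|^2\,dv,\qquad \|g\|_{\dot H^1_l}^2=\sum_{i=1}^3\|\langle v\rangle^l\partial_i g\|_{L^2}^2,\qquad \langle Q(f,g),g\langle v\rangle^{2k}\rangle=\int_{\mathbb R^3} Q(f,g)\,g\,\langle v\rangle^{2k}\,dv .$$ Let $m_0>0$ and $E_0,H_0\in\mathbb R$, and let $\mathcal F$ be the set of nonnegative $f\in C^\infty(\mathbb R^3)$ with $f\in L^1_2\cap L\log L$ and $$\int f\,dv\ge m_0,\qquad \int f\langle v\rangle^2\,dv\le E_0,\qquad \int f\log f\,dv\le H_0 .$$ For $k\ge 0$ and $f\in\mathcal F$ call $g:\mathbb R^3\to\mathbb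 R$ admissible if $g\in C^\infty(\mathbb R^3)$, $\|g\|_{L^2_{k+\gamma/2}}<\infty$, $\|g\|_{\dot H^1_{k+\gamma/2}}<\infty$, and $Q(f,g)\,g\,\langle v\rangle^{2k}\in L^1(\mathbb R^3)$. Then there is a constant $K>0$, depending only on $\gamma,m_0,E_0,H_0$, such that the following hold. (i) There is $C>0$, depending only on $\gamma,m_0,E_0,H_0$, such that for all $0\le k\le(\gamma+3)/2$, all $f\in\mathcal F$ and all admissible $g$, $$\langle Q(f,g),g\langle v\rangle^{2k}\rangle\le -K\|g\|_{\dot H^1_{k+\gamma/2}}^2+C\|g\|_{L^2_{k+\gamma/2}}^2 .$$ (ii) For every $k>(\gamma+3)/2$ there are $K',C>0$, depending only on $\gamma,k,m_0,E_0,H_0$, such that for all $f\in\mathcal F$ and all admissible $g$, $$\langle Q(f,g),g\langle v\rangle^{2k}\rangle\le -K\|g\|_{\dot H^1_{k+\gamma/2}}^2-K'\|g\|_{L^2_{k+\gamma/2}}^2+C\|g\|_{L^2_{k-1}}^2 .$$ -/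

import Mathlib

open MeasureTheory
open scoped ContDiff

namespace Landau

/-- The velocity space `ℝ³` with its Euclidean norm. -/
abbrev V : Type := EuclideanSpace ℝ (Fin 3)

/-- The bracket `⟨v⟩ = (1 + |v|²)^{1/2}`. -/
noncomputable def bracket (v : V) : ℝ := Real.sqrt (1 + ‖v‖ ^ 2)

/-- The partial derivative `∂ᵢ h (v)`. -/
noncomputable def pd (i : Fin 3) (h : V → ℝ) (v : V) : ℝ :=
  fderiv ℝ h v (EuclideanSpace.single i (1 : ℝ))

/-- `aᵢⱼ(z) = |z|^{γ+2} (δᵢⱼ - zᵢ zⱼ / |z|²)` (equal to `0` at `z = 0` when `γ > -2`). -/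
noncomputable def aKer (γ : ℝ) (i j : Fin 3) (z : V) : ℝ :=
  ‖z‖ ^ (γ + 2) * ((if i = j then (1 : ℝ) else 0) - z i * z j / ‖z‖ ^ 2)

/-- `bᵢ(z) = ∂ⱼ aᵢⱼ(z) = -2 |z|^γ zᵢ`. -/
noncomputable def bKer (γ : ℝ) (i : Fin 3) (z : V) : ℝ :=
  -2 * ‖z‖ ^ γ * z i

/-- The convolution `aᵢⱼ * f`. -/
noncomputable def aBar (γ : ℝ) (f : V → ℝ) (i j : Fin 3) (v : V) : ℝ :=
  ∫ w : V, aKer γ i j (v - w) * f w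

/-- The convolution `bᵢ * f`. -/
noncomputable def bBar (γ : ℝ) (f : V → ℝ) (i : Fin 3) (v : V) : ℝ :=
  ∫ w : V, bKer γ i (v - w) * f w

/-- The Landau collision operator `Q(f, g) = ∇ · { (a * f) ∇g - (b * f) g }`. -/
noncomputable def Q (γ : ℝ) (f g : V → ℝ) (v : V) : ℝ :=
  ∑ i : Fin 3, pd i (fun u => (∑ j : Fin 3, aBar γ f i j u * pd j g u) - bBar γ f i u * g u) v

/-- The integrand `Q(f, g) g ⟨v⟩^{2k}`. -/
noncomputable def pairingIntegrand (γ k : ℝ) (f g : V → ℝ) (v : V) : ℝ :=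
  Q γ f g v * (g v * bracket v ^ (2 * k))

/-- The pairing `⟨Q(f, g), g ⟨v⟩^{2k}⟩`. -/
noncomputable def pairing (γ k : ℝ) (f g : V → ℝ) : ℝ :=
  ∫ v : V, pairingIntegrand γ k f g v

/-- The squared weighted norm `‖g‖²` in `L²_l`, that is `‖⟨v⟩^l g‖²` in `L²`. -/
noncomputable def normSqL2 (l : ℝ) (g : V → ℝ) : ℝ :=
  ∫ v : V, (bracket v ^ l * g v) ^ 2

/-- The squared weighted homogeneous norm `‖g‖²` in `Ḣ¹_l`, that is `∑ᵢ ‖⟨v⟩^l ∂ᵢ g‖²` in `L²`. -/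
noncomputable def normSqH1dot (l : ℝ) (g : V → ℝ) : ℝ :=
  ∑ i : Fin 3, ∫ v : V, (bracket v ^ l * pd i g v) ^ 2

/-- Smooth nonnegative densities in `L¹_2 ∩ L log L`, with mass at least `m₀`, with `L¹_2` norm
at most `E₀` and with entropy at most `H₀`. -/
structure IsDensity (m₀ E₀ H₀ : ℝ) (f : V → ℝ) : Prop where
  smooth : ContDiff ℝ ∞ f
  nonneg : ∀ v, 0 ≤ f v
  moment_integrable : Integrable (fun v : V => bracket v ^ 2 * f v)
  entropy_integrable : Integrable (fun v : V => f v * Real.log (f v))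
  mass_ge : m₀ ≤ ∫ v : V, f v
  moment_le : ∫ v : V, bracket v ^ 2 * f v ≤ E₀
  entropy_le : ∫ v : V, f v * Real.log (f v) ≤ H₀

/-- Smooth functions `g` for which the quantities in the estimate are finite: `g` has finite norm in
`L²_{k+γ/2}` and in `Ḣ¹_{k+γ/2}`, and the integral defining `⟨Q(f, g), g ⟨v⟩^{2k}⟩` converges. -/
structure IsAdmissible (γ k : ℝ) (f g : V → ℝ) : Prop where
  smooth : ContDiff ℝ ∞ g
  memL2 : MemLp (fun v : V => bracket v ^ (k + γ / 2) * g v) 2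
  memH1dot : ∀ i : Fin 3, MemLp (fun v : V => bracket v ^ (k + γ / 2) * pd i g v) 2
  pairing_integrable : Integrable (pairingIntegrand γ k f g)

end Landau

namespace Landau

/-! ### The bracket -/

/-! The estimate is an energy identity in which no derivative ever falls on `f`. Testing `Q f g`
against `g Φ(1 + |v|²)` and integrating by parts gives minus the quadratic form of `a * f` on `∇g`,
weighted by `Φ`, plus first-order terms of the form `g ∇g`. By Fubini these are handled for each
fixed `w`: the field multiplying `∇(g²)` has an explicit divergence in `v`, so a second integration
by parts leaves only `|v - w|^γ g(v)² f(w)` times `zerothTerm`. This is `integral_Q_mul`. For `Φ(r)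
= r^k` the factor becomes `powTerm`, namely `⟨v⟩^{2k}` times `(γ + 3 - 2k) + 2k ⟨w⟩²/⟨v⟩² +
2k(k-1)(|v|²|w|² - (v·w)²)/⟨v⟩⁴`. The last two terms gain `⟨v⟩^{-2}` at the cost of `⟨w⟩²`, which
the second moment of `f` pays for, so the sign of `γ + 3 - 2k` separates the two cases.

Three quantitative facts finish the argument. The bounds on mass, energy and entropy prevent `f`
from concentrating on thin slabs, so `a * f` is at least a multiple of `⟨v⟩^γ` (`exists_aBar_ge`).
Since `γ > -2`, the potential `|v - w|^γ` is subcritical for Hardy's inequality, hence bounded by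
`ε` times the Dirichlet form plus `C` times the `L²` norm, uniformly in `w`
(`exists_integral_norm_rpow_mul_sq_le`). Finally `|·|^γ * f` is itself at least a multiple of
`⟨v⟩^γ` (`le_integral_norm_rpow_mul`).

When `2k ≤ γ + 3`, the whole zeroth-order term is treated as an error: with `ε` small, half of the
coercivity absorbs it. When `2k > γ + 3`, the leading term is negative and yields the damping in
`L²_{k+γ/2}`, while the remainder carries the weight `⟨v⟩^{2(k-1)}` and is absorbed in the same way,
because `k - 1 < k + γ/2`. In both cases the surviving gradient constant is half the ellipticity
constant, which does not depend on `k`.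

As `r^k` is not compactly supported, all identities are proved for the truncations `powCut k n`,
with bounds uniform in `n`, and `pairing_le` passes to the limit. -/

lemma bracket_sq (v : V) : bracket v ^ 2 = 1 + ‖v‖ ^ 2 :=
  Real.sq_sqrt (by positivity)

lemma one_le_bracket (v : V) : 1 ≤ bracket v :=
  Real.one_le_sqrt.2 (by nlinarith [sq_nonneg ‖v‖])

lemma bracket_pos (v : V) : 0 < bracket v := one_pos.trans_le (one_le_bracket v)

lemma norm_le_bracket (v : V) : ‖v‖ ≤ bracket v :=
  Real.le_sqrt_of_sq_le (by linarith)

lemma bracket_rpow_eq (l : ℝ) (v : V) : bracket v ^ l = (1 + ‖v‖ ^ 2) ^ (l / 2) := by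
  rw [bracket, Real.sqrt_eq_rpow, ← Real.rpow_mul (by positivity)]
  congr 1; ring

lemma bracket_rpow_pos (l : ℝ) (v : V) : 0 < bracket v ^ l := Real.rpow_pos_of_pos (bracket_pos v) l

lemma bracket_rpow_le {l m : ℝ} (h : l ≤ m) (v : V) : bracket v ^ l ≤ bracket v ^ m :=
  Real.rpow_le_rpow_of_exponent_le (one_le_bracket v) h

lemma contDiff_bracket_rpow (l : ℝ) : ContDiff ℝ ∞ (fun v : V => bracket v ^ l) := by
  simp_rw [bracket_rpow_eq]
  refine ContDiff.rpow_const_of_ne (contDiff_const.add (contDiff_norm_sq ℝ)) fun v => by positivity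

lemma continuous_bracket : Continuous bracket := by unfold bracket; fun_prop

lemma bracket_sub_le (v w : V) : bracket v ^ 2 ≤ 2 * (1 + ‖v - w‖ ^ 2) * bracket w ^ 2 := by
  rw [bracket_sq, bracket_sq]
  have h : ‖v‖ ≤ ‖v - w‖ + ‖w‖ := by simpa using norm_add_le (v - w) w
  have : ‖v‖ ^ 2 ≤ (‖v - w‖ + ‖w‖) ^ 2 := pow_le_pow_left₀ (norm_nonneg v) h 2
  nlinarith [sq_nonneg (‖v - w‖ - ‖w‖), sq_nonneg (‖v - w‖ * ‖w‖)]

lemma norm_sub_sq_le (v w : V) : ‖v - w‖ ^ 2 ≤ 2 * bracket v ^ 2 * bracket w ^ 2 := by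
  rw [bracket_sq, bracket_sq]
  have : ‖v - w‖ ^ 2 ≤ (‖v‖ + ‖w‖) ^ 2 := pow_le_pow_left₀ (norm_nonneg _) (norm_sub_le v w) 2
  nlinarith [sq_nonneg (‖v‖ - ‖w‖), sq_nonneg (‖v‖ * ‖w‖)]

lemma norm_sq_eq_coord (v : V) : ‖v‖ ^ 2 = v 0 ^ 2 + v 1 ^ 2 + v 2 ^ 2 := by
  rw [EuclideanSpace.norm_sq_eq, Fin.sum_univ_three]
  simp

lemma abs_coord_le (v : V) (i : Fin 3) : |v i| ≤ ‖v‖ := by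
  simpa using PiLp.norm_apply_le v i

/-! ### Partial derivatives -/

/-- `h` is differentiable at `v`, with `i`-th partial derivative `d`. -/
def HasPd (i : Fin 3) (h : V → ℝ) (d : ℝ) (v : V) : Prop :=
  DifferentiableAt ℝ h v ∧ pd i h v = d

variable {i : Fin 3} {h₁ h₂ : V → ℝ} {d₁ d₂ : ℝ} {v : V}

lemma _root_.DifferentiableAt.hasPd (h : DifferentiableAt ℝ h₁ v) (i : Fin 3) :
    HasPd i h₁ (pd i h₁ v) v := ⟨h, rfl⟩

lemma HasPd.congr_deriv (h : HasPd i h₁ d₁ v) (e : d₁ = d₂) : HasPd i h₁ d₂ v := e ▸ h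

lemma HasPd.add (H₁ : HasPd i h₁ d₁ v) (H₂ : HasPd i h₂ d₂ v) :
    HasPd i (fun u => h₁ u + h₂ u) (d₁ + d₂) v := by
  refine ⟨H₁.1.add H₂.1, ?_⟩
  rw [← H₁.2, ← H₂.2, pd, fderiv_fun_add H₁.1 H₂.1]; rfl

lemma HasPd.sub (H₁ : HasPd i h₁ d₁ v) (H₂ : HasPd i h₂ d₂ v) :
    HasPd i (fun u => h₁ u - h₂ u) (d₁ - d₂) v := by
  refine ⟨H₁.1.sub H₂.1, ?_⟩
  rw [← H₁.2, ← H₂.2, pd, fderiv_fun_sub H₁.1 H₂.1]; rfl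

lemma HasPd.mul (H₁ : HasPd i h₁ d₁ v) (H₂ : HasPd i h₂ d₂ v) :
    HasPd i (fun u => h₁ u * h₂ u) (d₁ * h₂ v + h₁ v * d₂) v := by
  refine ⟨H₁.1.mul H₂.1, ?_⟩
  rw [← H₁.2, ← H₂.2, pd, fderiv_fun_mul H₁.1 H₂.1]
  simp [pd]; ring

lemma hasPd_const (c : ℝ) : HasPd i (fun _ => c) 0 v :=
  ⟨differentiableAt_const c, by simp [pd]⟩

lemma hasPd_coord (j : Fin 3) : HasPd i (fun u : V => u j) (if j = i then 1 else 0) v := by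
  refine ⟨by fun_prop, ?_⟩
  have : (fun u : V => u j) = EuclideanSpace.proj (𝕜 := ℝ) j := rfl
  rw [pd, this, ContinuousLinearMap.fderiv]
  simp

lemma HasPd.comp {φ : ℝ → ℝ} {c : ℝ} (Hφ : HasDerivAt φ c (h₁ v)) (H₁ : HasPd i h₁ d₁ v) :
    HasPd i (fun u => φ (h₁ u)) (c * d₁) v := by
  have := Hφ.comp_hasFDerivAt v H₁.1.hasFDerivAt
  refine ⟨this.differentiableAt, ?_⟩
  rw [pd, HasFDerivAt.fderiv (f := fun u => φ (h₁ u)) this, ← H₁.2]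
  simp [pd]

lemma hasPd_norm_sub_sq (w : V) : HasPd i (fun u : V => ‖u - w‖ ^ 2) (2 * (v i - w i)) v := by
  have : HasFDerivAt (fun u : V => ‖u - w‖ ^ 2) _ v := (((hasFDerivAt_id v).sub_const w).norm_sq)
  refine ⟨this.differentiableAt, ?_⟩
  rw [pd, this.fderiv]
  simp [EuclideanSpace.inner_single_right]

lemma hasPd_norm_sq : HasPd i (fun u : V => ‖u‖ ^ 2) (2 * v i) v := by
  simpa using hasPd_norm_sub_sq (i := i) (v := v) 0

lemma hasPd_bracket_rpow (l : ℝ) :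
    HasPd i (fun u => bracket u ^ l) (l * bracket v ^ (l - 2) * v i) v := by
  simp_rw [bracket_rpow_eq]
  have h := HasPd.comp (φ := fun t : ℝ => t ^ (l / 2)) (h₁ := fun u : V => 1 + ‖u‖ ^ 2)
    (Real.hasDerivAt_rpow_const (p := l / 2) (Or.inl (by positivity)))
    ((hasPd_const (1 : ℝ)).add (hasPd_norm_sq (i := i) (v := v)))
  refine h.congr_deriv ?_
  rw [show (l - 2) / 2 = l / 2 - 1 by ring]; ring

lemma continuous_pd {h : V → ℝ} (H : ContDiff ℝ 1 h) (i : Fin 3) : Continuous (pd i h) :=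
  (H.continuous_fderiv (by simp)).clm_apply continuous_const

lemma contDiff_pd {h : V → ℝ} (H : ContDiff ℝ ∞ h) (i : Fin 3) : ContDiff ℝ ∞ (pd i h) :=
  (H.fderiv_right (m := ∞) (by simp)).clm_apply contDiff_const

/-- Integration by parts in one coordinate direction. -/
lemma integral_mul_pd {u ψ : V → ℝ} (i : Fin 3)
    (h₁ : Integrable fun v => pd i u v * ψ v) (h₂ : Integrable fun v => u v * pd i ψ v)
    (h₃ : Integrable fun v => u v * ψ v) (hu : Differentiable ℝ u) (hψ : Differentiable ℝ ψ) :
    ∫ v, u v * pd i ψ v = -∫ v, pd i u v * ψ v :=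
  integral_mul_fderiv_eq_neg_fderiv_mul_of_integrable h₁ h₂ h₃ (fun v _ => hu v) (fun v _ => hψ v)

lemma pd_eq_zero_of_notMem_tsupport {h : V → ℝ} {v : V} (hv : v ∉ tsupport h) (i : Fin 3) :
    pd i h v = 0 := by
  rw [pd, image_eq_zero_of_notMem_tsupport (fun H => hv (tsupport_fderiv_subset ℝ H))]
  rfl

lemma hasCompactSupport_pd {h : V → ℝ} (H : HasCompactSupport h) (i : Fin 3) :
    HasCompactSupport (pd i h) :=
  HasCompactSupport.of_support_subset_isCompact H fun v hv => by
    by_contra hv'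
    exact hv (pd_eq_zero_of_notMem_tsupport hv' i)

/-! ### Hardy's inequality -/

lemma hasPd_hardyField {η : ℝ} (hη : 0 < η) (w v : V) (i : Fin 3) :
    HasPd i (fun u : V => (u i - w i) * (η + ‖u - w‖ ^ 2)⁻¹)
      ((η + ‖v - w‖ ^ 2)⁻¹ - 2 * (v i - w i) ^ 2 * ((η + ‖v - w‖ ^ 2)⁻¹) ^ 2) v := by
  have ht : 0 < η + ‖v - w‖ ^ 2 := by positivity
  have h1 := HasPd.comp (φ := fun t : ℝ => t⁻¹) (h₁ := fun u : V => η + ‖u - w‖ ^ 2)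
    (hasDerivAt_inv ht.ne') ((hasPd_const η).add (hasPd_norm_sub_sq (i := i) (v := v) w))
  refine (((hasPd_coord (i := i) (v := v) i).sub (hasPd_const (w i))).mul h1).congr_deriv ?_
  simp only [if_true]
  field_simp
  ring

/-- With `z = v - w`, `t = (η + |z|²)⁻¹` and `X = t z`, dimension three gives `div X = 3t - 2|z|²t²
≥ t`, while `|X|² ≤ t`. Integrating `div X` against `h²` by parts and applying Young's inequality
returns half of the left side, whence the factor 4. The regularization `η` keeps `X` smooth and
bounded. -/
lemma hardy_regularized {h : V → ℝ} (hh : ContDiff ℝ 1 h) (hL : MemLp h 2)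
    (hH : ∀ i, MemLp (pd i h) 2) {η : ℝ} (hη : 0 < η) (w : V) :
    ∫ v, (η + ‖v - w‖ ^ 2)⁻¹ * h v ^ 2 ≤ 4 * ∑ i, ∫ v, pd i h v ^ 2 := by
  have ht : ∀ v : V, 0 < η + ‖v - w‖ ^ 2 := fun v => by positivity
  set X : Fin 3 → V → ℝ := fun i v => (v i - w i) * (η + ‖v - w‖ ^ 2)⁻¹ with hX
  set t : V → ℝ := fun v => (η + ‖v - w‖ ^ 2)⁻¹ with htdef
  have htpos : ∀ v, 0 < t v := fun v => inv_pos.2 (ht v)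
  have ht1 : ∀ v, t v * (η + ‖v - w‖ ^ 2) = 1 := fun v => inv_mul_cancel₀ (ht v).ne'
  have htη : ∀ v, t v ≤ η⁻¹ := fun v => inv_anti₀ hη (by nlinarith [sq_nonneg ‖v - w‖])
  have hXd : ∀ i v, HasPd i (X i) (t v - 2 * (v i - w i) ^ 2 * t v ^ 2) v :=
    fun i v => hasPd_hardyField hη w v i
  have hcoord : ∀ i (v : V), (v i - w i) ^ 2 ≤ ‖v - w‖ ^ 2 := fun i v => by
    have := abs_coord_le (v - w) i
    rw [← sq_abs (v i - w i)]
    exact pow_le_pow_left₀ (abs_nonneg _) (by simpa using this) 2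
  have hct : Continuous t := by
    refine Continuous.inv₀ (by fun_prop) fun v => (ht v).ne'
  have hcX : ∀ i, Continuous (X i) := fun i => by
    refine Continuous.mul (by fun_prop) hct
  have hzt : ∀ i v, (v i - w i) ^ 2 * t v ≤ 1 := fun i v => by
    nlinarith [ht1 v, htpos v, hcoord i v]
  have hXsq : ∀ i v, (X i v) ^ 2 ≤ η⁻¹ := fun i v => by
    have : X i v ^ 2 = (v i - w i) ^ 2 * t v * t v := by simp only [hX, htdef]; ring
    rw [this]; nlinarith [hzt i v, htpos v, htη v]
  have hXb : ∀ i v, ‖X i v‖ ≤ 1 + η⁻¹ := fun i v => by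
    rw [Real.norm_eq_abs]; exact abs_le_of_sq_le_sq (by nlinarith [hXsq i v, inv_pos.2 hη])
      (by positivity)
  have hXpd : ∀ i, pd i (X i) = fun v => t v - 2 * (v i - w i) ^ 2 * t v ^ 2 :=
    fun i => funext fun v => (hXd i v).2
  have hXpdb : ∀ i v, ‖pd i (X i) v‖ ≤ η⁻¹ := fun i v => by
    rw [hXpd, Real.norm_eq_abs, abs_le]
    have h1 := hzt i v
    have h2 : 0 ≤ (v i - w i) ^ 2 * t v := by have := htpos v; positivity
    constructor <;> nlinarith [htpos v, htη v, sq_nonneg (v i - w i)]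
  have hh2 : Integrable fun v => h v ^ 2 := hL.integrable_sq
  have hpd2 : ∀ i, Integrable fun v => pd i h v ^ 2 := fun i => (hH i).integrable_sq
  have hdiff : Differentiable ℝ h := hh.differentiable (by simp)
  have hsq : ∀ i, pd i (fun v => h v ^ 2) = fun v => 2 * (h v * pd i h v) := fun i => by
    funext v
    have := ((hdiff v).hasPd i).mul ((hdiff v).hasPd i)
    simp_rw [sq]; rw [this.2]; ring
  have hint : ∀ i, Integrable fun v => h v * pd i h v := fun i => hL.integrable_mul (hH i)
  have hcpdX : ∀ i, Continuous (pd i (X i)) := fun i => by rw [hXpd]; fun_prop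
  have i1 : ∀ i, Integrable fun v => pd i (X i) v * h v ^ 2 := fun i =>
    hh2.bdd_mul (hcpdX i).aestronglyMeasurable (ae_of_all _ (hXpdb i))
  have i2 : ∀ i, Integrable fun v => X i v * (2 * (h v * pd i h v)) := fun i =>
    ((hint i).const_mul 2).bdd_mul (hcX i).aestronglyMeasurable (ae_of_all _ (hXb i))
  have i3 : ∀ i, Integrable fun v => X i v * h v ^ 2 := fun i =>
    hh2.bdd_mul (hcX i).aestronglyMeasurable (ae_of_all _ (hXb i))
  have i4 : Integrable fun v => t v * h v ^ 2 :=
    hh2.bdd_mul (c := η⁻¹) hct.aestronglyMeasurable (ae_of_all _ fun v => by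
      rw [Real.norm_of_nonneg (htpos v).le]; exact htη v)
  have ibp : ∀ i, ∫ v, pd i (X i) v * h v ^ 2 = -∫ v, X i v * (2 * (h v * pd i h v)) := fun i => by
    have := integral_mul_pd (u := X i) (ψ := fun v => h v ^ 2) i (i1 i)
      (by rw [hsq]; exact i2 i) (i3 i) (fun v => (hXd i v).1) (hdiff.pow 2)
    rw [hsq] at this; linarith
  have key1 : ∫ v, t v * h v ^ 2 ≤ ∑ i, ∫ v, pd i (X i) v * h v ^ 2 := by
    rw [← integral_finsetSum _ fun i _ => i1 i]
    refine integral_mono i4 (integrable_finsetSum _ fun i _ => i1 i) fun v => ?_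
    simp only [← Finset.sum_mul]
    refine mul_le_mul_of_nonneg_right ?_ (sq_nonneg _)
    simp only [hXpd, Fin.sum_univ_three]
    have h1 := norm_sq_eq_coord (v - w)
    simp only [PiLp.sub_apply] at h1
    have h2 : ‖v - w‖ ^ 2 * t v ≤ 1 := by nlinarith [ht1 v, htpos v]
    have h3 : ((v 0 - w 0) ^ 2 + (v 1 - w 1) ^ 2 + (v 2 - w 2) ^ 2) * t v ^ 2 ≤ t v := by
      rw [← h1]; nlinarith [htpos v]
    nlinarith [htpos v]
  have key2 : ∑ i, ∫ v, pd i (X i) v * h v ^ 2 ≤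
      1 / 2 * (∫ v, t v * h v ^ 2) + 2 * ∑ i, ∫ v, pd i h v ^ 2 := by
    simp_rw [ibp]
    rw [Finset.sum_neg_distrib, ← integral_finsetSum _ fun i _ => i2 i, ← integral_neg,
      ← integral_finsetSum _ fun i _ => hpd2 i, ← integral_const_mul, ← integral_const_mul,
      ← integral_add (i4.const_mul _) ((integrable_finsetSum _ fun i _ => hpd2 i).const_mul _)]
    refine integral_mono (integrable_finsetSum _ fun i _ => i2 i).neg
      ((i4.const_mul _).add ((integrable_finsetSum _ fun i _ => hpd2 i).const_mul _)) fun v => ?_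
    simp only [Fin.sum_univ_three]
    have h1 := norm_sq_eq_coord (v - w)
    simp only [PiLp.sub_apply] at h1
    have h2 : X 0 v ^ 2 + X 1 v ^ 2 + X 2 v ^ 2 ≤ t v := by
      have : X 0 v ^ 2 + X 1 v ^ 2 + X 2 v ^ 2 = ‖v - w‖ ^ 2 * t v ^ 2 := by
        rw [h1]; simp only [hX, htdef]; ring
      rw [this]
      have h2 : ‖v - w‖ ^ 2 * t v ≤ 1 := by nlinarith [ht1 v, htpos v]
      nlinarith [htpos v]
    have h3 := mul_le_mul_of_nonneg_right h2 (sq_nonneg (h v))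
    nlinarith [sq_nonneg (X 0 v * h v + 2 * pd 0 h v), sq_nonneg (X 1 v * h v + 2 * pd 1 h v),
      sq_nonneg (X 2 v * h v + 2 * pd 2 h v)]
  simp only [htdef] at key1 key2
  linarith

/-- `|z|^γ` is form-bounded with respect to the Laplacian, with relative bound `0`, for
`-2 < γ < 0`. -/
lemma exists_integral_norm_rpow_mul_sq_le {γ : ℝ} (hγ₁ : -2 < γ) (hγ₂ : γ < 0) {ε : ℝ}
    (hε : 0 < ε) :
    ∃ C, 0 < C ∧ ∀ h : V → ℝ, ContDiff ℝ 1 h → MemLp h 2 → (∀ i, MemLp (pd i h) 2) → ∀ w : V,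
      Integrable (fun v => ‖v - w‖ ^ γ * h v ^ 2) ∧
      ∫ v, ‖v - w‖ ^ γ * h v ^ 2 ≤ ε * (∑ i, ∫ v, pd i h v ^ 2) + C * ∫ v, h v ^ 2 := by
  -- Chosen so that `δ^{-(2+γ)} = ε/4`: below `s = δ⁻²` the power `s^{γ/2}` is at most `(ε/4) s⁻¹`,
  -- and above it the constant `C` suffices. The 4 cancels the Hardy constant.
  set δ : ℝ := (4 / ε) ^ (1 / (2 + γ)) with hδ
  have hδ0 : 0 < δ := Real.rpow_pos_of_pos (by positivity) _
  refine ⟨(δ ^ 2) ^ (-(γ / 2)), Real.rpow_pos_of_pos (by positivity) _, fun h hh hL hH w => ?_⟩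
  set C := (δ ^ 2) ^ (-(γ / 2))
  have hpt : ∀ s : ℝ, 0 < s → s ^ (γ / 2) ≤ ε / 4 * s⁻¹ + C := fun s hs => by
    have hC : 0 < C := Real.rpow_pos_of_pos (by positivity) _
    rcases le_or_gt (δ ^ 2)⁻¹ s with h | h
    · have : s ^ (γ / 2) ≤ ((δ ^ 2)⁻¹) ^ (γ / 2) :=
        Real.rpow_le_rpow_of_nonpos (by positivity) h (by linarith)
      rw [Real.inv_rpow (by positivity), ← Real.rpow_neg (by positivity)] at this
      have h2 : 0 < ε / 4 * s⁻¹ := by positivity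
      linarith
    · have h1 : s ^ (γ / 2) = s ^ (1 + γ / 2) * s⁻¹ := by
        rw [Real.rpow_add hs, Real.rpow_one]; field_simp
      have h2 : s ^ (1 + γ / 2) ≤ ((δ ^ 2)⁻¹) ^ (1 + γ / 2) :=
        Real.rpow_le_rpow hs.le h.le (by linarith)
      have h3 : ((δ ^ 2)⁻¹) ^ (1 + γ / 2) = ε / 4 := by
        rw [Real.inv_rpow (by positivity), ← Real.rpow_natCast, hδ, ← Real.rpow_mul (by positivity),
          ← Real.rpow_mul (by positivity)]
        have : 1 / (2 + γ) * (((2 : ℕ) : ℝ) * (1 + γ / 2)) = 1 := by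
          have : (2 + γ) ≠ 0 := by linarith
          push_cast; field_simp
        rw [this, Real.rpow_one, inv_div]
      rw [h1]
      have := mul_le_mul_of_nonneg_right (h2.trans h3.le) (inv_pos.2 hs).le
      linarith
  have hh2 : Integrable fun v => h v ^ 2 := hL.integrable_sq
  set B := ε * (∑ i, ∫ v, pd i h v ^ 2) + C * ∫ v, h v ^ 2 with hB
  set η : ℕ → ℝ := fun n => 1 / ((n : ℝ) + 1) with hη
  have hη0 : ∀ n, 0 < η n := fun n => Nat.one_div_pos_of_nat
  have hreg : ∀ n, ∫⁻ v, ENNReal.ofReal ((η n + ‖v - w‖ ^ 2) ^ (γ / 2) * h v ^ 2) ≤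
      ENNReal.ofReal B := fun n => by
    have ht : ∀ v : V, 0 < η n + ‖v - w‖ ^ 2 := fun v => by have := hη0 n; positivity
    have hct : Continuous fun v : V => (η n + ‖v - w‖ ^ 2)⁻¹ :=
      Continuous.inv₀ (by fun_prop) fun v => (ht v).ne'
    have hcp : Continuous fun v : V => (η n + ‖v - w‖ ^ 2) ^ (γ / 2) :=
      Continuous.rpow_const (by fun_prop) fun v => Or.inl (ht v).ne'
    have i1 : Integrable fun v => (η n + ‖v - w‖ ^ 2)⁻¹ * h v ^ 2 :=
      hh2.bdd_mul (c := (η n)⁻¹) hct.aestronglyMeasurable (ae_of_all _ fun v => by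
        rw [Real.norm_of_nonneg (inv_pos.2 (ht v)).le]
        exact inv_anti₀ (hη0 n) (by nlinarith [sq_nonneg ‖v - w‖]))
    have i2 : Integrable fun v => (η n + ‖v - w‖ ^ 2) ^ (γ / 2) * h v ^ 2 :=
      hh2.bdd_mul (c := (η n) ^ (γ / 2)) hcp.aestronglyMeasurable (ae_of_all _ fun v => by
        rw [Real.norm_of_nonneg (Real.rpow_nonneg (ht v).le _)]
        exact Real.rpow_le_rpow_of_nonpos (hη0 n) (by nlinarith [sq_nonneg ‖v - w‖])
          (by linarith))
    rw [← ofReal_integral_eq_lintegral_ofReal i2 (ae_of_all _ fun v => mul_nonneg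
      (Real.rpow_nonneg (ht v).le _) (sq_nonneg _))]
    refine ENNReal.ofReal_le_ofReal ?_
    calc ∫ v, (η n + ‖v - w‖ ^ 2) ^ (γ / 2) * h v ^ 2
        ≤ ∫ v, (ε / 4 * ((η n + ‖v - w‖ ^ 2)⁻¹ * h v ^ 2) + C * h v ^ 2) := by
          refine integral_mono i2 ((i1.const_mul _).add (hh2.const_mul _)) fun v => ?_
          have := mul_le_mul_of_nonneg_right (hpt _ (ht v)) (sq_nonneg (h v))
          simp only
          linarith
      _ = ε / 4 * (∫ v, (η n + ‖v - w‖ ^ 2)⁻¹ * h v ^ 2) + C * ∫ v, h v ^ 2 := by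
          rw [integral_add (i1.const_mul _) (hh2.const_mul _), integral_const_mul,
            integral_const_mul]
      _ ≤ B := by
          have := hardy_regularized hh hL hH (hη0 n) w
          rw [hB]
          nlinarith
  -- Fatou's lemma removes `η` and yields integrability together with the bound. At `v = w` the
  -- integrand vanishes, because `0 ^ γ = 0` by convention.
  have hlim : ∫⁻ v, ENNReal.ofReal (‖v - w‖ ^ γ * h v ^ 2) ≤ ENNReal.ofReal B := by
    calc ∫⁻ v, ENNReal.ofReal (‖v - w‖ ^ γ * h v ^ 2)
        ≤ ∫⁻ v, Filter.liminf (fun n =>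
            ENNReal.ofReal ((η n + ‖v - w‖ ^ 2) ^ (γ / 2) * h v ^ 2)) Filter.atTop := by
          refine lintegral_mono fun v => ?_
          by_cases hz : ‖v - w‖ = 0
          · simp [hz, Real.zero_rpow hγ₂.ne]
          · have : Filter.Tendsto (fun n => ENNReal.ofReal ((η n + ‖v - w‖ ^ 2) ^ (γ / 2) * h v ^ 2))
                Filter.atTop (nhds (ENNReal.ofReal (‖v - w‖ ^ γ * h v ^ 2))) := by
              refine ENNReal.tendsto_ofReal (Filter.Tendsto.mul_const _ ?_)
              have h0 : ‖v - w‖ ^ γ = (0 + ‖v - w‖ ^ 2) ^ (γ / 2) := by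
                rw [zero_add, ← Real.rpow_natCast, ← Real.rpow_mul (norm_nonneg _)]
                congr 1; push_cast; ring
              rw [h0]
              refine Filter.Tendsto.rpow_const (tendsto_one_div_add_atTop_nhds_zero_nat.add_const _)
                (Or.inl (by positivity))
            rw [this.liminf_eq]
      _ ≤ Filter.liminf (fun n => ∫⁻ v,
            ENNReal.ofReal ((η n + ‖v - w‖ ^ 2) ^ (γ / 2) * h v ^ 2)) Filter.atTop := by
          refine lintegral_liminf_le fun n => ?_
          have := hh.continuous.measurable
          fun_prop
      _ ≤ ENNReal.ofReal B := by
          refine Filter.liminf_le_of_frequently_le' (Filter.Frequently.of_forall hreg)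
  have hmeas : AEStronglyMeasurable (fun v => ‖v - w‖ ^ γ * h v ^ 2) volume := by
    have := hh.continuous.measurable
    exact Measurable.aestronglyMeasurable (by fun_prop)
  have hnn : ∀ v, 0 ≤ ‖v - w‖ ^ γ * h v ^ 2 := fun v => by positivity
  have hint : Integrable (fun v => ‖v - w‖ ^ γ * h v ^ 2) := by
    refine ⟨hmeas, ?_⟩
    rw [hasFiniteIntegral_iff_ofReal (ae_of_all _ hnn)]
    exact hlim.trans_lt ENNReal.ofReal_lt_top
  refine ⟨hint, ?_⟩
  have hC : 0 < C := Real.rpow_pos_of_pos (by positivity) _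
  have hB0 : 0 ≤ B := by
    have h1 : 0 ≤ ∑ i, ∫ v, pd i h v ^ 2 :=
      Finset.sum_nonneg fun i _ => integral_nonneg fun v => sq_nonneg _
    have h2 : 0 ≤ ∫ v, h v ^ 2 := integral_nonneg fun v => sq_nonneg _
    positivity
  rw [← ENNReal.ofReal_le_ofReal_iff hB0,
    ofReal_integral_eq_lintegral_ofReal hint (ae_of_all _ hnn)]
  exact hlim

/-! ### Integrability against `|z|^γ` -/

/-- A multiple of the square of a bump function dominates `|ψ|`, so the form bound applied to the
bump gives local integrability of `|z|^γ`, uniformly in the position of the singularity. -/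
lemma exists_integral_norm_rpow_mul_le {γ : ℝ} (hγ₁ : -2 < γ) (hγ₂ : γ < 0) {ψ : V → ℝ}
    (hψ : Continuous ψ) (hc : HasCompactSupport ψ) :
    ∃ C, 0 < C ∧ ∀ w : V, Integrable (fun v => ‖v - w‖ ^ γ * ψ v) ∧
      ∫ v, ‖v - w‖ ^ γ * |ψ v| ≤ C := by
  obtain ⟨R, hR0, hR⟩ := hc.isCompact.isBounded.subset_closedBall_lt 0 0
  let b : ContDiffBump (0 : V) := ⟨R, R + 1, hR0, by linarith⟩
  obtain ⟨M, hM⟩ := hψ.bounded_above_of_compact_support hc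
  have hM0 : 0 ≤ M := (norm_nonneg _).trans (hM 0)
  have hb : ContDiff ℝ ∞ b := b.contDiff
  have hb1 : ContDiff ℝ 1 b := b.contDiff
  have hbc : HasCompactSupport b := b.hasCompactSupport
  obtain ⟨C, hC0, hC⟩ := exists_integral_norm_rpow_mul_sq_le hγ₁ hγ₂ one_pos
  have hle : ∀ v, |ψ v| ≤ M * b v ^ 2 := fun v => by
    by_cases hv : v ∈ tsupport ψ
    · rw [b.one_of_mem_closedBall (hR hv)]; simpa using hM v
    · rw [image_eq_zero_of_notMem_tsupport hv]; simp; positivity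
  have key := hC b hb1 (hb.continuous.memLp_of_hasCompactSupport hbc)
    fun i => (continuous_pd hb1 i).memLp_of_hasCompactSupport (hasCompactSupport_pd hbc i)
  set B := 1 * (∑ i, ∫ v, pd i b v ^ 2) + C * ∫ v, b v ^ 2
  have hB : 0 ≤ B := by
    refine le_trans ?_ (key 0).2
    exact integral_nonneg fun v => by positivity
  refine ⟨M * B + 1, by positivity, fun w => ?_⟩
  obtain ⟨k1, k2⟩ := key w
  have hm := hψ.measurable
  have i1 : Integrable (fun v => ‖v - w‖ ^ γ * ψ v) := by
    refine (k1.const_mul M).mono' (Measurable.aestronglyMeasurable (by fun_prop))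
      (ae_of_all _ fun v => ?_)
    rw [norm_mul, Real.norm_of_nonneg (by positivity), Real.norm_eq_abs]
    have := mul_le_mul_of_nonneg_left (hle v) (show 0 ≤ ‖v - w‖ ^ γ by positivity)
    linarith
  refine ⟨i1, ?_⟩
  have i2 : Integrable (fun v => ‖v - w‖ ^ γ * |ψ v|) := by
    refine i1.norm.congr (ae_of_all _ fun v => ?_)
    simp only [norm_mul, Real.norm_eq_abs]
    rw [abs_of_nonneg (show 0 ≤ ‖v - w‖ ^ γ by positivity)]
  have : ∫ v, ‖v - w‖ ^ γ * |ψ v| ≤ ∫ v, M * (‖v - w‖ ^ γ * b v ^ 2) := by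
    refine integral_mono i2 (k1.const_mul M) fun v => ?_
    have := mul_le_mul_of_nonneg_left (hle v) (show 0 ≤ ‖v - w‖ ^ γ by positivity)
    simp only; linarith
  rw [integral_const_mul] at this
  have := mul_le_mul_of_nonneg_left k2 hM0
  linarith

lemma integrable_of_bracket_sq_mul {f : V → ℝ} (hf : Continuous f)
    (hi : Integrable fun v : V => bracket v ^ 2 * f v) : Integrable f := by
  refine hi.mono hf.aestronglyMeasurable (ae_of_all _ fun v => ?_)
  rw [norm_mul, Real.norm_of_nonneg (sq_nonneg (bracket v))]
  exact le_mul_of_one_le_left (norm_nonneg _) (one_le_pow₀ (one_le_bracket v))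

lemma norm_rpow_le_one {γ : ℝ} (hγ : γ < 0) {z : V} (hz : 1 ≤ ‖z‖) : ‖z‖ ^ γ ≤ 1 :=
  Real.rpow_le_one_of_one_le_of_nonpos hz hγ.le

/-- The convolution of `|z|^γ` with a continuous integrable function converges everywhere. -/
lemma integrable_norm_rpow_mul {γ : ℝ} (hγ₁ : -2 < γ) (hγ₂ : γ < 0) {F : V → ℝ}
    (hF : Continuous F) (hi : Integrable F) (v : V) :
    Integrable fun w : V => ‖v - w‖ ^ γ * F w := by
  let b : ContDiffBump v := ⟨1, 2, one_pos, one_lt_two⟩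
  have hb : Continuous b := b.continuous
  have hbF : HasCompactSupport fun w => b w * F w := b.hasCompactSupport.mul_right
  obtain ⟨C, -, hC⟩ := exists_integral_norm_rpow_mul_le hγ₁ hγ₂ (hb.mul hF) hbF
  have h1 : Integrable fun w : V => ‖v - w‖ ^ γ * (b w * F w) := by
    simpa [norm_sub_rev v] using (hC v).1
  have hm := hF.measurable
  have hbm := hb.measurable
  have h2 : Integrable fun w : V => ‖v - w‖ ^ γ * ((1 - b w) * F w) := by
    refine hi.mono (Measurable.aestronglyMeasurable (by fun_prop)) (ae_of_all _ fun w => ?_)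
    rw [norm_mul, norm_mul, ← mul_assoc]
    refine mul_le_of_le_one_left (norm_nonneg _) ?_
    rcases le_or_gt ‖v - w‖ 1 with h | h
    · rw [b.one_of_mem_closedBall (by rwa [Metric.mem_closedBall, dist_eq_norm, norm_sub_rev])]
      simp
    · refine mul_le_one₀ ?_ (norm_nonneg _) ?_
      · rw [Real.norm_of_nonneg (by positivity)]; exact norm_rpow_le_one hγ₂ h.le
      · rw [Real.norm_eq_abs, abs_le]
        constructor <;> linarith [b.nonneg' w, b.le_one (x := w)]
  refine (h1.add h2).congr (ae_of_all _ fun w => ?_)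
  simp only [Pi.add_apply]; ring

/-- Tonelli, integrating in `v` first: the inner integral is bounded uniformly in `w`, so
integrability of `F` is enough. -/
lemma integrable_prod_norm_rpow_mul {γ : ℝ} {G F : V → ℝ} (hG : Measurable G)
    (hF : Measurable F) {C : ℝ}
    (h : ∀ w : V, Integrable (fun v => ‖v - w‖ ^ γ * G v) ∧ ∫ v, ‖v - w‖ ^ γ * |G v| ≤ C)
    (hi : Integrable F) :
    Integrable (fun p : V × V => ‖p.1 - p.2‖ ^ γ * G p.1 * F p.2) (volume.prod volume) := by
  have hm : AEStronglyMeasurable (fun p : V × V => ‖p.1 - p.2‖ ^ γ * G p.1 * F p.2)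
      (volume.prod volume) := Measurable.aestronglyMeasurable (by fun_prop)
  rw [integrable_prod_iff' hm]
  refine ⟨ae_of_all _ fun w => (h w).1.mul_const (F w), ?_⟩
  refine (hi.norm.const_mul C).mono' hm.norm.prod_swap.integral_prod_right' (ae_of_all _ fun w => ?_)
  have : ∀ v, ‖‖v - w‖ ^ γ * G v * F w‖ = ‖v - w‖ ^ γ * |G v| * ‖F w‖ := fun v => by
    rw [norm_mul, norm_mul, Real.norm_of_nonneg (show 0 ≤ ‖v - w‖ ^ γ by positivity),
      Real.norm_eq_abs (G v)]
  simp only [this]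
  rw [integral_mul_const, norm_mul, norm_norm]
  refine mul_le_mul_of_nonneg_right ?_ (norm_nonneg _)
  rw [Real.norm_of_nonneg (integral_nonneg fun v => by positivity)]
  exact (h w).2

/-! ### Convolution with a homogeneous kernel -/

/-- A measurable kernel on `V` that vanishes at `0`, is `C¹` away from `0`, and is homogeneous of
degree `d`. -/
structure IsHomogeneousKernel (d : ℝ) (κ : V → ℝ) : Prop where
  measurable : Measurable κ
  map_zero : κ 0 = 0
  contDiffOn : ContDiffOn ℝ 1 κ {0}ᶜ
  homogeneous : ∀ c : ℝ, 0 < c → ∀ z, κ (c • z) = c ^ d * κ z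

namespace IsHomogeneousKernel

variable {d : ℝ} {κ : V → ℝ}

lemma sphere_subset : Metric.sphere (0 : V) 1 ⊆ {0}ᶜ := fun z hz hz0 => by
  rw [Set.mem_singleton_iff.1 hz0] at hz; simp at hz

lemma exists_abs_le (h : IsHomogeneousKernel d κ) : ∃ C, 0 < C ∧ ∀ z, |κ z| ≤ C * ‖z‖ ^ d := by
  obtain ⟨C, hC⟩ := (isCompact_sphere (0 : V) 1).exists_bound_of_continuousOn
    (h.contDiffOn.continuousOn.mono sphere_subset)
  refine ⟨|C| + 1, by positivity, fun z => ?_⟩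
  by_cases hz : z = 0
  · rw [hz, h.map_zero, abs_zero]; positivity
  have hz' : 0 < ‖z‖ := norm_pos_iff.2 hz
  have h1 : z = ‖z‖ • (‖z‖⁻¹ • z) := by rw [smul_smul, mul_inv_cancel₀ hz'.ne', one_smul]
  have h2 := hC (‖z‖⁻¹ • z) (by simp [norm_smul, hz'.ne'])
  rw [h1, h.homogeneous _ hz', abs_mul, ← h1, abs_of_pos (Real.rpow_pos_of_pos hz' _), mul_comm]
  refine mul_le_mul_of_nonneg_right ?_ (by positivity)
  rw [Real.norm_eq_abs] at h2
  linarith [le_abs_self C]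

lemma differentiableAt (h : IsHomogeneousKernel d κ) {z : V} (hz : z ≠ 0) :
    DifferentiableAt ℝ κ z :=
  (h.contDiffOn.differentiableOn (by simp)).differentiableAt
    (isOpen_compl_singleton.mem_nhds hz)

lemma continuousOn_fderiv (h : IsHomogeneousKernel d κ) : ContinuousOn (fderiv ℝ κ) {0}ᶜ :=
  h.contDiffOn.continuousOn_fderiv_of_isOpen isOpen_compl_singleton (by simp)

/-- Differentiating the scaling relation makes the derivative homogeneous of degree `d - 1`, and
compactness of the unit sphere bounds it there. -/
lemma exists_norm_fderiv_le (h : IsHomogeneousKernel d κ) :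
    ∃ C, 0 < C ∧ ∀ z, z ≠ 0 → ‖fderiv ℝ κ z‖ ≤ C * ‖z‖ ^ (d - 1) := by
  obtain ⟨C, hC⟩ := (isCompact_sphere (0 : V) 1).exists_bound_of_continuousOn
    (h.continuousOn_fderiv.mono sphere_subset)
  refine ⟨|C| + 1, by positivity, fun z hz => ?_⟩
  have hz' : 0 < ‖z‖ := norm_pos_iff.2 hz
  set c := ‖z‖
  have h0 : c⁻¹ • z ≠ 0 := smul_ne_zero (inv_ne_zero hz'.ne') hz
  have h2 := hC (c⁻¹ • z) (by simp [norm_smul, c, hz'.ne'])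
  have hk : κ = fun y => c ^ d * κ (c⁻¹ • y) := funext fun y => by
    rw [← h.homogeneous c hz', smul_smul, mul_inv_cancel₀ hz'.ne', one_smul]
  have h3 : HasFDerivAt κ (c ^ d • ((fderiv ℝ κ (c⁻¹ • z)).comp
      (c⁻¹ • ContinuousLinearMap.id ℝ V))) z := by
    have h4 : HasFDerivAt (fun y : V => c⁻¹ • y) (c⁻¹ • ContinuousLinearMap.id ℝ V) z :=
      (hasFDerivAt_id z).const_smul c⁻¹
    have := ((h.differentiableAt h0).hasFDerivAt.comp z h4).const_mul (c ^ d)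
    exact this.congr_of_eventuallyEq (Filter.Eventually.of_forall fun y => congrFun hk y)
  rw [h3.fderiv, norm_smul, ContinuousLinearMap.comp_smul, ContinuousLinearMap.comp_id, norm_smul,
    norm_inv, Real.norm_of_nonneg hz'.le, Real.norm_of_nonneg (Real.rpow_nonneg hz'.le _),
    Real.rpow_sub_one hz'.ne']
  have : ‖fderiv ℝ κ (c⁻¹ • z)‖ ≤ |C| + 1 := by linarith [le_abs_self C]
  calc c ^ d * (c⁻¹ * ‖fderiv ℝ κ (c⁻¹ • z)‖) ≤ c ^ d * (c⁻¹ * (|C| + 1)) := by gcongr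
    _ = (|C| + 1) * (c ^ d / c) := by ring

variable {γ : ℝ}

/-- A kernel of degree between `γ + 1` and `γ + 2` is controlled by `|z|^γ (1 + |z|²)`. -/
lemma exists_abs_le_rpow (h : IsHomogeneousKernel d κ) (hd₁ : γ + 1 ≤ d) (hd₂ : d ≤ γ + 2) :
    ∃ C, 0 < C ∧ ∀ z, |κ z| ≤ C * (‖z‖ ^ γ * (1 + ‖z‖ ^ 2)) := by
  obtain ⟨C, hC0, hC⟩ := h.exists_abs_le
  refine ⟨C, hC0, fun z => ?_⟩
  by_cases hz : z = 0
  · rw [hz, h.map_zero, abs_zero]; positivity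
  have hz' : 0 < ‖z‖ := norm_pos_iff.2 hz
  refine (hC z).trans (mul_le_mul_of_nonneg_left ?_ hC0.le)
  rw [show d = γ + (d - γ) by ring, Real.rpow_add hz']
  refine mul_le_mul_of_nonneg_left ?_ (by positivity)
  rcases le_or_gt ‖z‖ 1 with h1 | h1
  · have : ‖z‖ ^ (d - γ) ≤ 1 := Real.rpow_le_one hz'.le h1 (by linarith)
    nlinarith
  · have : ‖z‖ ^ (d - γ) ≤ ‖z‖ ^ (2 : ℝ) :=
      Real.rpow_le_rpow_of_exponent_le h1.le (by linarith)
    rw [Real.rpow_two] at this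
    linarith

lemma integrable_mul (h : IsHomogeneousKernel d κ) (hγ₁ : -2 < γ) (hγ₂ : γ < 0)
    (hd₁ : γ + 1 ≤ d) (hd₂ : d ≤ γ + 2) {F : V → ℝ} (hF : Continuous F)
    (hi : Integrable fun v : V => bracket v ^ 2 * F v) (v : V) :
    Integrable fun w : V => κ (v - w) * F w := by
  obtain ⟨C, hC0, hC⟩ := h.exists_abs_le_rpow hd₁ hd₂
  have hFb : Continuous fun w : V => bracket w ^ 2 * F w := (continuous_bracket.pow 2).mul hF
  have key := (integrable_norm_rpow_mul hγ₁ hγ₂ hFb hi v).const_mul (C * (1 + 2 * bracket v ^ 2))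
  have hκ := h.measurable
  have hFm := hF.measurable
  refine key.mono (Measurable.aestronglyMeasurable (by fun_prop)) (ae_of_all _ fun w => ?_)
  simp only [norm_mul, Real.norm_eq_abs, abs_pow]
  rw [abs_of_pos (bracket_pos w), abs_of_nonneg (show 0 ≤ ‖v - w‖ ^ γ by positivity),
    abs_of_pos hC0, abs_of_pos (show 0 < 1 + 2 * bracket v ^ 2 by positivity)]
  have h1 : 1 + ‖v - w‖ ^ 2 ≤ (1 + 2 * bracket v ^ 2) * bracket w ^ 2 := by
    nlinarith [norm_sub_sq_le v w, one_le_bracket w]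
  calc |κ (v - w)| * |F w| ≤ C * (‖v - w‖ ^ γ * (1 + ‖v - w‖ ^ 2)) * |F w| := by
        gcongr; exact hC _
    _ ≤ C * (‖v - w‖ ^ γ * ((1 + 2 * bracket v ^ 2) * bracket w ^ 2)) * |F w| := by gcongr
    _ = _ := by ring

lemma locallyIntegrable (h : IsHomogeneousKernel d κ) (hγ₁ : -2 < γ) (hγ₂ : γ < 0)
    (hd₁ : γ + 1 ≤ d) (hd₂ : d ≤ γ + 2) : LocallyIntegrable κ := by
  obtain ⟨C, hC0, hC⟩ := h.exists_abs_le_rpow hd₁ hd₂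
  rw [locallyIntegrable_iff]
  intro K hK
  obtain ⟨R, hR0, hR⟩ := hK.isBounded.subset_closedBall_lt 0 0
  let b : ContDiffBump (0 : V) := ⟨R, R + 1, hR0, by linarith⟩
  have hb : Continuous b := b.continuous
  have hψ : Continuous fun z : V => b z * (1 + ‖z‖ ^ 2) := by fun_prop
  have hψc : HasCompactSupport fun z : V => b z * (1 + ‖z‖ ^ 2) := b.hasCompactSupport.mul_right
  obtain ⟨_, _, h1⟩ := exists_integral_norm_rpow_mul_le hγ₁ hγ₂ hψ hψc
  refine ((h1 0).1.const_mul C).integrableOn.mono'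
    h.measurable.aestronglyMeasurable ?_
  filter_upwards [ae_restrict_mem hK.measurableSet] with z hz
  rw [b.one_of_mem_closedBall (hR hz)]
  simpa using hC z

lemma norm_fderiv_le_of_half_le {C : ℝ} (hC0 : 0 < C)
    (hC : ∀ z, z ≠ 0 → ‖fderiv ℝ κ z‖ ≤ C * ‖z‖ ^ (d - 1)) (hγ₁ : -2 < γ) (hγ₂ : γ < 0)
    (hd₁ : γ + 1 ≤ d) (hd₂ : d ≤ γ + 2) {z : V} (hz : 1 / 2 ≤ ‖z‖) :
    ‖fderiv ℝ κ z‖ ≤ 4 * C * (1 + ‖z‖) := by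
  have hz0 : 0 < ‖z‖ := by linarith
  refine (hC z (norm_pos_iff.1 hz0)).trans ?_
  have : ‖z‖ ^ (d - 1) ≤ 4 * (1 + ‖z‖) := by
    rcases le_or_gt 1 ‖z‖ with h1 | h1
    · have := Real.rpow_le_rpow_of_exponent_le h1 (show d - 1 ≤ 1 by linarith)
      rw [Real.rpow_one] at this; linarith
    · have h2 : ‖z‖ ^ (d - 1) ≤ ‖z‖ ^ (-2 : ℝ) :=
        Real.rpow_le_rpow_of_exponent_ge hz0 h1.le (by linarith)
      have h3 : ‖z‖ ^ (-2 : ℝ) ≤ (1 / 2 : ℝ) ^ (-2 : ℝ) :=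
        Real.rpow_le_rpow_of_nonpos (by norm_num) hz (by norm_num)
      have h4 : (1 / 2 : ℝ) ^ (-2 : ℝ) = 4 := by
        rw [Real.rpow_neg (by norm_num), Real.rpow_two]; norm_num
      linarith
  nlinarith

/-- For `v` within `1/2` of `v₀` the singularity stays at distance at least `1/2` from the points
where `F` is nonzero. There the derivative of the kernel grows at most linearly, so `⟨w⟩² |F|`
dominates and one may differentiate under the integral. -/
lemma contDiffAt_integral_of_far (h : IsHomogeneousKernel d κ) (hγ₁ : -2 < γ) (hγ₂ : γ < 0)
    (hd₁ : γ + 1 ≤ d) (hd₂ : d ≤ γ + 2) {F : V → ℝ} (hF : Continuous F)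
    (hi : Integrable fun v : V => bracket v ^ 2 * F v) (v₀ : V)
    (hfar : ∀ w, ‖w - v₀‖ ≤ 1 → F w = 0) :
    ContDiffAt ℝ 1 (fun v => ∫ w, κ (v - w) * F w) v₀ := by
  obtain ⟨C, hC0, hC⟩ := h.exists_norm_fderiv_le
  have hκ := h.measurable
  have hFm := hF.measurable
  set s := Metric.ball v₀ (1 / 2)
  have hsep : ∀ v ∈ s, ∀ w, F w ≠ 0 → 1 / 2 ≤ ‖v - w‖ := fun v hv w hw => by
    have h1 : 1 < ‖w - v₀‖ := not_le.1 fun H => hw (hfar w H)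
    rw [Metric.mem_ball, dist_eq_norm] at hv
    have h2 : ‖w - v₀‖ ≤ ‖v - v₀‖ + ‖v - w‖ := by
      rw [show w - v₀ = (v - v₀) - (v - w) by abel]; exact norm_sub_le _ _
    linarith
  set F' : V → V → V →L[ℝ] ℝ := fun v w => F w • fderiv ℝ κ (v - w)
  set bd : V → ℝ := fun w => (4 * C * (2 * (2 + ‖v₀‖))) * ‖bracket w ^ 2 * F w‖
  have hbd : Integrable bd := hi.norm.const_mul _
  have hmeas : ∀ v, AEStronglyMeasurable (F' v) volume := fun v => by
    have h1 : Measurable fun w : V => fderiv ℝ κ (v - w) :=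
      (measurable_fderiv ℝ κ).comp (measurable_const.sub measurable_id)
    exact hF.aestronglyMeasurable.smul h1.aestronglyMeasurable
  have hbound : ∀ w, ∀ v ∈ s, ‖F' v w‖ ≤ bd w := fun w v hv => by
    by_cases hw : F w = 0
    · simp only [F', hw, zero_smul, norm_zero, bd, mul_zero, le_refl]
    have h1 := norm_fderiv_le_of_half_le hC0 hC hγ₁ hγ₂ hd₁ hd₂ (hsep v hv w hw)
    have h2 : 1 + ‖v - w‖ ≤ 2 * (2 + ‖v₀‖) * bracket w ^ 2 := by
      rw [Metric.mem_ball, dist_eq_norm] at hv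
      have h3 : ‖v - w‖ ≤ ‖v - v₀‖ + ‖v₀‖ + ‖w‖ := by
        rw [show v - w = (v - v₀) + v₀ - w by abel]
        exact (norm_sub_le _ _).trans (by gcongr; exact norm_add_le _ _)
      rw [bracket_sq]
      nlinarith [norm_nonneg w, norm_nonneg v₀, sq_nonneg (‖w‖ - 1), sq_nonneg ‖w‖,
        mul_nonneg (norm_nonneg v₀) (sq_nonneg ‖w‖)]
    simp only [F', bd, norm_smul, norm_mul, Real.norm_of_nonneg (sq_nonneg (bracket w))]
    calc ‖F w‖ * ‖fderiv ℝ κ (v - w)‖ ≤ ‖F w‖ * (4 * C * (2 * (2 + ‖v₀‖) * bracket w ^ 2)) := by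
          gcongr; exact h1.trans (by gcongr)
      _ = _ := by ring
  rw [contDiffAt_one_iff]
  refine ⟨fun v => ∫ w, F' v w, s, Metric.ball_mem_nhds _ (by norm_num), ?_, fun v hv => ?_⟩
  · refine continuousOn_of_dominated (fun v _ => hmeas v)
      (fun v hv => ae_of_all _ fun w => hbound w v hv) hbd (ae_of_all _ fun w => ?_)
    by_cases hw : F w = 0
    · simp only [F', hw, zero_smul]; exact continuousOn_const
    · have hc : ContinuousOn (fun v => fderiv ℝ κ (v - w)) s := by
        refine h.continuousOn_fderiv.comp (f := fun v : V => v - w) (by fun_prop) fun v hv => ?_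
        have := hsep v hv w hw
        exact norm_pos_iff.1 (by linarith)
      exact hc.const_smul (F w)
  · refine hasFDerivAt_integral_of_dominated_of_fderiv_le (F := fun v w => κ (v - w) * F w)
      (Metric.isOpen_ball.mem_nhds hv)
      (Filter.Eventually.of_forall fun v => Measurable.aestronglyMeasurable (by fun_prop))
      (h.integrable_mul hγ₁ hγ₂ hd₁ hd₂ hF hi v) (hmeas v)
      (ae_of_all _ hbound) hbd (ae_of_all _ fun w v hv => ?_)
    by_cases hw : F w = 0
    · simp only [F', hw, zero_smul, mul_zero]; exact hasFDerivAt_const _ _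
    · have hne : v - w ≠ 0 := by
        have := hsep v hv w hw
        exact norm_pos_iff.1 (by linarith)
      have h1 : HasFDerivAt (fun v : V => κ (v - w)) (fderiv ℝ κ (v - w)) v := by
        have := (h.differentiableAt hne).hasFDerivAt.comp v ((hasFDerivAt_id v).sub_const w)
        rwa [ContinuousLinearMap.comp_id] at this
      exact h1.mul_const (F w)

/-- The convolution of a smooth function of `L¹₂` with a homogeneous kernel is `C¹`. -/
lemma contDiff_integral (h : IsHomogeneousKernel d κ) (hγ₁ : -2 < γ) (hγ₂ : γ < 0)
    (hd₁ : γ + 1 ≤ d) (hd₂ : d ≤ γ + 2) {f : V → ℝ} (hf : ContDiff ℝ ∞ f)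
    (hi : Integrable fun v : V => bracket v ^ 2 * f v) :
    ContDiff ℝ 1 (fun v => ∫ w, κ (v - w) * f w) := by
  rw [contDiff_iff_contDiffAt]
  intro v₀
  let b : ContDiffBump v₀ := ⟨1, 2, one_pos, one_lt_two⟩
  have hb : ContDiff ℝ ∞ b := b.contDiff
  have hbc : Continuous b := b.continuous
  have hfc := hf.continuous
  have hb2 : ContDiff ℝ 1 fun w => b w * f w := (hb.mul hf).of_le (by simp)
  have hbcs : HasCompactSupport fun w => b w * f w := b.hasCompactSupport.mul_right
  have hbr := continuous_bracket
  have i1 : Integrable fun w : V => bracket w ^ 2 * (b w * f w) := by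
    refine Continuous.integrable_of_hasCompactSupport (by fun_prop) hbcs.mul_left
  have i2 : Integrable fun w : V => bracket w ^ 2 * ((1 - b w) * f w) := by
    refine (hi.sub i1).congr (ae_of_all _ fun w => ?_)
    simp only [Pi.sub_apply]; ring
  -- Near `v₀` the derivative is put on the smooth factor `b f`, since the kernel is only locally
  -- integrable; away from `v₀` it is put on the kernel.
  have hsplit : (fun v => ∫ w, κ (v - w) * f w) = fun v =>
      (∫ w, κ (v - w) * (b w * f w)) + ∫ w, κ (v - w) * ((1 - b w) * f w) := funext fun v => by
    rw [← integral_add (h.integrable_mul hγ₁ hγ₂ hd₁ hd₂ (by fun_prop) i1 v)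
      (h.integrable_mul hγ₁ hγ₂ hd₁ hd₂ (by fun_prop) i2 v)]
    congr 1; funext w; ring
  rw [hsplit]
  refine ContDiffAt.add ?_ (h.contDiffAt_integral_of_far hγ₁ hγ₂ hd₁ hd₂ (by fun_prop) i2 v₀
    fun w hw => ?_)
  · have := HasCompactSupport.contDiff_convolution_right (n := 1) (ContinuousLinearMap.mul ℝ ℝ)
      hbcs (h.locallyIntegrable hγ₁ hγ₂ hd₁ hd₂) hb2
    have e : (fun v => ∫ w, κ (v - w) * (b w * f w)) =
        convolution κ (fun w => b w * f w) (ContinuousLinearMap.mul ℝ ℝ) volume := funext fun v => by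
      rw [convolution, ← integral_sub_left_eq_self _ _ v]
      simp
    rw [e]
    exact this.contDiffAt
  · rw [b.one_of_mem_closedBall (by rwa [Metric.mem_closedBall, dist_eq_norm])]
    simp

end IsHomogeneousKernel

/-! ### The Landau kernels -/

lemma aKer_eq {γ : ℝ} (hγ : -2 < γ) (i j : Fin 3) (z : V) :
    aKer γ i j z = ‖z‖ ^ γ * ((if i = j then ‖z‖ ^ 2 else 0) - z i * z j) := by
  by_cases hz : z = 0
  · subst hz; simp [aKer, Real.zero_rpow (show γ + 2 ≠ 0 by linarith)]
  have h : 0 < ‖z‖ := norm_pos_iff.2 hz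
  rw [aKer, Real.rpow_add h, Real.rpow_two]
  split_ifs
  · field_simp
  · field_simp; ring

lemma contDiffAt_norm_rpow (p : ℝ) {z : V} (hz : z ≠ 0) :
    ContDiffAt ℝ 1 (fun z : V => ‖z‖ ^ p) z :=
  (contDiffAt_norm ℝ hz).rpow_const_of_ne (norm_ne_zero_iff.2 hz)

lemma contDiff_coord (i : Fin 3) : ContDiff ℝ 1 (fun z : V => z i) := by fun_prop

lemma isHomogeneousKernel_aKer {γ : ℝ} (hγ : -2 < γ) (i j : Fin 3) :
    IsHomogeneousKernel (γ + 2) (aKer γ i j) where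
  measurable := by
    have : aKer γ i j = fun z => ‖z‖ ^ γ * ((if i = j then ‖z‖ ^ 2 else 0) - z i * z j) :=
      funext (aKer_eq hγ i j)
    rw [this]
    split_ifs <;> fun_prop
  map_zero := by simp [aKer_eq hγ]
  contDiffOn z hz := by
    have : aKer γ i j = fun z => ‖z‖ ^ γ * ((if i = j then ‖z‖ ^ 2 else 0) - z i * z j) :=
      funext (aKer_eq hγ i j)
    rw [this]
    refine ContDiffAt.contDiffWithinAt ((contDiffAt_norm_rpow γ hz).mul (ContDiffAt.sub ?_
      ((contDiff_coord i).contDiffAt.mul (contDiff_coord j).contDiffAt)))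
    split_ifs
    · exact (contDiff_norm_sq ℝ).contDiffAt
    · exact contDiffAt_const
  homogeneous c hc z := by
    rw [aKer_eq hγ, aKer_eq hγ, norm_smul, Real.norm_of_nonneg hc.le,
      Real.mul_rpow hc.le (norm_nonneg z), Real.rpow_add hc, Real.rpow_two]
    simp only [PiLp.smul_apply, smul_eq_mul]
    split_ifs <;> ring

lemma isHomogeneousKernel_bKer {γ : ℝ} (i : Fin 3) :
    IsHomogeneousKernel (γ + 1) (bKer γ i) where
  measurable := by unfold bKer; fun_prop
  map_zero := by simp [bKer]
  contDiffOn z hz := ContDiffAt.contDiffWithinAt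
    ((contDiffAt_const.mul (contDiffAt_norm_rpow γ hz)).mul (contDiff_coord i).contDiffAt)
  homogeneous c hc z := by
    rw [bKer, bKer, norm_smul, Real.norm_of_nonneg hc.le,
      Real.mul_rpow hc.le (norm_nonneg z), Real.rpow_add hc, Real.rpow_one]
    simp only [PiLp.smul_apply, smul_eq_mul]
    ring

lemma sum_aKer_mul_mul {γ : ℝ} (hγ : -2 < γ) (z x y : V) :
    ∑ i, ∑ j, aKer γ i j z * x i * y j =
      ‖z‖ ^ γ * (‖z‖ ^ 2 * inner ℝ x y - inner ℝ z x * inner ℝ z y) := by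
  simp only [aKer_eq hγ, Fin.sum_univ_three, PiLp.inner_apply]
  simp
  ring

/-! ### Immediate consequences of the moment bound. -/

namespace IsDensity

variable {m₀ E₀ H₀ : ℝ} {f : V → ℝ}

lemma continuous (hf : IsDensity m₀ E₀ H₀ f) : Continuous f := hf.smooth.continuous

lemma integrable (hf : IsDensity m₀ E₀ H₀ f) : Integrable f :=
  integrable_of_bracket_sq_mul hf.continuous hf.moment_integrable

lemma mass_le_moment (hf : IsDensity m₀ E₀ H₀ f) : m₀ ≤ E₀ := by
  refine hf.mass_ge.trans (le_trans ?_ hf.moment_le)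
  exact integral_mono hf.integrable hf.moment_integrable fun v =>
    le_mul_of_one_le_left (hf.nonneg v) (one_le_pow₀ (one_le_bracket v))

end IsDensity

/-! ### Entropy prevents concentration -/

/-- Young's inequality for the convex conjugate pair `s log s - s` and `e^t`. -/
lemma mul_le_mul_log_sub_add_exp {s : ℝ} (hs : 0 ≤ s) (t : ℝ) :
    s * t ≤ s * Real.log s - s + Real.exp t := by
  rcases hs.eq_or_lt with rfl | hs
  · simp [Real.exp_nonneg]
  have h := Real.log_le_sub_one_of_pos (show 0 < Real.exp t / s by positivity)
  rw [Real.log_div (Real.exp_ne_zero t) hs.ne', Real.log_exp] at h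
  have h2 := mul_le_mul_of_nonneg_left h hs.le
  have h3 : s * (Real.exp t / s - 1) = Real.exp t - s := by field_simp
  nlinarith

lemma integrable_one_add_norm_rpow : Integrable fun v : V => (1 + ‖v‖) ^ (-4 : ℝ) :=
  integrable_one_add_norm (by simp; norm_num)

/-- Dividing by a large `L` shows that sets of small volume carry little mass. The entropy has no
sign, so its negative part must be controlled by the second moment. -/
lemma IsDensity.mul_setIntegral_le {m₀ E₀ H₀ : ℝ} {f : V → ℝ} (hf : IsDensity m₀ E₀ H₀ f)
    {A : Set V} (hA : MeasurableSet A) (hA' : volume A ≠ ⊤) (L : ℝ) :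
    L * ∫ v in A, f v ≤
      H₀ + 4 * E₀ + (∫ v : V, (1 + ‖v‖) ^ (-4 : ℝ)) + Real.exp L * (volume A).toReal := by
  have hpt : ∀ v : V, L * A.indicator f v ≤ f v * Real.log (f v) + 4 * (bracket v ^ 2 * f v) +
      (1 + ‖v‖) ^ (-4 : ℝ) + A.indicator (fun _ => Real.exp L) v := fun v => by
    have hv : (0 : ℝ) < 1 + ‖v‖ := by positivity
    set i := A.indicator (fun _ : V => (1 : ℝ)) v with hi
    have hif : A.indicator f v = i * f v := by
      by_cases h : v ∈ A <;> simp [hi, h]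
    have hie : A.indicator (fun _ : V => Real.exp L) v = i * Real.exp L := by
      by_cases h : v ∈ A <;> simp [hi, h]
    -- The choice `t = L 1_A - 4 log(1 + |v|)` turns the exponential into `e^{L 1_A}(1 + |v|)^{-4}`,
    -- integrable off `A` because `4 > 3`; the cost `4 f log(1 + |v|)` is at most `4 ⟨v⟩² f`.
    have h1 := mul_le_mul_log_sub_add_exp (hf.nonneg v) (L * i - 4 * Real.log (1 + ‖v‖))
    have h2 : Real.exp (L * i - 4 * Real.log (1 + ‖v‖)) =
        Real.exp (L * i) * (1 + ‖v‖) ^ (-4 : ℝ) := by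
      rw [Real.rpow_def_of_pos hv, ← Real.exp_add]; congr 1; ring
    have hp0 : 0 < (1 + ‖v‖) ^ (-4 : ℝ) := Real.rpow_pos_of_pos hv _
    have hp1 : (1 + ‖v‖) ^ (-4 : ℝ) ≤ 1 :=
      Real.rpow_le_one_of_one_le_of_nonpos (by linarith [norm_nonneg v]) (by norm_num)
    have h3 : Real.exp (L * i) * (1 + ‖v‖) ^ (-4 : ℝ) ≤ (1 + ‖v‖) ^ (-4 : ℝ) + i * Real.exp L := by
      by_cases h : v ∈ A
      · have : i = 1 := by simp [hi, h]
        rw [this, mul_one, one_mul]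
        nlinarith [Real.exp_pos L]
      · have : i = 0 := by simp [hi, h]
        simp [this]
    have h4 : Real.log (1 + ‖v‖) ≤ bracket v ^ 2 := by
      have := Real.log_le_sub_one_of_pos hv
      nlinarith [norm_le_bracket v, one_le_bracket v]
    have h5 := mul_le_mul_of_nonneg_left h4 (hf.nonneg v)
    rw [hif, hie]
    nlinarith [hf.nonneg v]
  have i1 := hf.integrable.indicator hA
  have i2 : Integrable (A.indicator fun _ : V => Real.exp L) :=
    (integrable_indicator_iff hA).2 (integrableOn_const hA')
  have i3 := integrable_one_add_norm_rpow
  have i4 := hf.moment_integrable.const_mul 4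
  have h := integral_mono (i1.const_mul L) (((hf.entropy_integrable.add i4).add i3).add i2) hpt
  rw [integral_const_mul, integral_indicator hA,
    integral_add' ((hf.entropy_integrable.add i4).add i3) i2,
    integral_add' (hf.entropy_integrable.add i4) i3, integral_add' hf.entropy_integrable i4,
    integral_const_mul, integral_indicator hA, setIntegral_const, smul_eq_mul, Measure.real] at h
  linarith [hf.entropy_le, hf.moment_le]

/-! ### Ellipticity of `a * f` -/

lemma measurableSet_slab (e : V) (p r R : ℝ) :
    MeasurableSet {w : V | ‖w‖ ≤ R ∧ |inner ℝ e w - p| ≤ r} :=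
  ((isClosed_le (f := fun w : V => ‖w‖) (by fun_prop) continuous_const).inter (isClosed_le
    (f := fun w : V => |inner ℝ e w - p|) (by fun_prop) continuous_const)).measurableSet

/-- In the coordinates of `b`, which preserve volume, the set lies in a box with sides `2R`, `2r`,
`2R`. -/
lemma volume_slab_le (b : OrthonormalBasis (Fin 3) ℝ V) (p : ℝ) {r R : ℝ} :
    volume {w : V | ‖w‖ ≤ R ∧ |inner ℝ (b 1) w - p| ≤ r} ≤
      ENNReal.ofReal (2 * R) * ENNReal.ofReal (2 * r) * ENNReal.ofReal (2 * R) := by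
  set l : Fin 3 → ℝ := ![-R, p - r, -R]
  set u : Fin 3 → ℝ := ![R, p + r, R]
  have hmp := (EuclideanSpace.volume_preserving_symm_measurableEquiv_toLp (Fin 3)).comp
    b.measurePreserving_repr
  have hsub : {w : V | ‖w‖ ≤ R ∧ |inner ℝ (b 1) w - p| ≤ r} ⊆
      ((MeasurableEquiv.toLp 2 (Fin 3 → ℝ)).symm ∘ b.repr) ⁻¹' Set.Icc l u := by
    rintro w ⟨h1, h2⟩
    have h3 : ∀ i, |inner ℝ (b i) w| ≤ R := fun i => by
      have := abs_real_inner_le_norm (b i) w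
      rw [b.norm_eq_one, one_mul] at this
      exact this.trans h1
    have h4 : ∀ i, ((MeasurableEquiv.toLp 2 (Fin 3 → ℝ)).symm ∘ b.repr) w i = inner ℝ (b i) w :=
      fun i => b.repr_apply_apply w i
    have e0 := abs_le.1 (h3 0)
    have e2 := abs_le.1 (h3 2)
    have e1 := abs_le.1 h2
    refine ⟨fun i => ?_, fun i => ?_⟩ <;> rw [h4] <;> fin_cases i <;> simp [l, u] <;> linarith
  refine (measure_mono hsub).trans ?_
  rw [hmp.measure_preimage measurableSet_Icc.nullMeasurableSet, Real.volume_Icc_pi,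
    Fin.prod_univ_three]
  simp only [l, u, Matrix.cons_val_zero, Matrix.cons_val_one, Matrix.cons_val]
  rw [show R - -R = 2 * R by ring, show p + r - (p - r) = 2 * r by ring]

lemma exists_orthonormalBasis_zero {u : V} (hu : ‖u‖ = 1) :
    ∃ b : OrthonormalBasis (Fin 3) ℝ V, b 0 = u := by
  have hv : Orthonormal ℝ (Set.domRestrict ({0} : Set (Fin 3)) fun _ : Fin 3 => u) := by
    refine ⟨fun i => hu, fun i j hij => absurd (Subsingleton.elim i j) hij⟩
  obtain ⟨b, hb⟩ := hv.exists_orthonormalBasis_extension_of_card_eq (by simp)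
  exact ⟨b, hb 0 rfl⟩

lemma sum_aBar_mul_mul {γ : ℝ} (hγ₁ : -2 < γ) (hγ₂ : γ < 0) {f : V → ℝ} (hf : Continuous f)
    (hi : Integrable fun v : V => bracket v ^ 2 * f v) (v x y : V) :
    Integrable (fun w => ‖v - w‖ ^ γ *
        (‖v - w‖ ^ 2 * inner ℝ x y - inner ℝ (v - w) x * inner ℝ (v - w) y) * f w) ∧
    ∑ i, ∑ j, aBar γ f i j v * x i * y j = ∫ w, ‖v - w‖ ^ γ *
      (‖v - w‖ ^ 2 * inner ℝ x y - inner ℝ (v - w) x * inner ℝ (v - w) y) * f w := by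
  have i1 : ∀ i j, Integrable fun w => aKer γ i j (v - w) * f w * (x i * y j) := fun i j =>
    ((isHomogeneousKernel_aKer hγ₁ i j).integrable_mul hγ₁ hγ₂ (by linarith) le_rfl hf hi v).mul_const _
  have e : ∀ w, ‖v - w‖ ^ γ *
      (‖v - w‖ ^ 2 * inner ℝ x y - inner ℝ (v - w) x * inner ℝ (v - w) y) * f w =
      ∑ i, ∑ j, aKer γ i j (v - w) * f w * (x i * y j) := fun w => by
    rw [← sum_aKer_mul_mul hγ₁, Finset.sum_mul]
    refine Finset.sum_congr rfl fun i _ => ?_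
    rw [Finset.sum_mul]
    exact Finset.sum_congr rfl fun j _ => by ring
  have i2 : ∀ i, Integrable fun w => ∑ j, aKer γ i j (v - w) * f w * (x i * y j) := fun i =>
    integrable_finsetSum _ fun j _ => i1 i j
  simp_rw [e]
  refine ⟨integrable_finsetSum _ fun i _ => i2 i, ?_⟩
  rw [integral_finsetSum _ fun i _ => i2 i]
  refine Finset.sum_congr rfl fun i _ => ?_
  rw [integral_finsetSum _ fun j _ => i1 i j]
  refine Finset.sum_congr rfl fun j _ => ?_
  rw [integral_mul_const, aBar]; ring

/-- The matrix `a * f` is uniformly elliptic, with weight `⟨v⟩^γ`. -/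
lemma exists_aBar_ge {γ : ℝ} (hγ₁ : -2 < γ) (hγ₂ : γ < 0) {m₀ : ℝ} (hm₀ : 0 < m₀) (E₀ H₀ : ℝ) :
    ∃ K, 0 < K ∧ ∀ f : V → ℝ, IsDensity m₀ E₀ H₀ f → ∀ v ξ : V,
      K * bracket v ^ γ * ‖ξ‖ ^ 2 ≤ ∑ i, ∑ j, aBar γ f i j v * ξ i * ξ j := by
  by_cases hE : m₀ ≤ E₀
  swap
  · exact ⟨1, one_pos, fun f hf => absurd hf.mass_le_moment hE⟩
  set c₀ : ℝ := ∫ v : V, (1 + ‖v‖) ^ (-4 : ℝ)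
  have hc₀ : 0 ≤ c₀ := integral_nonneg fun v => by positivity
  -- By Chebyshev, mass at most `m₀/4` lies outside the ball of radius `R`. The values of `L` and
  -- `r` make `e^L · 8R²r = 1`, so the slab too carries at most `m₀/4`, leaving mass at least `m₀/2`
  -- for the lower bound.
  set R : ℝ := Real.sqrt (4 * E₀ / m₀) with hR
  have hE0 : 0 < E₀ := hm₀.trans_le hE
  have hR0 : 0 < R := Real.sqrt_pos.2 (by positivity)
  have hR2 : R ^ 2 = 4 * E₀ / m₀ := Real.sq_sqrt (by positivity)
  set L : ℝ := 4 * (|H₀| + 4 * E₀ + c₀ + 1) / m₀ with hL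
  have hL0 : 0 < L := by positivity
  set r : ℝ := Real.exp (-L) / (8 * R ^ 2) with hr
  have hr0 : 0 < r := by positivity
  set κ : ℝ := (2 * (1 + R ^ 2)) ^ (γ / 2) * r ^ 2 with hκ
  have hκ0 : 0 < κ := by positivity
  refine ⟨κ * (m₀ / 2), by positivity, fun f hf v ξ => ?_⟩
  by_cases hξ : ξ = 0
  · simp [hξ]
  have hξ0 : 0 < ‖ξ‖ := norm_pos_iff.2 hξ
  obtain ⟨b, hb⟩ := exists_orthonormalBasis_zero (u := ‖ξ‖⁻¹ • ξ)
    (by rw [norm_smul, norm_inv, norm_norm, inv_mul_cancel₀ hξ0.ne'])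
  set A : Set V := {w : V | ‖w‖ ≤ R ∧ |inner ℝ (b 1) w - inner ℝ (b 1) v| ≤ r} with hA
  have hAm : MeasurableSet A := measurableSet_slab _ _ _ _
  have hAv := volume_slab_le b (inner ℝ (b 1) v) (r := r) (R := R)
  rw [← ENNReal.ofReal_mul (by positivity), ← ENNReal.ofReal_mul (by positivity)] at hAv
  have hAt : volume A ≠ ⊤ := (hAv.trans_lt ENNReal.ofReal_lt_top).ne
  have hAr : (volume A).toReal ≤ 8 * R ^ 2 * r := by
    have := ENNReal.toReal_mono ENNReal.ofReal_ne_top hAv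
    rw [ENNReal.toReal_ofReal (by positivity)] at this
    linarith
  have hAf : ∫ w in A, f w ≤ m₀ / 4 := by
    have h1 := hf.mul_setIntegral_le hAm hAt L
    have h2 : Real.exp L * (volume A).toReal ≤ 1 := by
      calc Real.exp L * (volume A).toReal ≤ Real.exp L * (8 * R ^ 2 * r) := by gcongr
        _ = Real.exp L * Real.exp (-L) := by rw [hr]; field_simp
        _ = 1 := by rw [← Real.exp_add]; simp
    have h3 : L * (m₀ / 4) = |H₀| + 4 * E₀ + c₀ + 1 := by rw [hL]; field_simp
    have h4 : L * ∫ w in A, f w ≤ L * (m₀ / 4) := by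
      rw [h3]; linarith [le_abs_self H₀]
    exact le_of_mul_le_mul_left h4 hL0
  obtain ⟨i1, e1⟩ := sum_aBar_mul_mul hγ₁ hγ₂ hf.continuous hf.moment_integrable v ξ ξ
  have i2 := hf.integrable.indicator hAm
  have i3 := hf.moment_integrable.const_mul (R ^ 2)⁻¹
  have i4 := ((hf.integrable.sub i3).sub i2).const_mul (κ * bracket v ^ γ * ‖ξ‖ ^ 2)
  have hc : 0 ≤ κ * bracket v ^ γ * ‖ξ‖ ^ 2 := by
    have := bracket_rpow_pos γ v; positivity
  -- The quadratic form of `a(z)` sees only the components of `z` orthogonal to `ξ`. Bounding one of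
  -- them below is enough, so avoiding a slab replaces avoiding a cylinder around the line through
  -- `v` along `ξ`.
  have hquad : ∀ z : V, ‖z‖ ^ 2 * inner ℝ ξ ξ - inner ℝ z ξ * inner ℝ z ξ =
      ‖ξ‖ ^ 2 * (inner ℝ (b 1) z ^ 2 + inner ℝ (b 2) z ^ 2) := fun z => by
    have h1 := b.sum_sq_inner_right z
    rw [Fin.sum_univ_three, hb, real_inner_smul_left] at h1
    rw [real_inner_self_eq_norm_sq, ← h1, real_inner_comm z ξ]
    field_simp; ring
  -- The bracketed difference is at most `f w` everywhere, and nonpositive on the slab and outside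
  -- the ball; its integral is at least `m₀/2`.
  have hpt : ∀ w, κ * bracket v ^ γ * ‖ξ‖ ^ 2 *
      (f w - (R ^ 2)⁻¹ * (bracket w ^ 2 * f w) - A.indicator f w) ≤
      ‖v - w‖ ^ γ * (‖v - w‖ ^ 2 * inner ℝ ξ ξ - inner ℝ (v - w) ξ * inner ℝ (v - w) ξ) * f w :=
    fun w => by
    have hfw := hf.nonneg w
    rw [hquad]
    have hrhs : 0 ≤ ‖v - w‖ ^ γ *
        (‖ξ‖ ^ 2 * (inner ℝ (b 1) (v - w) ^ 2 + inner ℝ (b 2) (v - w) ^ 2)) * f w := by positivity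
    have hind : 0 ≤ A.indicator f w := Set.indicator_nonneg (fun _ _ => hf.nonneg _) _
    have hRb : 0 ≤ (R ^ 2)⁻¹ * (bracket w ^ 2 * f w) := by positivity
    by_cases hwA : w ∈ A
    · rw [Set.indicator_of_mem hwA]
      refine le_trans (mul_nonpos_of_nonneg_of_nonpos hc (by linarith)) hrhs
    rcases le_or_gt ‖w‖ R with hw | hw
    swap
    · refine le_trans (mul_nonpos_of_nonneg_of_nonpos hc ?_) hrhs
      have h1 : 1 ≤ (R ^ 2)⁻¹ * bracket w ^ 2 := by
        rw [inv_mul_eq_div, one_le_div (by positivity)]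
        exact pow_le_pow_left₀ hR0.le (hw.le.trans (norm_le_bracket w)) 2
      have h2 := mul_le_mul_of_nonneg_right h1 hfw
      linarith
    have hr1 : r < |inner ℝ (b 1) w - inner ℝ (b 1) v| := not_le.1 fun H => hwA ⟨hw, H⟩
    have hr2 : r ^ 2 ≤ inner ℝ (b 1) (v - w) ^ 2 := by
      rw [inner_sub_right, ← sq_abs (_ - _), abs_sub_comm]
      exact pow_le_pow_left₀ hr0.le hr1.le 2
    have hz0 : 0 < ‖v - w‖ := by
      rw [norm_pos_iff]; intro h0
      rw [h0, inner_zero_right] at hr2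
      nlinarith
    have hzγ : bracket v ^ γ * (2 * (1 + R ^ 2)) ^ (γ / 2) ≤ ‖v - w‖ ^ γ := by
      have h1 : ‖v - w‖ ^ γ = (‖v - w‖ ^ 2) ^ (γ / 2) := by
        rw [← Real.rpow_natCast, ← Real.rpow_mul hz0.le]; congr 1; push_cast; ring
      have h2 : bracket v ^ γ = (bracket v ^ 2) ^ (γ / 2) := by
        rw [← Real.rpow_natCast, ← Real.rpow_mul (bracket_pos v).le]; congr 1; push_cast; ring
      rw [h1, h2, ← Real.mul_rpow (by positivity) (by positivity)]
      refine Real.rpow_le_rpow_of_nonpos (by positivity) ?_ (by linarith)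
      have h3 : bracket w ^ 2 ≤ 1 + R ^ 2 := by
        rw [bracket_sq]; gcongr
      calc ‖v - w‖ ^ 2 ≤ 2 * bracket v ^ 2 * bracket w ^ 2 := norm_sub_sq_le v w
        _ ≤ 2 * bracket v ^ 2 * (1 + R ^ 2) := by gcongr
        _ = _ := by ring
    calc κ * bracket v ^ γ * ‖ξ‖ ^ 2 *
          (f w - (R ^ 2)⁻¹ * (bracket w ^ 2 * f w) - A.indicator f w)
        ≤ κ * bracket v ^ γ * ‖ξ‖ ^ 2 * f w := mul_le_mul_of_nonneg_left (by linarith) hc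
      _ = (bracket v ^ γ * (2 * (1 + R ^ 2)) ^ (γ / 2)) * (‖ξ‖ ^ 2 * r ^ 2) * f w := by
          rw [hκ]; ring
      _ ≤ ‖v - w‖ ^ γ *
          (‖ξ‖ ^ 2 * (inner ℝ (b 1) (v - w) ^ 2 + inner ℝ (b 2) (v - w) ^ 2)) * f w := by
          gcongr
          nlinarith [sq_nonneg (inner ℝ (b 2) (v - w))]
  rw [e1]
  refine le_trans ?_ (integral_mono i4 i1 hpt)
  rw [integral_const_mul, integral_sub' (hf.integrable.sub i3) i2, integral_sub' hf.integrable i3,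
    integral_const_mul, integral_indicator hAm]
  have h5 : (R ^ 2)⁻¹ * ∫ w, bracket w ^ 2 * f w ≤ m₀ / 4 := by
    calc (R ^ 2)⁻¹ * ∫ w, bracket w ^ 2 * f w ≤ (R ^ 2)⁻¹ * E₀ := by gcongr; exact hf.moment_le
      _ = m₀ / 4 := by rw [hR2]; field_simp
  have h6 : m₀ / 2 ≤ (∫ w, f w) - (R ^ 2)⁻¹ * (∫ w, bracket w ^ 2 * f w) - ∫ w in A, f w := by
    linarith [hf.mass_ge]
  calc κ * (m₀ / 2) * bracket v ^ γ * ‖ξ‖ ^ 2 = κ * bracket v ^ γ * ‖ξ‖ ^ 2 * (m₀ / 2) := by ring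
    _ ≤ _ := mul_le_mul_of_nonneg_left h6 hc

/-! ### Integration by parts against a fixed singularity -/

lemma inner_sub_self_eq (u w : V) :
    inner ℝ (u - w) u = (‖u - w‖ ^ 2 + ‖u‖ ^ 2 - ‖w‖ ^ 2) * (1 / 2) := by
  simp only [norm_sq_eq_coord, PiLp.inner_apply, Fin.sum_univ_three, PiLp.sub_apply]
  simp; ring

lemma hasPd_inner_sub_self (w v : V) (i : Fin 3) :
    HasPd i (fun u : V => inner ℝ (u - w) u) (v i + (v i - w i)) v := by
  simp_rw [inner_sub_self_eq]
  refine ((((hasPd_norm_sub_sq w).add hasPd_norm_sq).sub (hasPd_const (‖w‖ ^ 2))).mul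
    (hasPd_const (1 / 2))).congr_deriv ?_
  ring

/-- The quantity `|v|²|w|² - (v·w)²`. -/
noncomputable def gramDet (v w : V) : ℝ := ‖v‖ ^ 2 * ‖w‖ ^ 2 - inner ℝ v w ^ 2

lemma gramDet_nonneg (v w : V) : 0 ≤ gramDet v w := by
  have := abs_real_inner_le_norm v w
  have h := pow_le_pow_left₀ (abs_nonneg _) this 2
  rw [sq_abs, mul_pow] at h
  rw [gramDet]; linarith

lemma gramDet_le (v w : V) : gramDet v w ≤ bracket v ^ 2 * bracket w ^ 2 := by
  rw [gramDet, bracket_sq, bracket_sq]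
  nlinarith [sq_nonneg (inner ℝ v w), sq_nonneg ‖v‖, sq_nonneg ‖w‖]

/-- The field `½ (a(z) ∇φ - b(z) φ) / |z|^γ`, where `φ(v) = Φ(1 + |v|²)` and `z = v - w`. -/
noncomputable def radialField (Φ : ℝ → ℝ) (w : V) (i : Fin 3) (v : V) : ℝ :=
  Φ (1 + ‖v‖ ^ 2) * (v i - w i) +
    deriv Φ (1 + ‖v‖ ^ 2) * (‖v - w‖ ^ 2 * v i - (v i - w i) * inner ℝ (v - w) v)

lemma hasPd_comp_one_add_norm_sq {Φ : ℝ → ℝ} (hΦ : Differentiable ℝ Φ) (v : V) (i : Fin 3) :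
    HasPd i (fun u : V => Φ (1 + ‖u‖ ^ 2)) (deriv Φ (1 + ‖v‖ ^ 2) * (2 * v i)) v :=
  (HasPd.comp (φ := Φ) (h₁ := fun u : V => 1 + ‖u‖ ^ 2) (hΦ _).hasDerivAt
    ((hasPd_const (1 : ℝ)).add (hasPd_norm_sq (i := i) (v := v)))).congr_deriv (by ring)

lemma differentiable_of_smooth {Φ : ℝ → ℝ} (hΦ : ContDiff ℝ ∞ Φ) : Differentiable ℝ Φ :=
  hΦ.differentiable (by simp)

lemma contDiff_deriv {Φ : ℝ → ℝ} (hΦ : ContDiff ℝ ∞ Φ) : ContDiff ℝ ∞ (deriv Φ) :=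
  (contDiff_infty_iff_deriv.1 hΦ).2

lemma hasPd_reg_radialField {Φ : ℝ → ℝ} (hΦ : ContDiff ℝ ∞ Φ) (γ : ℝ) {η : ℝ} (hη : 0 < η)
    (w v : V) (i : Fin 3) :
    HasPd i (fun u => (η + ‖u - w‖ ^ 2) ^ (γ / 2) * radialField Φ w i u)
      (γ * (η + ‖v - w‖ ^ 2) ^ (γ / 2 - 1) * (v i - w i) * radialField Φ w i v +
        (η + ‖v - w‖ ^ 2) ^ (γ / 2) *
        (deriv Φ (1 + ‖v‖ ^ 2) * (2 * v i) * (v i - w i) + Φ (1 + ‖v‖ ^ 2) +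
          deriv (deriv Φ) (1 + ‖v‖ ^ 2) * (2 * v i) *
            (‖v - w‖ ^ 2 * v i - (v i - w i) * inner ℝ (v - w) v) +
          deriv Φ (1 + ‖v‖ ^ 2) * (2 * (v i - w i) * v i + ‖v - w‖ ^ 2 - inner ℝ (v - w) v -
            (v i - w i) * (v i + (v i - w i))))) v := by
  have ht : 0 < η + ‖v - w‖ ^ 2 := by positivity
  have h1 := HasPd.comp (φ := fun t : ℝ => t ^ (γ / 2)) (h₁ := fun u : V => η + ‖u - w‖ ^ 2)
    (Real.hasDerivAt_rpow_const (p := γ / 2) (Or.inl ht.ne'))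
    ((hasPd_const η).add (hasPd_norm_sub_sq (i := i) (v := v) w))
  have hz : HasPd i (fun u : V => u i - w i) 1 v :=
    ((hasPd_coord i).sub (hasPd_const (w i))).congr_deriv (by simp)
  have hv : HasPd i (fun u : V => u i) 1 v := (hasPd_coord i).congr_deriv (by simp)
  have h2 := hasPd_comp_one_add_norm_sq (differentiable_of_smooth hΦ) v i
  have h3 := hasPd_comp_one_add_norm_sq (differentiable_of_smooth (contDiff_deriv hΦ)) v i
  refine (h1.mul ((h2.mul hz).add (h3.mul (((hasPd_norm_sub_sq w).mul hv).sub
    (hz.mul (hasPd_inner_sub_self w v i)))))).congr_deriv ?_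
  simp only [radialField]
  ring

/-- The vector `|z|² v - (z·v) z` is orthogonal to `z`, so differentiating the regularized power
only meets the part `Φ z` of the field; this produces the single term with factor `γ`. The terms in
`Φ'` proportional to `z·v` cancel, and the Gram determinant of `v` and `z` equals that of `v` and
`w`. -/
lemma sum_pd_reg_radialField {Φ : ℝ → ℝ} (hΦ : ContDiff ℝ ∞ Φ) (γ : ℝ) {η : ℝ} (hη : 0 < η)
    (w v : V) :
    ∑ i, pd i (fun u => (η + ‖u - w‖ ^ 2) ^ (γ / 2) * radialField Φ w i u) v =
      (η + ‖v - w‖ ^ 2) ^ (γ / 2) * (3 * Φ (1 + ‖v‖ ^ 2) +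
        2 * deriv Φ (1 + ‖v‖ ^ 2) * ‖v - w‖ ^ 2 +
        2 * deriv (deriv Φ) (1 + ‖v‖ ^ 2) * gramDet v w) +
      (η + ‖v - w‖ ^ 2) ^ (γ / 2) * (‖v - w‖ ^ 2 / (η + ‖v - w‖ ^ 2)) *
        (γ * Φ (1 + ‖v‖ ^ 2)) := by
  have ht : 0 < η + ‖v - w‖ ^ 2 := by positivity
  simp_rw [fun i => (hasPd_reg_radialField hΦ γ hη w v i).2]
  rw [Real.rpow_sub_one ht.ne']
  set s := (η + ‖v - w‖ ^ 2) ^ (γ / 2)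
  set t := η + ‖v - w‖ ^ 2
  rw [show s * (‖v - w‖ ^ 2 / t) * (γ * Φ (1 + ‖v‖ ^ 2)) =
    (s / t) * (‖v - w‖ ^ 2 * (γ * Φ (1 + ‖v‖ ^ 2))) by ring]
  set s' := s / t
  simp only [radialField, gramDet]
  set A := Φ (1 + ‖v‖ ^ 2)
  set A' := deriv Φ (1 + ‖v‖ ^ 2)
  set A'' := deriv (deriv Φ) (1 + ‖v‖ ^ 2)
  simp only [norm_sq_eq_coord, PiLp.inner_apply, Fin.sum_univ_three, PiLp.sub_apply]
  simp only [RCLike.inner_apply, conj_trivial]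
  ring

lemma continuous_radialField {Φ : ℝ → ℝ} (hΦ : ContDiff ℝ ∞ Φ) (w : V) (i : Fin 3) :
    Continuous (radialField Φ w i) := by
  have h1 := hΦ.continuous
  have h2 := (contDiff_deriv hΦ).continuous
  unfold radialField
  fun_prop

lemma contDiff_radialField {Φ : ℝ → ℝ} (hΦ : ContDiff ℝ ∞ Φ) (w : V) (i : Fin 3) :
    ContDiff ℝ 1 (radialField Φ w i) := by
  have h0 : ContDiff ℝ 1 fun v : V => 1 + ‖v‖ ^ 2 := contDiff_const.add (contDiff_norm_sq ℝ)
  have h1 : ContDiff ℝ 1 fun v : V => Φ (1 + ‖v‖ ^ 2) := (hΦ.of_le (by simp)).comp h0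
  have h2 : ContDiff ℝ 1 fun v : V => deriv Φ (1 + ‖v‖ ^ 2) :=
    ((contDiff_deriv hΦ).of_le (by simp)).comp h0
  have h3 : ContDiff ℝ 1 fun v : V => v i - w i := (contDiff_coord i).sub contDiff_const
  have h4 : ContDiff ℝ 1 fun v : V => v - w := contDiff_id.sub contDiff_const
  exact (h1.mul h3).add (h2.mul (((h4.norm_sq ℝ).mul (contDiff_coord i)).sub
    (h3.mul (h4.inner ℝ contDiff_id))))

/-- The support condition that makes `v ↦ Φ(1 + |v|²)` compactly supported. -/
def VanishesAbove (Φ : ℝ → ℝ) (ρ : ℝ) : Prop := ∀ r, ρ ≤ r → Φ r = 0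

lemma VanishesAbove.deriv {Φ : ℝ → ℝ} {ρ : ℝ} (h : VanishesAbove Φ ρ) :
    VanishesAbove (deriv Φ) (ρ + 1) := fun r hr => by
  have : Φ =ᶠ[nhds r] fun _ => 0 := by
    filter_upwards [lt_mem_nhds (show ρ < r by linarith)] with x hx using h x hx.le
  rw [this.deriv_eq]; simp

lemma VanishesAbove.hasCompactSupport {Φ : ℝ → ℝ} {ρ : ℝ} (h : VanishesAbove Φ ρ) :
    HasCompactSupport fun v : V => Φ (1 + ‖v‖ ^ 2) := by
  refine HasCompactSupport.intro (isCompact_closedBall (0 : V) (1 + |ρ|)) fun v hv => h _ ?_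
  rw [Metric.mem_closedBall, dist_zero_right, not_le] at hv
  nlinarith [le_abs_self ρ, abs_nonneg ρ]

lemma hasCompactSupport_radialField {Φ : ℝ → ℝ} {ρ : ℝ} (h : VanishesAbove Φ ρ) (w : V)
    (i : Fin 3) : HasCompactSupport (radialField Φ w i) :=
  h.hasCompactSupport.mul_right.add h.deriv.hasCompactSupport.mul_right

lemma ae_ne (w : V) : ∀ᵐ v : V, v ≠ w := by
  rw [ae_iff]; simp

lemma norm_rpow_eq_sq_rpow (γ : ℝ) (z : V) : ‖z‖ ^ γ = (‖z‖ ^ 2) ^ (γ / 2) := by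
  rw [← Real.rpow_natCast, ← Real.rpow_mul (norm_nonneg z)]; congr 1; push_cast; ring

lemma reg_rpow_le {γ η : ℝ} (hγ : γ < 0) (hη : 0 < η) {z : V} (hz : z ≠ 0) :
    (η + ‖z‖ ^ 2) ^ (γ / 2) ≤ ‖z‖ ^ γ := by
  rw [norm_rpow_eq_sq_rpow]
  have := norm_pos_iff.2 hz
  exact Real.rpow_le_rpow_of_nonpos (by positivity) (by linarith) (by linarith)

/-- Dominated convergence for regularizations of `|v - w|^γ`; the point `v = w` is negligible and
excluded from the hypotheses. -/
lemma tendsto_integral_of_le_norm_rpow {γ : ℝ} (hγ₁ : -2 < γ) (hγ₂ : γ < 0) {ψ : V → ℝ}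
    (hψ : Continuous ψ) (hc : HasCompactSupport ψ) (w : V) {θ : ℕ → V → ℝ}
    (hm : ∀ n, Measurable (θ n)) (hle : ∀ n v, v ≠ w → |θ n v| ≤ ‖v - w‖ ^ γ)
    (hlim : ∀ v, v ≠ w → Filter.Tendsto (fun n => θ n v) Filter.atTop (nhds (‖v - w‖ ^ γ))) :
    Filter.Tendsto (fun n => ∫ v, θ n v * ψ v) Filter.atTop
      (nhds (∫ v, ‖v - w‖ ^ γ * ψ v)) := by
  obtain ⟨C, -, hC⟩ := exists_integral_norm_rpow_mul_le hγ₁ hγ₂ hψ hc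
  refine tendsto_integral_of_dominated_convergence _
    (fun n => ((hm n).mul hψ.measurable).aestronglyMeasurable) (hC w).1.norm (fun n => ?_) ?_
  · filter_upwards [ae_ne w] with v hv
    rw [norm_mul, norm_mul, Real.norm_of_nonneg (show 0 ≤ ‖v - w‖ ^ γ by positivity)]
    exact mul_le_mul_of_nonneg_right (hle n v hv) (norm_nonneg _)
  · filter_upwards [ae_ne w] with v hv using (hlim v hv).mul_const _

/-- The divergence theorem across the singularity: integrate by parts with `η + |v - w|²` in place
of `|v - w|²`, then let `η → 0`. No boundary term appears, as `|v - w|^γ` is locally integrable. -/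
lemma integral_norm_rpow_mul_radialField {γ : ℝ} (hγ₁ : -2 < γ) (hγ₂ : γ < 0) {Φ : ℝ → ℝ}
    (hΦ : ContDiff ℝ ∞ Φ) {ρ : ℝ} (hρ : VanishesAbove Φ ρ) {G : V → ℝ} (hG : ContDiff ℝ 1 G)
    (w : V) :
    ∫ v, ‖v - w‖ ^ γ * (∑ i, radialField Φ w i v * pd i G v) =
      -∫ v, ‖v - w‖ ^ γ * (((γ + 3) * Φ (1 + ‖v‖ ^ 2) + 2 * deriv Φ (1 + ‖v‖ ^ 2) * ‖v - w‖ ^ 2 +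
        2 * deriv (deriv Φ) (1 + ‖v‖ ^ 2) * gramDet v w) * G v) := by
  have hc0 := hΦ.continuous
  have hc1 := (contDiff_deriv hΦ).continuous
  have hc2 := (contDiff_deriv (contDiff_deriv hΦ)).continuous
  have hGc := hG.continuous
  set ψ₀ : V → ℝ := fun v => ∑ i, radialField Φ w i v * pd i G v with hψ₀
  -- The parts with factors `3` and `γ` are kept apart: before the limit they carry different
  -- kernels, `s n` and `s' n`, both tending to `|v - w|^γ`.
  set ψ₁ : V → ℝ := fun v => (3 * Φ (1 + ‖v‖ ^ 2) + 2 * deriv Φ (1 + ‖v‖ ^ 2) * ‖v - w‖ ^ 2 +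
        2 * deriv (deriv Φ) (1 + ‖v‖ ^ 2) * gramDet v w) * G v with hψ₁
  set ψ₂ : V → ℝ := fun v => γ * Φ (1 + ‖v‖ ^ 2) * G v with hψ₂
  have c0 : Continuous ψ₀ := continuous_finsetSum _ fun i _ =>
    (continuous_radialField hΦ w i).mul (continuous_pd hG i)
  have c1 : Continuous ψ₁ := by simp only [hψ₁, gramDet]; fun_prop
  have c2 : Continuous ψ₂ := by fun_prop
  have k0 : HasCompactSupport ψ₀ := by
    simp only [hψ₀, Fin.sum_univ_three]
    exact ((hasCompactSupport_radialField hρ w 0).mul_right.add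
      (hasCompactSupport_radialField hρ w 1).mul_right).add
      (hasCompactSupport_radialField hρ w 2).mul_right
  have k1 : HasCompactSupport ψ₁ :=
    ((hρ.hasCompactSupport.mul_left.add hρ.deriv.hasCompactSupport.mul_left.mul_right).add
      hρ.deriv.deriv.hasCompactSupport.mul_left.mul_right).mul_right
  have k2 : HasCompactSupport ψ₂ := hρ.hasCompactSupport.mul_left.mul_right
  set η : ℕ → ℝ := fun n => 1 / ((n : ℝ) + 1) with hη
  have hη0 : ∀ n, 0 < η n := fun n => Nat.one_div_pos_of_nat
  have hηlim : Filter.Tendsto η Filter.atTop (nhds 0) := tendsto_one_div_add_atTop_nhds_zero_nat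
  set s : ℕ → V → ℝ := fun n v => (η n + ‖v - w‖ ^ 2) ^ (γ / 2) with hs
  set s' : ℕ → V → ℝ := fun n v => s n v * (‖v - w‖ ^ 2 / (η n + ‖v - w‖ ^ 2)) with hs'
  have ht : ∀ n (v : V), 0 < η n + ‖v - w‖ ^ 2 := fun n v => by have := hη0 n; positivity
  have hsc : ∀ n, Continuous (s n) := fun n =>
    Continuous.rpow_const (by fun_prop) fun v => Or.inl (ht n v).ne'
  have hs'c : ∀ n, Continuous (s' n) := fun n =>
    (hsc n).mul (Continuous.div (by fun_prop) (by fun_prop) fun v => (ht n v).ne')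
  have hs0 : ∀ n v, 0 ≤ s n v := fun n v => Real.rpow_nonneg (ht n v).le _
  have ibp : ∀ n, ∫ v, s n v * ψ₀ v = -((∫ v, s n v * ψ₁ v) + ∫ v, s' n v * ψ₂ v) := fun n => by
    set Y : Fin 3 → V → ℝ := fun i u => s n u * radialField Φ w i u with hY
    have hYd : ∀ i, ContDiff ℝ 1 (Y i) := fun i => by
      refine ContDiff.mul ?_ (contDiff_radialField hΦ w i)
      refine ContDiff.rpow_const_of_ne ?_ fun v => (ht n v).ne'
      exact contDiff_const.add ((contDiff_id.sub contDiff_const).norm_sq ℝ)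
    have hYc : ∀ i, HasCompactSupport (Y i) := fun i =>
      (hasCompactSupport_radialField hρ w i).mul_left
    have i1 : ∀ i, Integrable fun v => pd i (Y i) v * G v := fun i =>
      ((continuous_pd (hYd i) i).mul hGc).integrable_of_hasCompactSupport
        (hasCompactSupport_pd (hYc i) i).mul_right
    have i2 : ∀ i, Integrable fun v => Y i v * pd i G v := fun i =>
      ((hYd i).continuous.mul (continuous_pd hG i)).integrable_of_hasCompactSupport (hYc i).mul_right
    have i3 : ∀ i, Integrable fun v => Y i v * G v := fun i =>
      ((hYd i).continuous.mul hGc).integrable_of_hasCompactSupport (hYc i).mul_right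
    have e : ∀ i, ∫ v, Y i v * pd i G v = -∫ v, pd i (Y i) v * G v := fun i =>
      integral_mul_pd i (i1 i) (i2 i) (i3 i) ((hYd i).differentiable (by simp))
        (hG.differentiable (by simp))
    have j1 : Integrable fun v => s n v * ψ₁ v :=
      ((hsc n).mul c1).integrable_of_hasCompactSupport k1.mul_left
    have j2 : Integrable fun v => s' n v * ψ₂ v :=
      ((hs'c n).mul c2).integrable_of_hasCompactSupport k2.mul_left
    calc ∫ v, s n v * ψ₀ v = ∫ v, ∑ i, Y i v * pd i G v := by
          congr 1; funext v
          simp only [hψ₀, hY, Finset.mul_sum, mul_assoc]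
      _ = -∑ i, ∫ v, pd i (Y i) v * G v := by
          rw [integral_finsetSum _ fun i _ => i2 i, ← Finset.sum_neg_distrib]
          exact Finset.sum_congr rfl fun i _ => e i
      _ = -∫ v, (s n v * ψ₁ v + s' n v * ψ₂ v) := by
          rw [← integral_finsetSum _ fun i _ => i1 i]
          congr 2; funext v
          rw [← Finset.sum_mul, sum_pd_reg_radialField hΦ γ (hη0 n) w v]
          simp only [hψ₁, hψ₂, hs', hs]; ring
      _ = _ := by rw [integral_add j1 j2]
  have hs_le : ∀ n v, v ≠ w → |s n v| ≤ ‖v - w‖ ^ γ := fun n v hv => by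
    rw [abs_of_nonneg (hs0 n v)]
    exact reg_rpow_le hγ₂ (hη0 n) (sub_ne_zero.2 hv)
  have hs_lim : ∀ v, v ≠ w →
      Filter.Tendsto (fun n => s n v) Filter.atTop (nhds (‖v - w‖ ^ γ)) := fun v hv => by
    have h0 : ‖v - w‖ ^ γ = (0 + ‖v - w‖ ^ 2) ^ (γ / 2) := by
      rw [zero_add, norm_rpow_eq_sq_rpow]
    have := norm_pos_iff.2 (sub_ne_zero.2 hv)
    rw [h0]
    exact Filter.Tendsto.rpow_const (hηlim.add_const _) (Or.inl (by positivity))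
  have hs'_le : ∀ n v, v ≠ w → |s' n v| ≤ ‖v - w‖ ^ γ := fun n v hv => by
    have h2 : ‖v - w‖ ^ 2 / (η n + ‖v - w‖ ^ 2) ≤ 1 :=
      (div_le_one (ht n v)).2 (by linarith [hη0 n])
    have h3 : 0 ≤ ‖v - w‖ ^ 2 / (η n + ‖v - w‖ ^ 2) := div_nonneg (sq_nonneg _) (ht n v).le
    rw [hs', abs_mul, abs_of_nonneg h3]
    exact (mul_le_of_le_one_right (abs_nonneg _) h2).trans (hs_le n v hv)
  have hs'_lim : ∀ v, v ≠ w →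
      Filter.Tendsto (fun n => s' n v) Filter.atTop (nhds (‖v - w‖ ^ γ)) := fun v hv => by
    have := norm_pos_iff.2 (sub_ne_zero.2 hv)
    have h1 : Filter.Tendsto (fun n => ‖v - w‖ ^ 2 / (η n + ‖v - w‖ ^ 2)) Filter.atTop
        (nhds (‖v - w‖ ^ 2 / (0 + ‖v - w‖ ^ 2))) :=
      Filter.Tendsto.div tendsto_const_nhds (hηlim.add_const _) (by positivity)
    rw [zero_add, div_self (by positivity)] at h1
    simpa using (hs_lim v hv).mul h1
  have L0 := tendsto_integral_of_le_norm_rpow hγ₁ hγ₂ c0 k0 w (fun n => (hsc n).measurable)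
    hs_le hs_lim
  have L1 := tendsto_integral_of_le_norm_rpow hγ₁ hγ₂ c1 k1 w (fun n => (hsc n).measurable)
    hs_le hs_lim
  have L2 := tendsto_integral_of_le_norm_rpow hγ₁ hγ₂ c2 k2 w (fun n => (hs'c n).measurable)
    hs'_le hs'_lim
  simp_rw [ibp] at L0
  have hlim := tendsto_nhds_unique L0 (L1.add L2).neg
  obtain ⟨_, _, b1⟩ := exists_integral_norm_rpow_mul_le hγ₁ hγ₂ c1 k1
  obtain ⟨_, _, b2⟩ := exists_integral_norm_rpow_mul_le hγ₁ hγ₂ c2 k2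
  rw [hlim, ← integral_add (b1 w).1 (b2 w).1]
  congr 2; funext v
  simp only [hψ₁, hψ₂]; ring

/-! ### The weak form of `Q(f, g)` tested against `g Φ(1 + |v|²)` -/

/-- The gradient of `g` at `v`. -/
noncomputable def grad (g : V → ℝ) (v : V) : V := WithLp.toLp 2 fun i => pd i g v

@[simp] lemma grad_apply (g : V → ℝ) (v : V) (i : Fin 3) : grad g v i = pd i g v := rfl

lemma continuous_grad {g : V → ℝ} (hg : ContDiff ℝ 1 g) : Continuous (grad g) :=
  (PiLp.continuous_toLp 2 _).comp (continuous_pi fun i => continuous_pd hg i)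

lemma contDiff_aBar {γ : ℝ} (hγ₁ : -2 < γ) (hγ₂ : γ < 0) {f : V → ℝ} (hf : ContDiff ℝ ∞ f)
    (hi : Integrable fun v : V => bracket v ^ 2 * f v) (i j : Fin 3) :
    ContDiff ℝ 1 (aBar γ f i j) :=
  (isHomogeneousKernel_aKer hγ₁ i j).contDiff_integral hγ₁ hγ₂ (by linarith) le_rfl hf hi

lemma contDiff_bBar {γ : ℝ} (hγ₁ : -2 < γ) (hγ₂ : γ < 0) {f : V → ℝ} (hf : ContDiff ℝ ∞ f)
    (hi : Integrable fun v : V => bracket v ^ 2 * f v) (i : Fin 3) :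
    ContDiff ℝ 1 (bBar γ f i) :=
  (isHomogeneousKernel_bKer i).contDiff_integral hγ₁ hγ₂ le_rfl (by linarith) hf hi

lemma sum_bBar_mul {γ : ℝ} (hγ₁ : -2 < γ) (hγ₂ : γ < 0) {f : V → ℝ} (hf : Continuous f)
    (hi : Integrable fun v : V => bracket v ^ 2 * f v) (v x : V) :
    Integrable (fun w => ‖v - w‖ ^ γ * (-2 * inner ℝ (v - w) x) * f w) ∧
    ∑ i, bBar γ f i v * x i = ∫ w, ‖v - w‖ ^ γ * (-2 * inner ℝ (v - w) x) * f w := by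
  have i1 : ∀ i, Integrable fun w => bKer γ i (v - w) * f w * x i := fun i =>
    ((isHomogeneousKernel_bKer i).integrable_mul hγ₁ hγ₂ le_rfl (by linarith) hf hi v).mul_const _
  have e : ∀ w, ‖v - w‖ ^ γ * (-2 * inner ℝ (v - w) x) * f w =
      ∑ i, bKer γ i (v - w) * f w * x i := fun w => by
    simp only [bKer, PiLp.inner_apply, Fin.sum_univ_three, RCLike.inner_apply, conj_trivial]
    ring
  simp_rw [e]
  refine ⟨integrable_finsetSum _ fun i _ => i1 i, ?_⟩
  rw [integral_finsetSum _ fun i _ => i1 i]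
  refine Finset.sum_congr rfl fun i _ => ?_
  rw [integral_mul_const, bBar]

/-- The density, relative to `|v - w|^γ f(w)`, of the first-order terms of the weak form. -/
noncomputable def crossTerm (Φ : ℝ → ℝ) (g : V → ℝ) (v w : V) : ℝ :=
  2 * g v * (∑ i, radialField Φ w i v * pd i g v) +
    4 * g v ^ 2 * deriv Φ (1 + ‖v‖ ^ 2) * inner ℝ (v - w) v

lemma crossTerm_eq (Φ : ℝ → ℝ) (g : V → ℝ) (v w : V) :
    crossTerm Φ g v w = 2 * g v * (Φ (1 + ‖v‖ ^ 2) * inner ℝ (v - w) (grad g v) +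
      deriv Φ (1 + ‖v‖ ^ 2) * (‖v - w‖ ^ 2 * inner ℝ v (grad g v) -
        inner ℝ (v - w) v * inner ℝ (v - w) (grad g v))) +
    4 * g v ^ 2 * deriv Φ (1 + ‖v‖ ^ 2) * inner ℝ (v - w) v := by
  have h : ∑ i, radialField Φ w i v * pd i g v =
      Φ (1 + ‖v‖ ^ 2) * inner ℝ (v - w) (grad g v) +
      deriv Φ (1 + ‖v‖ ^ 2) * (‖v - w‖ ^ 2 * inner ℝ v (grad g v) -
        inner ℝ (v - w) v * inner ℝ (v - w) (grad g v)) := by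
    have h1 : inner ℝ v (grad g v) = ∑ i, v i * pd i g v := by
      rw [PiLp.inner_apply]; exact Finset.sum_congr rfl fun i _ => by simp; ring
    have h2 : inner ℝ (v - w) (grad g v) = ∑ i, (v i - w i) * pd i g v := by
      rw [PiLp.inner_apply]; exact Finset.sum_congr rfl fun i _ => by simp; ring
    rw [h1, h2]
    simp only [radialField, Fin.sum_univ_three]
    ring
  rw [crossTerm, h]

/-- By symmetry of `a`, the term `g Φ' a∇g·v`, the drift on `Φ∇g` and the drift on `gΦ'v` combine
under the `w`-integral into `crossTerm`; only the quadratic form in `∇g` remains in terms of `a *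
f`. -/
lemma sum_flux_mul_pd {γ : ℝ} (hγ₁ : -2 < γ) (hγ₂ : γ < 0) {f : V → ℝ} (hf : ContDiff ℝ ∞ f)
    (hi : Integrable fun v : V => bracket v ^ 2 * f v) {g : V → ℝ} (hg : ContDiff ℝ ∞ g)
    {Φ : ℝ → ℝ} (hΦ : ContDiff ℝ ∞ Φ) (v : V) :
    ∑ i, ((∑ j, aBar γ f i j v * pd j g v) - bBar γ f i v * g v) *
        pd i (fun u => g u * Φ (1 + ‖u‖ ^ 2)) v =
      Φ (1 + ‖v‖ ^ 2) * (∑ i, ∑ j, aBar γ f i j v * pd i g v * pd j g v) +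
        ∫ w, ‖v - w‖ ^ γ * crossTerm Φ g v w * f w := by
  have hgd : Differentiable ℝ g := hg.differentiable (by simp)
  have hpd : ∀ i, pd i (fun u => g u * Φ (1 + ‖u‖ ^ 2)) v =
      pd i g v * Φ (1 + ‖v‖ ^ 2) + g v * (deriv Φ (1 + ‖v‖ ^ 2) * (2 * v i)) := fun i =>
    (((hgd v).hasPd i).mul (hasPd_comp_one_add_norm_sq (differentiable_of_smooth hΦ) v i)).2
  obtain ⟨ia, ea⟩ := sum_aBar_mul_mul hγ₁ hγ₂ hf.continuous hi v v (grad g v)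
  obtain ⟨ib, eb⟩ := sum_bBar_mul hγ₁ hγ₂ hf.continuous hi v (grad g v)
  obtain ⟨ic, ec⟩ := sum_bBar_mul hγ₁ hγ₂ hf.continuous hi v v
  set A := Φ (1 + ‖v‖ ^ 2)
  set A' := deriv Φ (1 + ‖v‖ ^ 2) with hA'
  have e : ∫ w, ‖v - w‖ ^ γ * crossTerm Φ g v w * f w =
      2 * g v * A' * (∑ i, ∑ j, aBar γ f i j v * v i * grad g v j) -
      g v * A * (∑ i, bBar γ f i v * grad g v i) -
      2 * g v ^ 2 * A' * ∑ i, bBar γ f i v * v i := by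
    rw [ea, eb, ec, ← integral_const_mul, ← integral_const_mul, ← integral_const_mul,
      ← integral_sub' (ia.const_mul _) (ib.const_mul _),
      ← integral_sub' ((ia.const_mul _).sub (ib.const_mul _)) (ic.const_mul _)]
    congr 1; funext w
    simp only [Pi.sub_apply]
    rw [crossTerm_eq]
    ring
  rw [e]
  simp only [hpd, grad_apply, Fin.sum_univ_three]
  ring

/-- The density, relative to `|v - w|^γ f(w) g(v)²`, of the zeroth-order terms of the weak form. -/
noncomputable def zerothTerm (γ : ℝ) (Φ : ℝ → ℝ) (v w : V) : ℝ :=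
  (γ + 3) * Φ (1 + ‖v‖ ^ 2) + 2 * deriv Φ (1 + ‖v‖ ^ 2) * (‖w‖ ^ 2 - ‖v‖ ^ 2) +
    2 * deriv (deriv Φ) (1 + ‖v‖ ^ 2) * gramDet v w

/-- The gradient part is `radialField` paired with `∇(g²)`. Its `2Φ'|v - w|²` combines with `4Φ' (v
- w)·v` to give `2Φ'(|w|² - |v|²)`, the source of the favourable `-2k` for powers. -/
lemma integral_norm_rpow_mul_crossTerm {γ : ℝ} (hγ₁ : -2 < γ) (hγ₂ : γ < 0) {Φ : ℝ → ℝ}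
    (hΦ : ContDiff ℝ ∞ Φ) {ρ : ℝ} (hρ : VanishesAbove Φ ρ) {g : V → ℝ} (hg : ContDiff ℝ ∞ g)
    (w : V) :
    ∫ v, ‖v - w‖ ^ γ * crossTerm Φ g v w =
      -∫ v, ‖v - w‖ ^ γ * (zerothTerm γ Φ v w * g v ^ 2) := by
  have hc0 := hΦ.continuous
  have hc1 := (contDiff_deriv hΦ).continuous
  have hc2 := (contDiff_deriv (contDiff_deriv hΦ)).continuous
  have hgc := hg.continuous
  have hg1 : ContDiff ℝ 1 g := hg.of_le (by simp)
  have hgd : Differentiable ℝ g := hg.differentiable (by simp)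
  have hG : ContDiff ℝ 1 fun v => g v ^ 2 := hg1.pow 2
  have hpd : ∀ i v, pd i (fun v => g v ^ 2) v = 2 * g v * pd i g v := fun i v => by
    have := ((hgd v).hasPd i).mul ((hgd v).hasPd i)
    simp_rw [sq]; rw [this.2]; ring
  have key := integral_norm_rpow_mul_radialField hγ₁ hγ₂ hΦ hρ hG w
  set ψ₀ : V → ℝ := fun v => ∑ i, radialField Φ w i v * pd i (fun v => g v ^ 2) v with hψ₀
  set ψ₁ : V → ℝ := fun v => ((γ + 3) * Φ (1 + ‖v‖ ^ 2) +
    2 * deriv Φ (1 + ‖v‖ ^ 2) * ‖v - w‖ ^ 2 +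
        2 * deriv (deriv Φ) (1 + ‖v‖ ^ 2) * gramDet v w) * g v ^ 2 with hψ₁
  set ψ₂ : V → ℝ := fun v => 4 * g v ^ 2 * deriv Φ (1 + ‖v‖ ^ 2) * inner ℝ (v - w) v with hψ₂
  have c0 : Continuous ψ₀ := continuous_finsetSum _ fun i _ =>
    (continuous_radialField hΦ w i).mul (continuous_pd hG i)
  have c1 : Continuous ψ₁ := by simp only [hψ₁, gramDet]; fun_prop
  have c2 : Continuous ψ₂ := by fun_prop
  have k0 : HasCompactSupport ψ₀ := by
    simp only [hψ₀, Fin.sum_univ_three]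
    exact ((hasCompactSupport_radialField hρ w 0).mul_right.add
      (hasCompactSupport_radialField hρ w 1).mul_right).add
      (hasCompactSupport_radialField hρ w 2).mul_right
  have k1 : HasCompactSupport ψ₁ :=
    ((hρ.hasCompactSupport.mul_left.add hρ.deriv.hasCompactSupport.mul_left.mul_right).add
      hρ.deriv.deriv.hasCompactSupport.mul_left.mul_right).mul_right
  have k2 : HasCompactSupport ψ₂ := hρ.deriv.hasCompactSupport.mul_left.mul_right
  obtain ⟨_, _, b0⟩ := exists_integral_norm_rpow_mul_le hγ₁ hγ₂ c0 k0
  obtain ⟨_, _, b1⟩ := exists_integral_norm_rpow_mul_le hγ₁ hγ₂ c1 k1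
  obtain ⟨_, _, b2⟩ := exists_integral_norm_rpow_mul_le hγ₁ hγ₂ c2 k2
  calc ∫ v, ‖v - w‖ ^ γ * crossTerm Φ g v w
      = ∫ v, (‖v - w‖ ^ γ * ψ₀ v + ‖v - w‖ ^ γ * ψ₂ v) := by
        congr 1; funext v
        have : ψ₀ v = 2 * g v * ∑ i, radialField Φ w i v * pd i g v := by
          simp only [hψ₀, hpd, Finset.mul_sum]
          exact Finset.sum_congr rfl fun i _ => by ring
        rw [this, crossTerm]; ring
    _ = -∫ v, (‖v - w‖ ^ γ * ψ₁ v - ‖v - w‖ ^ γ * ψ₂ v) := by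
        rw [integral_add (b0 w).1 (b2 w).1, key, integral_sub (b1 w).1 (b2 w).1]; ring
    _ = _ := by
        congr 2; funext v
        simp only [hψ₁, hψ₂, zerothTerm]
        rw [inner_sub_self_eq]; ring

/-- Growth in `w` is at most quadratic, exactly what the second moment of `f` allows; this justifies
Fubini. -/
lemma exists_abs_crossTerm_le {Φ : ℝ → ℝ} (hΦ : ContDiff ℝ ∞ Φ) {ρ : ℝ} (hρ : VanishesAbove Φ ρ)
    {g : V → ℝ} (hg : ContDiff ℝ ∞ g) :
    ∃ ψ : V → ℝ, Continuous ψ ∧ HasCompactSupport ψ ∧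
      ∀ v w, |crossTerm Φ g v w| ≤ ψ v * bracket w ^ 2 := by
  have hc0 := hΦ.continuous
  have hc1 := (contDiff_deriv hΦ).continuous
  have hgc := hg.continuous
  have hgr := continuous_grad (hg.of_le (by simp : (1 : WithTop ℕ∞) ≤ ∞))
  have hbr := continuous_bracket
  refine ⟨fun v => |Φ (1 + ‖v‖ ^ 2)| * (6 * |g v| * ‖grad g v‖ * bracket v ^ 2) +
    |deriv Φ (1 + ‖v‖ ^ 2)| * (8 * |g v| * ‖v‖ * ‖grad g v‖ * bracket v ^ 2 +
      12 * |g v| ^ 2 * ‖v‖ * bracket v ^ 2), by fun_prop, ?_, fun v w => ?_⟩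
  · exact (hρ.hasCompactSupport.norm.mul_right).add (hρ.deriv.hasCompactSupport.norm.mul_right)
  rw [crossTerm_eq]
  set z := v - w with hz
  set A := Φ (1 + ‖v‖ ^ 2)
  set A' := deriv Φ (1 + ‖v‖ ^ 2)
  have hz2 : ‖z‖ ^ 2 ≤ 2 * bracket v ^ 2 * bracket w ^ 2 := norm_sub_sq_le v w
  have hb : 1 ≤ bracket v ^ 2 * bracket w ^ 2 :=
    one_le_mul_of_one_le_of_one_le (one_le_pow₀ (one_le_bracket v)) (one_le_pow₀ (one_le_bracket w))
  have hz1 : ‖z‖ ≤ 3 * (bracket v ^ 2 * bracket w ^ 2) := by nlinarith [sq_nonneg (‖z‖ - 1)]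
  have e1 := abs_real_inner_le_norm z (grad g v)
  have e2 := abs_real_inner_le_norm v (grad g v)
  have e3 := abs_real_inner_le_norm z v
  have t1 : |‖z‖ ^ 2 * inner ℝ v (grad g v) - inner ℝ z v * inner ℝ z (grad g v)| ≤
      2 * (2 * bracket v ^ 2 * bracket w ^ 2) * (‖v‖ * ‖grad g v‖) := by
    calc _ ≤ |‖z‖ ^ 2 * inner ℝ v (grad g v)| + |inner ℝ z v * inner ℝ z (grad g v)| := abs_sub _ _
      _ = ‖z‖ ^ 2 * |inner ℝ v (grad g v)| + |inner ℝ z v| * |inner ℝ z (grad g v)| := by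
          rw [abs_mul, abs_mul, abs_of_nonneg (sq_nonneg ‖z‖)]
      _ ≤ ‖z‖ ^ 2 * (‖v‖ * ‖grad g v‖) + (‖z‖ * ‖v‖) * (‖z‖ * ‖grad g v‖) := by gcongr
      _ = 2 * ‖z‖ ^ 2 * (‖v‖ * ‖grad g v‖) := by ring
      _ ≤ _ := by gcongr
  have t2 : |(inner ℝ z (grad g v) : ℝ)| ≤ 3 * (bracket v ^ 2 * bracket w ^ 2) * ‖grad g v‖ :=
    e1.trans (by gcongr)
  have t3 : |(inner ℝ z v : ℝ)| ≤ 3 * (bracket v ^ 2 * bracket w ^ 2) * ‖v‖ :=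
    e3.trans (by gcongr)
  calc _ ≤ 2 * |g v| * (|A| * |inner ℝ z (grad g v)| +
        |A'| * |‖z‖ ^ 2 * inner ℝ v (grad g v) - inner ℝ z v * inner ℝ z (grad g v)|) +
        4 * |g v| ^ 2 * |A'| * |inner ℝ z v| := by
        refine (abs_add_le _ _).trans (add_le_add ?_ ?_)
        · rw [abs_mul, abs_mul, abs_two]
          gcongr
          refine (abs_add_le _ _).trans (by rw [abs_mul, abs_mul])
        · rw [abs_mul, abs_mul, abs_mul, abs_pow, abs_of_pos (by norm_num : (0 : ℝ) < 4)]
    _ ≤ 2 * |g v| * (|A| * (3 * (bracket v ^ 2 * bracket w ^ 2) * ‖grad g v‖) +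
        |A'| * (2 * (2 * bracket v ^ 2 * bracket w ^ 2) * (‖v‖ * ‖grad g v‖))) +
        4 * |g v| ^ 2 * |A'| * (3 * (bracket v ^ 2 * bracket w ^ 2) * ‖v‖) := by gcongr
    _ = _ := by ring

lemma integrable_prod_crossTerm {γ : ℝ} (hγ₁ : -2 < γ) (hγ₂ : γ < 0) {f : V → ℝ}
    (hf : Continuous f) (hi : Integrable fun v : V => bracket v ^ 2 * f v) {Φ : ℝ → ℝ}
    (hΦ : ContDiff ℝ ∞ Φ) {ρ : ℝ} (hρ : VanishesAbove Φ ρ) {g : V → ℝ} (hg : ContDiff ℝ ∞ g) :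
    Integrable (fun p : V × V => ‖p.1 - p.2‖ ^ γ * crossTerm Φ g p.1 p.2 * f p.2)
      (volume.prod volume) := by
  obtain ⟨ψ, hψ, hψc, hle⟩ := exists_abs_crossTerm_le hΦ hρ hg
  obtain ⟨C, -, hC⟩ := exists_integral_norm_rpow_mul_le hγ₁ hγ₂ hψ hψc
  have hbr := continuous_bracket
  have key := integrable_prod_norm_rpow_mul (γ := γ) hψ.measurable
    (F := fun w => bracket w ^ 2 * f w) (by fun_prop) hC hi
  refine key.mono ?_ (ae_of_all _ fun p => ?_)
  · have hc0 := hΦ.continuous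
    have hc1 := (contDiff_deriv hΦ).continuous
    have hgc := hg.continuous
    have hgr := continuous_grad (hg.of_le (by simp : (1 : WithTop ℕ∞) ≤ ∞))
    have h1 : Continuous fun p : V × V => crossTerm Φ g p.1 p.2 := by
      simp_rw [crossTerm_eq]; fun_prop
    have h2 : Measurable fun p : V × V => ‖p.1 - p.2‖ ^ γ := by fun_prop
    exact ((h2.mul h1.measurable).mul (hf.measurable.comp measurable_snd)).aestronglyMeasurable
  · have hψ0 : 0 ≤ ψ p.1 := by
      have := (abs_nonneg _).trans (hle p.1 p.2)
      exact nonneg_of_mul_nonneg_left this (by have := bracket_pos p.2; positivity)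
    simp only [norm_mul, Real.norm_eq_abs, abs_pow, abs_of_pos (bracket_pos p.2), abs_of_nonneg hψ0]
    rw [show |‖p.1 - p.2‖ ^ γ| * ψ p.1 * (bracket p.2 ^ 2 * |f p.2|) =
      |‖p.1 - p.2‖ ^ γ| * (ψ p.1 * bracket p.2 ^ 2) * |f p.2| by ring]
    gcongr
    exact hle _ _

/-- The weak form of `Q(f, g)`, tested against `g(v) Φ(1 + |v|²)`. -/
lemma integral_Q_mul {γ : ℝ} (hγ₁ : -2 < γ) (hγ₂ : γ < 0) {f : V → ℝ} (hf : ContDiff ℝ ∞ f)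
    (hi : Integrable fun v : V => bracket v ^ 2 * f v) {g : V → ℝ} (hg : ContDiff ℝ ∞ g)
    {Φ : ℝ → ℝ} (hΦ : ContDiff ℝ ∞ Φ) {ρ : ℝ} (hρ : VanishesAbove Φ ρ) :
    ∫ v, Q γ f g v * (g v * Φ (1 + ‖v‖ ^ 2)) =
      -(∫ v, Φ (1 + ‖v‖ ^ 2) * (∑ i, ∑ j, aBar γ f i j v * pd i g v * pd j g v)) +
      ∫ w, (∫ v, ‖v - w‖ ^ γ * (zerothTerm γ Φ v w * g v ^ 2)) * f w := by
  have hg1 : ContDiff ℝ 1 g := hg.of_le (by simp)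
  have hpg : ∀ i, ContDiff ℝ 1 (pd i g) := fun i => (contDiff_pd hg i).of_le (by simp)
  have ha := contDiff_aBar hγ₁ hγ₂ hf hi
  have hb := contDiff_bBar hγ₁ hγ₂ hf hi
  set F : Fin 3 → V → ℝ := fun i u => (∑ j, aBar γ f i j u * pd j g u) - bBar γ f i u * g u with hF
  have hFd : ∀ i, ContDiff ℝ 1 (F i) := fun i =>
    (ContDiff.sum fun j _ => (ha i j).mul (hpg j)).sub ((hb i).mul hg1)
  set ψ : V → ℝ := fun v => g v * Φ (1 + ‖v‖ ^ 2) with hψ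
  have hψd : ContDiff ℝ 1 ψ :=
    hg1.mul ((hΦ.of_le (by simp)).comp (contDiff_const.add (contDiff_norm_sq ℝ)))
  have hψc : HasCompactSupport ψ := hρ.hasCompactSupport.mul_left
  have i1 : ∀ i, Integrable fun v => pd i (F i) v * ψ v := fun i =>
    ((continuous_pd (hFd i) i).mul hψd.continuous).integrable_of_hasCompactSupport hψc.mul_left
  have i2 : ∀ i, Integrable fun v => F i v * pd i ψ v := fun i =>
    ((hFd i).continuous.mul (continuous_pd hψd i)).integrable_of_hasCompactSupport
      (hasCompactSupport_pd hψc i).mul_left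
  have i3 : ∀ i, Integrable fun v => F i v * ψ v := fun i =>
    ((hFd i).continuous.mul hψd.continuous).integrable_of_hasCompactSupport hψc.mul_left
  have e : ∀ i, ∫ v, F i v * pd i ψ v = -∫ v, pd i (F i) v * ψ v := fun i =>
    integral_mul_pd i (i1 i) (i2 i) (i3 i) ((hFd i).differentiable (by simp))
      (hψd.differentiable (by simp))
  have hprod := integrable_prod_crossTerm hγ₁ hγ₂ hf.continuous hi hΦ hρ hg
  have j1 : Integrable fun v => Φ (1 + ‖v‖ ^ 2) *
      (∑ i, ∑ j, aBar γ f i j v * pd i g v * pd j g v) := by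
    refine Continuous.integrable_of_hasCompactSupport ?_ hρ.hasCompactSupport.mul_right
    have := hΦ.continuous
    refine Continuous.mul (by fun_prop) (continuous_finsetSum _ fun i _ =>
      continuous_finsetSum _ fun j _ => ?_)
    exact ((ha i j).continuous.mul (hpg i).continuous).mul (hpg j).continuous
  have j2 : Integrable fun v => ∫ w, ‖v - w‖ ^ γ * crossTerm Φ g v w * f w :=
    hprod.integral_prod_left
  calc ∫ v, Q γ f g v * ψ v = ∫ v, ∑ i, pd i (F i) v * ψ v := by
        congr 1; funext v
        rw [Q, Finset.sum_mul]
    _ = -∫ v, ∑ i, F i v * pd i ψ v := by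
        rw [integral_finsetSum _ fun i _ => i1 i, integral_finsetSum _ fun i _ => i2 i,
          ← Finset.sum_neg_distrib]
        exact Finset.sum_congr rfl fun i _ => by rw [e i, neg_neg]
    _ = -∫ v, (Φ (1 + ‖v‖ ^ 2) * (∑ i, ∑ j, aBar γ f i j v * pd i g v * pd j g v) +
          ∫ w, ‖v - w‖ ^ γ * crossTerm Φ g v w * f w) := by
        congr 2; funext v
        exact sum_flux_mul_pd hγ₁ hγ₂ hf hi hg hΦ v
    _ = _ := by
        rw [integral_add j1 j2, integral_integral_swap hprod, neg_add]
        congr 1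
        rw [← integral_neg]
        congr 1; funext w
        rw [integral_mul_const, integral_norm_rpow_mul_crossTerm hγ₁ hγ₂ hΦ hρ hg w]
        ring

/-! ### Weighted norms -/

section Weights

variable {g : V → ℝ} {l l' : ℝ}

lemma memLp_bracket_rpow_mul_of_le (hl : l' ≤ l) (hg : Continuous g)
    (h : MemLp (fun v : V => bracket v ^ l * g v) 2) :
    MemLp (fun v : V => bracket v ^ l' * g v) 2 := by
  refine h.of_le ((contDiff_bracket_rpow l').continuous.mul hg).aestronglyMeasurable
    (ae_of_all _ fun v => ?_)
  rw [norm_mul, norm_mul, Real.norm_of_nonneg (bracket_rpow_pos _ v).le,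
    Real.norm_of_nonneg (bracket_rpow_pos _ v).le]
  exact mul_le_mul_of_nonneg_right (bracket_rpow_le hl v) (norm_nonneg _)

lemma integral_bracket_rpow_mul_sq_le (hl : l' ≤ l) (hg : Continuous g)
    (h : MemLp (fun v : V => bracket v ^ l * g v) 2) :
    ∫ v : V, (bracket v ^ l' * g v) ^ 2 ≤ ∫ v : V, (bracket v ^ l * g v) ^ 2 := by
  refine integral_mono (memLp_bracket_rpow_mul_of_le hl hg h).integrable_sq h.integrable_sq
    fun v => ?_
  simp only [mul_pow]
  exact mul_le_mul_of_nonneg_right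
    (pow_le_pow_left₀ (bracket_rpow_pos _ v).le (bracket_rpow_le hl v) 2) (sq_nonneg _)

lemma normSqL2_nonneg (l : ℝ) (g : V → ℝ) : 0 ≤ normSqL2 l g :=
  integral_nonneg fun _ => sq_nonneg _

lemma pd_bracket_rpow_mul (hg : ContDiff ℝ ∞ g) (l : ℝ) (i : Fin 3) (v : V) :
    pd i (fun v => bracket v ^ l * g v) v =
      bracket v ^ l * pd i g v + l * bracket v ^ (l - 2) * v i * g v := by
  rw [((hasPd_bracket_rpow l).mul (((hg.differentiable (by simp)) v).hasPd i)).2]; ring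

lemma abs_bracket_rpow_sub_two_mul_le (l : ℝ) (v : V) (i : Fin 3) (x : ℝ) :
    |l * bracket v ^ (l - 2) * v i * x| ≤ |l| * |bracket v ^ l * x| := by
  have h1 : |v i| ≤ bracket v ^ 2 :=
    ((abs_coord_le v i).trans (norm_le_bracket v)).trans
      (le_self_pow₀ (one_le_bracket v) two_ne_zero)
  have h2 : bracket v ^ l = bracket v ^ (l - 2) * bracket v ^ 2 := by
    rw [← Real.rpow_natCast (bracket v) 2, ← Real.rpow_add (bracket_pos v)]
    congr 1; push_cast; ring
  rw [abs_mul, abs_mul, abs_mul, abs_mul, abs_of_pos (bracket_rpow_pos _ v),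
    abs_of_pos (bracket_rpow_pos _ v), h2]
  have := bracket_rpow_pos (l - 2) v
  calc |l| * bracket v ^ (l - 2) * |v i| * |x| ≤ |l| * bracket v ^ (l - 2) * bracket v ^ 2 * |x| := by
        gcongr
    _ = _ := by ring

lemma memLp_pd_bracket_rpow_mul (hg : ContDiff ℝ ∞ g)
    (h : MemLp (fun v : V => bracket v ^ l * g v) 2)
    (h' : ∀ i, MemLp (fun v : V => bracket v ^ l * pd i g v) 2) (i : Fin 3) :
    MemLp (pd i fun v => bracket v ^ l * g v) 2 := by
  have hgc := hg.continuous
  have h2 : MemLp (fun v : V => l * bracket v ^ (l - 2) * v i * g v) 2 := by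
    refine (h.const_mul |l|).of_le ?_ (ae_of_all _ fun v => ?_)
    · have := (contDiff_bracket_rpow (l - 2)).continuous
      exact Continuous.aestronglyMeasurable (by fun_prop)
    · rw [Real.norm_eq_abs, Real.norm_eq_abs, abs_mul |l|, abs_abs]
      exact abs_bracket_rpow_sub_two_mul_le l v i (g v)
  refine ((h' i).add h2).congr_norm ?_ (ae_of_all _ fun v => ?_)
  · exact (continuous_pd (((contDiff_bracket_rpow l).mul hg).of_le (by simp)) i).aestronglyMeasurable
  · rw [pd_bracket_rpow_mul hg]; rfl

/-- Passes from the gradient of the weighted function to the weighted gradient. Differentiating the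
weight costs at most `|l| ⟨v⟩^l |g|` per coordinate, so `6 = 2 · 3`. -/
lemma sum_integral_pd_bracket_rpow_mul_sq_le (hg : ContDiff ℝ ∞ g)
    (h : MemLp (fun v : V => bracket v ^ l * g v) 2)
    (h' : ∀ i, MemLp (fun v : V => bracket v ^ l * pd i g v) 2) :
    ∑ i, ∫ v, pd i (fun v => bracket v ^ l * g v) v ^ 2 ≤
      2 * normSqH1dot l g + 6 * l ^ 2 * normSqL2 l g := by
  have h1 : ∀ i, ∫ v, pd i (fun v => bracket v ^ l * g v) v ^ 2 ≤
      2 * (∫ v, (bracket v ^ l * pd i g v) ^ 2) + 2 * l ^ 2 * normSqL2 l g := fun i => by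
    rw [normSqL2, ← integral_const_mul, ← integral_const_mul,
      ← integral_add ((h' i).integrable_sq.const_mul _) (h.integrable_sq.const_mul _)]
    refine integral_mono (memLp_pd_bracket_rpow_mul hg h h' i).integrable_sq
      (((h' i).integrable_sq.const_mul _).add (h.integrable_sq.const_mul _)) fun v => ?_
    simp only [pd_bracket_rpow_mul hg]
    have h2 := pow_le_pow_left₀ (abs_nonneg _) (abs_bracket_rpow_sub_two_mul_le l v i (g v)) 2
    rw [mul_pow, sq_abs, sq_abs, sq_abs] at h2
    nlinarith [sq_nonneg (bracket v ^ l * pd i g v - l * bracket v ^ (l - 2) * v i * g v)]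
  refine (Finset.sum_le_sum fun i _ => h1 i).trans (le_of_eq ?_)
  rw [Finset.sum_add_distrib, ← Finset.mul_sum, normSqH1dot]
  simp; ring

end Weights

/-- The singular part of the zeroth-order terms is form-bounded by the weighted gradient, with
relative bound `0`. -/
lemma exists_integral_prod_norm_rpow_mul_le {γ : ℝ} (hγ₁ : -2 < γ) (hγ₂ : γ < 0) {ε : ℝ}
    (hε : 0 < ε) :
    ∃ C, 0 < C ∧ ∀ (l E : ℝ) (f g : V → ℝ), ContDiff ℝ ∞ g → Continuous f → (∀ v, 0 ≤ f v) →
      Integrable (fun v : V => bracket v ^ 2 * f v) → ∫ v : V, bracket v ^ 2 * f v ≤ E →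
      MemLp (fun v : V => bracket v ^ l * g v) 2 →
      (∀ i, MemLp (fun v : V => bracket v ^ l * pd i g v) 2) →
      Integrable (fun p : V × V => ‖p.1 - p.2‖ ^ γ * (bracket p.1 ^ l * g p.1) ^ 2 *
        (bracket p.2 ^ 2 * f p.2)) (volume.prod volume) ∧
      ∫ p : V × V, ‖p.1 - p.2‖ ^ γ * (bracket p.1 ^ l * g p.1) ^ 2 * (bracket p.2 ^ 2 * f p.2)
        ∂(volume.prod volume) ≤
        E * (ε * (2 * normSqH1dot l g + 6 * l ^ 2 * normSqL2 l g) + C * normSqL2 l g) := by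
  obtain ⟨C, hC0, hC⟩ := exists_integral_norm_rpow_mul_sq_le hγ₁ hγ₂ hε
  refine ⟨C, hC0, fun l E f g hg hf hf0 hi hE h h' => ?_⟩
  have key := hC (fun v => bracket v ^ l * g v) (((contDiff_bracket_rpow l).mul hg).of_le (by simp))
    h (memLp_pd_bracket_rpow_mul hg h h')
  set B := ε * (2 * normSqH1dot l g + 6 * l ^ 2 * normSqL2 l g) + C * normSqL2 l g
  have hB : ∀ w, ∫ v, ‖v - w‖ ^ γ * (bracket v ^ l * g v) ^ 2 ≤ B := fun w => by
    refine (key w).2.trans (add_le_add ?_ le_rfl)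
    exact mul_le_mul_of_nonneg_left (sum_integral_pd_bracket_rpow_mul_sq_le hg h h') hε.le
  have hB0 : 0 ≤ B := (integral_nonneg fun v => by positivity).trans (hB 0)
  have hgc := hg.continuous
  have hbr := (contDiff_bracket_rpow l).continuous
  have hb1 := continuous_bracket
  have hint := integrable_prod_norm_rpow_mul (γ := γ) (G := fun v : V => (bracket v ^ l * g v) ^ 2)
    (F := fun w : V => bracket w ^ 2 * f w) (Continuous.measurable (by fun_prop))
    (Continuous.measurable (by fun_prop)) (C := B)
    (fun w => ⟨(key w).1, by simpa only [abs_sq] using hB w⟩) hi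
  refine ⟨hint, ?_⟩
  -- Integrating in `v` first, the form bound holds with the same constant for every `w`, so only
  -- the moment of `f` enters.
  rw [integral_prod_symm _ hint]
  calc ∫ w, ∫ v, ‖v - w‖ ^ γ * (bracket v ^ l * g v) ^ 2 * (bracket w ^ 2 * f w)
      ≤ ∫ w, B * (bracket w ^ 2 * f w) := by
        refine integral_mono hint.integral_prod_right (hi.const_mul B) fun w => ?_
        simp only
        rw [integral_mul_const]
        exact mul_le_mul_of_nonneg_right (hB w) (mul_nonneg (sq_nonneg _) (hf0 w))
    _ ≤ E * B := by
        rw [integral_const_mul, mul_comm]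
        exact mul_le_mul_of_nonneg_right hE hB0

/-! ### Truncated powers -/

/-- A smooth compactly supported truncation of `r ↦ r ^ k` on `[1, ∞)`. -/
noncomputable def powCut (k : ℝ) (n : ℕ) (r : ℝ) : ℝ :=
  Real.smoothTransition (4 * r - 2) * (r ^ k * Real.smoothTransition (2 - r / (n + 1)))

section PowCut

variable (k : ℝ) (n : ℕ)

lemma contDiff_powCut : ContDiff ℝ ∞ (powCut k n) := by
  rw [contDiff_iff_contDiffAt]
  intro r
  -- The factor `smoothTransition (4 * r - 2)` vanishes for `r ≤ 1/2`, removing the singularity of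
  -- `r ^ k` at zero, and equals one for `r ≥ 3/4`, so it is invisible where `r = ⟨v⟩²`.
  rcases lt_or_ge r (1 / 2) with h | h
  · have : powCut k n =ᶠ[nhds r] fun _ => 0 := by
      filter_upwards [gt_mem_nhds h] with x hx
      rw [powCut, Real.smoothTransition.zero_of_nonpos (by linarith), zero_mul]
    exact contDiffAt_const.congr_of_eventuallyEq this
  · refine ContDiffAt.mul ?_ (ContDiffAt.mul
      (Real.contDiffAt_rpow_const_of_ne (by linarith)) ?_)
    · exact (Real.smoothTransition.contDiff.comp (by fun_prop :
        ContDiff ℝ ∞ fun r : ℝ => 4 * r - 2)).contDiffAt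
    · exact (Real.smoothTransition.contDiff.comp (by fun_prop :
        ContDiff ℝ ∞ fun r : ℝ => 2 - r / ((n : ℝ) + 1))).contDiffAt

lemma vanishesAbove_powCut : VanishesAbove (powCut k n) (2 * (n + 1)) := fun r hr => by
  have hn : (0 : ℝ) < n + 1 := by positivity
  have : 2 ≤ r / ((n : ℝ) + 1) := (le_div_iff₀ hn).2 hr
  rw [powCut, Real.smoothTransition.zero_of_nonpos (x := 2 - r / ((n : ℝ) + 1)) (by linarith)]
  ring

lemma powCut_eventuallyEq {r : ℝ} (hr : 1 ≤ r) : powCut k n =ᶠ[nhds r]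
    fun r => r ^ k * Real.smoothTransition (2 - r / (n + 1)) := by
  filter_upwards [lt_mem_nhds (show 3 / 4 < r by linarith)] with x hx
  rw [powCut, Real.smoothTransition.one_of_one_le (by linarith), one_mul]

lemma powCut_nonneg {r : ℝ} (hr : 1 ≤ r) : 0 ≤ powCut k n r := by
  rw [(powCut_eventuallyEq k n hr).eq_of_nhds]
  exact mul_nonneg (Real.rpow_nonneg (by linarith) _) (Real.smoothTransition.nonneg _)

lemma powCut_le {r : ℝ} (hr : 1 ≤ r) : powCut k n r ≤ r ^ k := by
  rw [(powCut_eventuallyEq k n hr).eq_of_nhds]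
  exact mul_le_of_le_one_right (Real.rpow_nonneg (by linarith) _) (Real.smoothTransition.le_one _)

lemma powCut_eventuallyEq_rpow {r : ℝ} (hr : 1 ≤ r) (hn : r < n + 1) :
    powCut k n =ᶠ[nhds r] fun r => r ^ k := by
  filter_upwards [powCut_eventuallyEq k n hr, gt_mem_nhds hn] with x hx hx'
  have hn : (0 : ℝ) < n + 1 := by positivity
  rw [hx, Real.smoothTransition.one_of_one_le, mul_one]
  have : x / ((n : ℝ) + 1) ≤ 1 := (div_le_one hn).2 hx'.le
  linarith

lemma deriv_rpow_const' (k : ℝ) {r : ℝ} (hr : 1 ≤ r) :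
    deriv (fun r : ℝ => r ^ k) r = k * r ^ (k - 1) :=
  (Real.hasDerivAt_rpow_const (Or.inl (by linarith))).deriv

lemma deriv_powCut_eq {r : ℝ} (hr : 1 ≤ r) (hn : r < n + 1) :
    deriv (powCut k n) r = k * r ^ (k - 1) := by
  rw [(powCut_eventuallyEq_rpow k n hr hn).deriv_eq, deriv_rpow_const' k hr]

lemma deriv_deriv_powCut_eq {r : ℝ} (hr : 1 ≤ r) (hn : r < n + 1) :
    deriv (deriv (powCut k n)) r = k * (k - 1) * r ^ (k - 2) := by
  have h2 : (deriv fun r : ℝ => r ^ k) =ᶠ[nhds r] fun r => k * r ^ (k - 1) := by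
    filter_upwards [lt_mem_nhds (show 0 < r by linarith)] with x hx
    exact (Real.hasDerivAt_rpow_const (Or.inl hx.ne')).deriv
  rw [((powCut_eventuallyEq_rpow k n hr hn).deriv.trans h2).deriv_eq, deriv_const_mul_field,
    deriv_rpow_const' (k - 1) hr]
  ring_nf

end PowCut

/-- Uniform bounds for the derivatives of the truncated powers. -/
lemma exists_abs_deriv_powCut_le (k : ℝ) : ∃ B, 0 < B ∧ ∀ (n : ℕ) (r : ℝ), 1 ≤ r →
    |deriv (powCut k n) r| * r ≤ B * r ^ k ∧
    |deriv (deriv (powCut k n)) r| * r ^ 2 ≤ B * r ^ k := by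
  set θ : ℝ → ℝ := fun t => Real.smoothTransition (2 - t) with hθ
  have hθc : ContDiff ℝ ∞ θ := Real.smoothTransition.contDiff.comp (by fun_prop)
  have hθ1 := contDiff_deriv hθc
  have hθ2 := contDiff_deriv hθ1
  have hz : VanishesAbove θ 2 := fun t ht => Real.smoothTransition.zero_of_nonpos (by linarith)
  obtain ⟨M₁, hM₁⟩ := isCompact_Icc.exists_bound_of_continuousOn (s := Set.Icc (0 : ℝ) 4)
    (f := fun t => t * deriv θ t) (continuous_id.mul hθ1.continuous).continuousOn
  obtain ⟨M₂, hM₂⟩ := isCompact_Icc.exists_bound_of_continuousOn (s := Set.Icc (0 : ℝ) 4)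
    (f := fun t => t ^ 2 * deriv (deriv θ) t)
    ((continuous_id.pow 2).mul hθ2.continuous).continuousOn
  have hM₁0 : 0 ≤ M₁ := (norm_nonneg _).trans (hM₁ 0 (by norm_num))
  have hM₂0 : 0 ≤ M₂ := (norm_nonneg _).trans (hM₂ 0 (by norm_num))
  -- The quantities `t θ'(t)` and `t² θ''(t)` with `t = r/N` are scale invariant, which makes the
  -- bounds uniform in `n`. The interval ends at 4 because each use of `VanishesAbove.deriv` raises
  -- the threshold 2 by one.
  have b1 : ∀ t, 0 ≤ t → |t * deriv θ t| ≤ M₁ := fun t ht => by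
    rcases le_or_gt t 4 with h | h
    · exact hM₁ t ⟨ht, h⟩
    · rw [hz.deriv t (by linarith), mul_zero, abs_zero]; exact hM₁0
  have b2 : ∀ t, 0 ≤ t → |t ^ 2 * deriv (deriv θ) t| ≤ M₂ := fun t ht => by
    rcases le_or_gt t 4 with h | h
    · exact hM₂ t ⟨ht, h⟩
    · rw [hz.deriv.deriv t (by linarith), mul_zero, abs_zero]; exact hM₂0
  have b0 : ∀ t, |θ t| ≤ 1 := fun t => by
    rw [abs_of_nonneg (Real.smoothTransition.nonneg _)]; exact Real.smoothTransition.le_one _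
  refine ⟨|k| + M₁ + |k * (k - 1)| + 2 * |k| * M₁ + M₂ + 1, by positivity, fun n r hr => ?_⟩
  set N : ℝ := (n : ℝ) + 1 with hN
  have hN0 : 0 < N := by positivity
  have hr0 : 0 < r := by linarith
  have d0 : ∀ x : ℝ, HasDerivAt (fun x => θ (x / N)) (deriv θ (x / N) / N) x := fun x => by
    have := ((differentiable_of_smooth hθc) (x / N)).hasDerivAt.comp x
      ((hasDerivAt_id x).div_const N)
    exact this.congr_deriv (by ring)
  have d1 : ∀ x : ℝ, HasDerivAt (fun x => deriv θ (x / N) / N) (deriv (deriv θ) (x / N) / N ^ 2) x :=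
    fun x => by
    have := (((differentiable_of_smooth hθ1) (x / N)).hasDerivAt.comp x
      ((hasDerivAt_id x).div_const N)).div_const N
    exact this.congr_deriv (by field_simp)
  have e1 : ∀ x : ℝ, 1 ≤ x → HasDerivAt (powCut k n)
      (k * x ^ (k - 1) * θ (x / N) + x ^ k * (deriv θ (x / N) / N)) x := fun x hx =>
    ((Real.hasDerivAt_rpow_const (Or.inl (by linarith))).mul (d0 x)).congr_of_eventuallyEq
      (powCut_eventuallyEq k n hx)
  have e1' : deriv (powCut k n) =ᶠ[nhds r] fun x =>
      k * x ^ (k - 1) * θ (x / N) + x ^ k * (deriv θ (x / N) / N) := by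
    have h2 := (powCut_eventuallyEq k n hr).deriv
    filter_upwards [h2, lt_mem_nhds hr0] with x hx hx0
    rw [hx]
    exact ((Real.hasDerivAt_rpow_const (Or.inl hx0.ne')).mul (d0 x)).deriv
  have e2 : deriv (deriv (powCut k n)) r =
      (k * ((k - 1) * r ^ (k - 1 - 1)) * θ (r / N) + k * r ^ (k - 1) * (deriv θ (r / N) / N)) +
      (k * r ^ (k - 1) * (deriv θ (r / N) / N) + r ^ k * (deriv (deriv θ) (r / N) / N ^ 2)) := by
    rw [e1'.deriv_eq]
    have p1 := Real.hasDerivAt_rpow_const (x := r) (p := k) (Or.inl hr0.ne')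
    have p2 := Real.hasDerivAt_rpow_const (x := r) (p := k - 1) (Or.inl hr0.ne')
    exact (((p2.const_mul k).mul (d0 r)).add (p1.mul (d1 r))).deriv
  have hrk : 0 < r ^ k := Real.rpow_pos_of_pos hr0 k
  have t0 : 0 ≤ r / N := by positivity
  have B1 := b1 (r / N) t0
  have B2 := b2 (r / N) t0
  have B0 := b0 (r / N)
  constructor
  · have : deriv (powCut k n) r * r =
        r ^ k * (k * θ (r / N) + r / N * deriv θ (r / N)) := by
      rw [(e1 r hr).deriv, Real.rpow_sub_one hr0.ne']
      field_simp
    have h2 : |deriv (powCut k n) r * r| = |deriv (powCut k n) r| * r := by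
      rw [abs_mul, abs_of_pos hr0]
    rw [← h2, this, abs_mul, abs_of_pos hrk, mul_comm]
    refine mul_le_mul_of_nonneg_right ?_ hrk.le
    calc |k * θ (r / N) + r / N * deriv θ (r / N)|
        ≤ |k| * |θ (r / N)| + |r / N * deriv θ (r / N)| := by
          rw [← abs_mul]; exact abs_add_le _ _
      _ ≤ |k| * 1 + M₁ := by gcongr
      _ ≤ _ := by nlinarith [abs_nonneg k, abs_nonneg (k * (k - 1)), mul_nonneg (abs_nonneg k) hM₁0]
  · have : deriv (deriv (powCut k n)) r * r ^ 2 =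
        r ^ k * (k * (k - 1) * θ (r / N) + 2 * k * (r / N * deriv θ (r / N)) +
          (r / N) ^ 2 * deriv (deriv θ) (r / N)) := by
      rw [e2, Real.rpow_sub_one hr0.ne', Real.rpow_sub_one hr0.ne']
      field_simp
      ring
    have h2 : |deriv (deriv (powCut k n)) r * r ^ 2| = |deriv (deriv (powCut k n)) r| * r ^ 2 := by
      rw [abs_mul, abs_sq]
    rw [← h2, this, abs_mul, abs_of_pos hrk, mul_comm]
    refine mul_le_mul_of_nonneg_right ?_ hrk.le
    calc _ ≤ |k * (k - 1)| * |θ (r / N)| + 2 * |k| * |r / N * deriv θ (r / N)| +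
          |(r / N) ^ 2 * deriv (deriv θ) (r / N)| := by
          refine (abs_add_le _ _).trans (add_le_add ((abs_add_le _ _).trans ?_) le_rfl)
          rw [abs_mul (k * (k - 1)), abs_mul (2 * k), abs_mul 2 k, abs_two]
      _ ≤ |k * (k - 1)| * 1 + 2 * |k| * M₁ + M₂ := by gcongr
      _ ≤ _ := by nlinarith [abs_nonneg k, abs_nonneg (k * (k - 1)), mul_nonneg (abs_nonneg k) hM₁0]

/-! ### The weak form tested against `g ⟨v⟩^{2k}` -/

/-- The zeroth-order term for the weight `⟨v⟩^{2k}`. -/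
noncomputable def powTerm (γ k : ℝ) (v w : V) : ℝ :=
  bracket v ^ (2 * k) * ((γ + 3 - 2 * k) + 2 * k * (bracket w ^ 2 / bracket v ^ 2) +
    2 * k * (k - 1) * (gramDet v w / bracket v ^ 4))

lemma bracket_rpow_two_mul (k : ℝ) (v : V) : bracket v ^ (2 * k) = (1 + ‖v‖ ^ 2) ^ k := by
  rw [bracket_rpow_eq]; congr 1; ring

lemma zerothTerm_eventuallyEq (γ k : ℝ) (v w : V) :
    ∀ᶠ n in Filter.atTop, zerothTerm γ (powCut k n) v w = powTerm γ k v w := by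
  have hr : 1 ≤ 1 + ‖v‖ ^ 2 := by nlinarith [sq_nonneg ‖v‖]
  filter_upwards [Filter.eventually_gt_atTop ⌈1 + ‖v‖ ^ 2⌉₊] with n hn
  have hn' : 1 + ‖v‖ ^ 2 < n + 1 := by
    have := (Nat.le_ceil (1 + ‖v‖ ^ 2)).trans_lt (Nat.cast_lt.2 hn)
    linarith
  have hr0 : 0 < 1 + ‖v‖ ^ 2 := by linarith
  rw [zerothTerm, powTerm, (powCut_eventuallyEq_rpow k n hr hn').eq_of_nhds,
    deriv_powCut_eq k n hr hn', deriv_deriv_powCut_eq k n hr hn', bracket_rpow_two_mul,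
    show bracket v ^ 4 = (bracket v ^ 2) ^ 2 by ring, bracket_sq, bracket_sq,
    show k - 2 = k - 1 - 1 by ring]
  simp only [Real.rpow_sub_one hr0.ne']
  field_simp
  ring

lemma exists_abs_zerothTerm_le (γ k : ℝ) : ∃ B, 0 < B ∧ ∀ (n : ℕ) (v w : V),
    |zerothTerm γ (powCut k n) v w| ≤
      B * (bracket v ^ (2 * k) * (1 + bracket w ^ 2 / bracket v ^ 2)) := by
  obtain ⟨B, hB0, hB⟩ := exists_abs_deriv_powCut_le k
  refine ⟨|γ + 3| + 2 * B + 2 * B, by positivity, fun n v w => ?_⟩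
  have hr : 1 ≤ 1 + ‖v‖ ^ 2 := by nlinarith [sq_nonneg ‖v‖]
  obtain ⟨h1, h2⟩ := hB n _ hr
  have h0 : |powCut k n (1 + ‖v‖ ^ 2)| ≤ (1 + ‖v‖ ^ 2) ^ k := by
    rw [abs_of_nonneg (powCut_nonneg k n hr)]; exact powCut_le k n hr
  rw [bracket_rpow_two_mul, ← bracket_sq] at *
  set r := bracket v ^ 2 with hrdef
  set A := powCut k n r
  set A' := deriv (powCut k n) r
  set A'' := deriv (deriv (powCut k n)) r
  have hr0 : 0 < r := by linarith
  have hq : 0 ≤ bracket w ^ 2 / r := by positivity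
  have hrk : 0 < r ^ k := Real.rpow_pos_of_pos hr0 k
  have s1 : |2 * A' * (‖w‖ ^ 2 - ‖v‖ ^ 2)| ≤ 2 * B * (r ^ k * (1 + bracket w ^ 2 / r)) := by
    have e : ‖w‖ ^ 2 - ‖v‖ ^ 2 = bracket w ^ 2 - r := by rw [hrdef, bracket_sq, bracket_sq]; ring
    have : |bracket w ^ 2 - r| ≤ r * (1 + bracket w ^ 2 / r) := by
      rw [mul_add, mul_one, mul_div_cancel₀ _ hr0.ne', abs_le]
      constructor <;> nlinarith [sq_nonneg (bracket w)]
    rw [e, abs_mul, abs_mul, abs_two]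
    calc 2 * |A'| * |bracket w ^ 2 - r| ≤ 2 * |A'| * (r * (1 + bracket w ^ 2 / r)) := by gcongr
      _ = 2 * (|A'| * r) * (1 + bracket w ^ 2 / r) := by ring
      _ ≤ 2 * (B * r ^ k) * (1 + bracket w ^ 2 / r) := by gcongr
      _ = _ := by ring
  have s2 : |2 * A'' * gramDet v w| ≤ 2 * B * (r ^ k * (1 + bracket w ^ 2 / r)) := by
    rw [abs_mul, abs_mul, abs_two, abs_of_nonneg (gramDet_nonneg v w)]
    calc 2 * |A''| * gramDet v w ≤ 2 * |A''| * (r * bracket w ^ 2) := by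
          gcongr; exact gramDet_le v w
      _ = 2 * (|A''| * r ^ 2) * (bracket w ^ 2 / r) := by field_simp
      _ ≤ 2 * (B * r ^ k) * (1 + bracket w ^ 2 / r) := by gcongr; linarith
      _ = _ := by ring
  have s0 : |(γ + 3) * A| ≤ |γ + 3| * (r ^ k * (1 + bracket w ^ 2 / r)) := by
    rw [abs_mul]
    refine mul_le_mul_of_nonneg_left (h0.trans ?_) (abs_nonneg _)
    exact le_mul_of_one_le_right hrk.le (by linarith)
  have e : zerothTerm γ (powCut k n) v w =
      (γ + 3) * A + 2 * A' * (‖w‖ ^ 2 - ‖v‖ ^ 2) + 2 * A'' * gramDet v w := by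
    rw [zerothTerm, ← bracket_sq]
  rw [e]
  calc _ ≤ |(γ + 3) * A| + |2 * A' * (‖w‖ ^ 2 - ‖v‖ ^ 2)| + |2 * A'' * gramDet v w| :=
        (abs_add_le _ _).trans (add_le_add (abs_add_le _ _) le_rfl)
    _ ≤ _ := by linarith

/-! ### Trading the singular kernel for the weight in `v`, and the dominating density. -/

lemma bracket_rpow_eq_sq_rpow (γ : ℝ) (v : V) : bracket v ^ γ = (bracket v ^ 2) ^ (γ / 2) := by
  rw [bracket_rpow_eq, bracket_sq]

/-- A Peetre-type inequality: `⟨v⟩² ≤ 2(1 + |v - w|²)⟨w⟩²` raised to the power `-γ/2`, which lies in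
`[0, 1]` and so costs at most `⟨w⟩²`. Large `|v - w|` gives the decay `⟨v⟩^γ`, small `|v - w|` keeps
the singularity. -/
lemma norm_rpow_le_bracket_rpow {γ : ℝ} (hγ₁ : -2 < γ) (hγ₂ : γ < 0) (v w : V) :
    ‖v - w‖ ^ γ ≤ 4 * (bracket w ^ 2 * (1 + ‖v - w‖ ^ γ) * bracket v ^ γ) := by
  by_cases hz : ‖v - w‖ = 0
  · rw [hz, Real.zero_rpow hγ₂.ne]
    have := bracket_rpow_pos γ v; positivity
  have hz0 : 0 < ‖v - w‖ := lt_of_le_of_ne (norm_nonneg _) (Ne.symm hz)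
  set p := -(γ / 2) with hp
  have hp0 : 0 ≤ p := by linarith
  have hp1 : p ≤ 1 := by linarith
  have hv : bracket v ^ γ = ((bracket v ^ 2) ^ p)⁻¹ := by
    rw [bracket_rpow_eq_sq_rpow, ← Real.rpow_neg (by positivity), hp, neg_neg]
  have hle_self : ∀ x : ℝ, 1 ≤ x → x ^ p ≤ x := fun x hx => by
    simpa using Real.rpow_le_rpow_of_exponent_le hx hp1
  have h1 : (bracket v ^ 2) ^ p ≤ 2 * (1 + ‖v - w‖ ^ 2) ^ p * bracket w ^ 2 := by
    calc (bracket v ^ 2) ^ p ≤ (2 * (1 + ‖v - w‖ ^ 2) * bracket w ^ 2) ^ p :=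
          Real.rpow_le_rpow (by positivity) (bracket_sub_le v w) hp0
      _ = 2 ^ p * (1 + ‖v - w‖ ^ 2) ^ p * (bracket w ^ 2) ^ p := by
          rw [Real.mul_rpow (by positivity) (by positivity), Real.mul_rpow (by norm_num)
            (by positivity)]
      _ ≤ _ := by
          gcongr
          · exact hle_self 2 (by norm_num)
          · exact hle_self _ (one_le_pow₀ (one_le_bracket w))
  have h2 : ‖v - w‖ ^ γ * (1 + ‖v - w‖ ^ 2) ^ p ≤ 2 * (1 + ‖v - w‖ ^ γ) := by
    have hzγ : 0 < ‖v - w‖ ^ γ := Real.rpow_pos_of_pos hz0 _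
    have h2p : (2 : ℝ) ^ p ≤ 2 := hle_self 2 (by norm_num)
    rcases le_or_gt 1 ‖v - w‖ with h | h
    · have h3 : (1 + ‖v - w‖ ^ 2) ^ p ≤ 2 * (‖v - w‖ ^ 2) ^ p := by
        calc (1 + ‖v - w‖ ^ 2) ^ p ≤ (2 * ‖v - w‖ ^ 2) ^ p :=
              Real.rpow_le_rpow (by positivity) (by nlinarith) hp0
          _ = 2 ^ p * (‖v - w‖ ^ 2) ^ p := Real.mul_rpow (by norm_num) (by positivity)
          _ ≤ _ := by gcongr
      have h4 : ‖v - w‖ ^ γ * (‖v - w‖ ^ 2) ^ p = 1 := by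
        rw [norm_rpow_eq_sq_rpow, ← Real.rpow_add (by positivity), hp]; simp
      calc _ ≤ ‖v - w‖ ^ γ * (2 * (‖v - w‖ ^ 2) ^ p) := by gcongr
        _ = 2 := by linarith
        _ ≤ _ := by linarith
    · have h3 : (1 + ‖v - w‖ ^ 2) ^ p ≤ 2 :=
        (Real.rpow_le_rpow (by positivity) (by nlinarith) hp0).trans h2p
      nlinarith
  rw [hv, ← div_eq_mul_inv, ← mul_div_assoc, le_div_iff₀ (by have := bracket_pos v; positivity)]
  calc ‖v - w‖ ^ γ * (bracket v ^ 2) ^ p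
      ≤ ‖v - w‖ ^ γ * (2 * (1 + ‖v - w‖ ^ 2) ^ p * bracket w ^ 2) := by gcongr
    _ = 2 * (‖v - w‖ ^ γ * (1 + ‖v - w‖ ^ 2) ^ p) * bracket w ^ 2 := by ring
    _ ≤ 2 * (2 * (1 + ‖v - w‖ ^ γ)) * bracket w ^ 2 := by gcongr
    _ = _ := by ring

lemma norm_rpow_mul_weight_le {γ : ℝ} (hγ₁ : -2 < γ) (hγ₂ : γ < 0) (v w : V) :
    ‖v - w‖ ^ γ * (1 + bracket w ^ 2 / bracket v ^ 2) ≤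
      5 * (bracket w ^ 2 * (1 + ‖v - w‖ ^ γ) * bracket v ^ γ) := by
  have h1 := norm_rpow_le_bracket_rpow hγ₁ hγ₂ v w
  have h2 : (bracket v ^ 2)⁻¹ ≤ bracket v ^ γ := by
    have := bracket_rpow_le hγ₁.le v
    rwa [Real.rpow_neg (bracket_pos v).le, Real.rpow_two] at this
  have h3 : 0 ≤ ‖v - w‖ ^ γ := by positivity
  have h4 : ‖v - w‖ ^ γ * (bracket w ^ 2 / bracket v ^ 2) ≤
      bracket w ^ 2 * (1 + ‖v - w‖ ^ γ) * bracket v ^ γ := by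
    rw [div_eq_mul_inv]
    have := bracket_rpow_pos γ v
    calc ‖v - w‖ ^ γ * (bracket w ^ 2 * (bracket v ^ 2)⁻¹)
        ≤ (1 + ‖v - w‖ ^ γ) * (bracket w ^ 2 * bracket v ^ γ) := by gcongr; linarith
      _ = _ := by ring
  linarith

lemma bracket_rpow_two_mul_mul (γ k : ℝ) (v : V) :
    bracket v ^ (2 * k) * bracket v ^ γ = (bracket v ^ (k + γ / 2)) ^ 2 := by
  rw [← Real.rpow_natCast (bracket v ^ _), ← Real.rpow_mul (bracket_pos v).le,
    ← Real.rpow_add (bracket_pos v)]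
  congr 1; push_cast; ring

/-- The dominating density of the zeroth-order terms. -/
noncomputable def majorant (γ l : ℝ) (f g : V → ℝ) (p : V × V) : ℝ :=
  (bracket p.1 ^ l * g p.1) ^ 2 * (bracket p.2 ^ 2 * f p.2) +
    ‖p.1 - p.2‖ ^ γ * (bracket p.1 ^ l * g p.1) ^ 2 * (bracket p.2 ^ 2 * f p.2)

lemma abs_le_majorant {γ : ℝ} (hγ₁ : -2 < γ) (hγ₂ : γ < 0) {k B T : ℝ} (hB : 0 ≤ B) {f g : V → ℝ}
    (hf : ∀ v, 0 ≤ f v) (p : V × V)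
    (hT : T ≤ B * (bracket p.1 ^ (2 * k) * (1 + bracket p.2 ^ 2 / bracket p.1 ^ 2))) :
    ‖p.1 - p.2‖ ^ γ * (T * g p.1 ^ 2) * f p.2 ≤ 5 * B * majorant γ (k + γ / 2) f g p := by
  have h1 := norm_rpow_mul_weight_le hγ₁ hγ₂ p.1 p.2
  have h2 := bracket_rpow_pos (2 * k) p.1
  have h3 := hf p.2
  calc ‖p.1 - p.2‖ ^ γ * (T * g p.1 ^ 2) * f p.2
      ≤ ‖p.1 - p.2‖ ^ γ * ((B * (bracket p.1 ^ (2 * k) *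
          (1 + bracket p.2 ^ 2 / bracket p.1 ^ 2))) * g p.1 ^ 2) * f p.2 := by gcongr
    _ = B * bracket p.1 ^ (2 * k) * (‖p.1 - p.2‖ ^ γ * (1 + bracket p.2 ^ 2 / bracket p.1 ^ 2)) *
          (g p.1 ^ 2 * f p.2) := by ring
    _ ≤ B * bracket p.1 ^ (2 * k) *
          (5 * (bracket p.2 ^ 2 * (1 + ‖p.1 - p.2‖ ^ γ) * bracket p.1 ^ γ)) *
          (g p.1 ^ 2 * f p.2) := by gcongr
    _ = 5 * B * ((1 + ‖p.1 - p.2‖ ^ γ) * ((bracket p.1 ^ (2 * k) * bracket p.1 ^ γ) * g p.1 ^ 2) *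
          (bracket p.2 ^ 2 * f p.2)) := by ring
    _ = _ := by rw [bracket_rpow_two_mul_mul, majorant]; ring

/-- The nonsingular part factorizes into the moment of `f` and the weighted norm of `g`; the
singular part is the form bound. -/
lemma exists_majorant_integral_le {γ : ℝ} (hγ₁ : -2 < γ) (hγ₂ : γ < 0) {ε : ℝ} (hε : 0 < ε) :
    ∃ C, 0 < C ∧ ∀ (l E : ℝ) (f g : V → ℝ), ContDiff ℝ ∞ g → Continuous f → (∀ v, 0 ≤ f v) →
      Integrable (fun v : V => bracket v ^ 2 * f v) → ∫ v : V, bracket v ^ 2 * f v ≤ E →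
      MemLp (fun v : V => bracket v ^ l * g v) 2 →
      (∀ i, MemLp (fun v : V => bracket v ^ l * pd i g v) 2) →
      Integrable (majorant γ l f g) (volume.prod volume) ∧
      ∫ p, majorant γ l f g p ∂(volume.prod volume) ≤
        E * (ε * (2 * normSqH1dot l g + 6 * l ^ 2 * normSqL2 l g) + C * normSqL2 l g) := by
  obtain ⟨C, hC0, hC⟩ := exists_integral_prod_norm_rpow_mul_le hγ₁ hγ₂ hε
  refine ⟨C + 1, by positivity, fun l E f g hg hf hf0 hi hE h h' => ?_⟩
  obtain ⟨k1, k2⟩ := hC l E f g hg hf hf0 hi hE h h'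
  have k3 := h.integrable_sq.mul_prod hi
  refine ⟨k3.add k1, ?_⟩
  have e : ∫ p : V × V, (bracket p.1 ^ l * g p.1) ^ 2 * (bracket p.2 ^ 2 * f p.2)
      ∂(volume.prod volume) ≤ E * normSqL2 l g := by
    rw [integral_prod_mul (fun v : V => (bracket v ^ l * g v) ^ 2) fun w : V => bracket w ^ 2 * f w,
      mul_comm]
    exact mul_le_mul_of_nonneg_right hE (normSqL2_nonneg l g)
  simp only [majorant]
  rw [integral_add k3 k1]
  linarith

lemma measurable_zerothTerm {γ : ℝ} {Φ : ℝ → ℝ} (hΦ : ContDiff ℝ ∞ Φ) :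
    Measurable fun p : V × V => zerothTerm γ Φ p.1 p.2 := by
  have hc0 := hΦ.continuous
  have hc1 := (contDiff_deriv hΦ).continuous
  have hc2 := (contDiff_deriv (contDiff_deriv hΦ)).continuous
  refine Continuous.measurable ?_
  simp only [zerothTerm, gramDet]
  fun_prop

lemma integral_weight_grad {l : ℝ} {g : V → ℝ}
    (h : ∀ i, MemLp (fun v : V => bracket v ^ l * pd i g v) 2) :
    Integrable (fun v => (bracket v ^ l) ^ 2 * ‖grad g v‖ ^ 2) ∧
    ∫ v, (bracket v ^ l) ^ 2 * ‖grad g v‖ ^ 2 = normSqH1dot l g := by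
  have e : ∀ v, (bracket v ^ l) ^ 2 * ‖grad g v‖ ^ 2 = ∑ i, (bracket v ^ l * pd i g v) ^ 2 :=
    fun v => by
      rw [norm_sq_eq_coord, Fin.sum_univ_three]; simp only [grad_apply]; ring
  simp_rw [e]
  exact ⟨integrable_finsetSum _ fun i _ => (h i).integrable_sq,
    integral_finsetSum _ fun i _ => (h i).integrable_sq⟩

/-- The basic energy inequality: the pairing is bounded by minus the coercive term, plus the
zeroth-order terms. -/
lemma pairing_le {γ : ℝ} (hγ₁ : -2 < γ) (hγ₂ : γ < 0) {m₀ E₀ H₀ : ℝ} {k K : ℝ} {f g : V → ℝ}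
    (hf : IsDensity m₀ E₀ H₀ f) (hg : IsAdmissible γ k f g)
    (hK : ∀ v ξ : V, K * bracket v ^ γ * ‖ξ‖ ^ 2 ≤ ∑ i, ∑ j, aBar γ f i j v * ξ i * ξ j) :
    Integrable (fun p : V × V => ‖p.1 - p.2‖ ^ γ * (powTerm γ k p.1 p.2 * g p.1 ^ 2) * f p.2)
      (volume.prod volume) ∧
    pairing γ k f g ≤ -K * normSqH1dot (k + γ / 2) g +
      ∫ p : V × V, ‖p.1 - p.2‖ ^ γ * (powTerm γ k p.1 p.2 * g p.1 ^ 2) * f p.2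
        ∂(volume.prod volume) := by
  obtain ⟨B, hB0, hB⟩ := exists_abs_zerothTerm_le γ k
  obtain ⟨_, _, hmaj⟩ := exists_majorant_integral_le hγ₁ hγ₂ one_pos
  have hmaj := (hmaj (k + γ / 2) E₀ f g hg.smooth hf.continuous hf.nonneg hf.moment_integrable
    hf.moment_le hg.memL2 hg.memH1dot).1.const_mul (5 * B)
  have hfm := hf.continuous.measurable
  have hgm := hg.smooth.continuous.measurable
  set Z : ℕ → V × V → ℝ := fun n p =>
    ‖p.1 - p.2‖ ^ γ * (zerothTerm γ (powCut k n) p.1 p.2 * g p.1 ^ 2) * f p.2 with hZ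
  set Z' : V × V → ℝ := fun p =>
    ‖p.1 - p.2‖ ^ γ * (powTerm γ k p.1 p.2 * g p.1 ^ 2) * f p.2 with hZ'
  have hZm : ∀ n, AEStronglyMeasurable (Z n) (volume.prod volume) := fun n => by
    have := measurable_zerothTerm (γ := γ) (contDiff_powCut k n)
    exact Measurable.aestronglyMeasurable (by fun_prop)
  have hZb : ∀ n p, ‖Z n p‖ ≤ 5 * B * majorant γ (k + γ / 2) f g p := fun n p => by
    have e : ‖Z n p‖ = ‖p.1 - p.2‖ ^ γ * (|zerothTerm γ (powCut k n) p.1 p.2| * g p.1 ^ 2) * f p.2 := by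
      rw [hZ, Real.norm_eq_abs, abs_mul, abs_mul, abs_mul, abs_sq, abs_of_nonneg (hf.nonneg _),
        abs_of_nonneg (show 0 ≤ ‖p.1 - p.2‖ ^ γ by positivity)]
    rw [e]
    exact abs_le_majorant hγ₁ hγ₂ hB0.le hf.nonneg p (hB n _ _)
  have hZi : ∀ n, Integrable (Z n) (volume.prod volume) := fun n =>
    hmaj.mono' (hZm n) (ae_of_all _ (hZb n))
  have hZl : ∀ p, Filter.Tendsto (fun n => Z n p) Filter.atTop (nhds (Z' p)) := fun p => by
    refine tendsto_const_nhds.congr' ?_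
    filter_upwards [zerothTerm_eventuallyEq γ k p.1 p.2] with n hn
    simp only [hZ, hZ', hn]
  have limZ := tendsto_integral_of_dominated_convergence _ hZm hmaj
    (fun n => ae_of_all _ (hZb n)) (ae_of_all _ hZl)
  have hZ'i : Integrable Z' (volume.prod volume) := by
    refine hmaj.mono' (aestronglyMeasurable_of_tendsto_ae _ hZm (ae_of_all _ hZl))
      (ae_of_all _ fun p => ?_)
    exact le_of_tendsto (hZl p).norm (Filter.Eventually.of_forall fun n => hZb n p)
  refine ⟨hZ'i, ?_⟩
  have hr : ∀ v : V, 1 ≤ 1 + ‖v‖ ^ 2 := fun v => by nlinarith [sq_nonneg ‖v‖]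
  have hΦ0 : ∀ n (v : V), 0 ≤ powCut k n (1 + ‖v‖ ^ 2) := fun n v => powCut_nonneg k n (hr v)
  have hΦ1 : ∀ n (v : V), powCut k n (1 + ‖v‖ ^ 2) ≤ bracket v ^ (2 * k) := fun n v => by
    rw [bracket_rpow_two_mul]; exact powCut_le k n (hr v)
  have hΦl : ∀ v : V, Filter.Tendsto (fun n => powCut k n (1 + ‖v‖ ^ 2)) Filter.atTop
      (nhds (bracket v ^ (2 * k))) := fun v => by
    refine tendsto_const_nhds.congr' ?_
    filter_upwards [Filter.eventually_gt_atTop ⌈1 + ‖v‖ ^ 2⌉₊] with n hn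
    have := (Nat.le_ceil (1 + ‖v‖ ^ 2)).trans_lt (Nat.cast_lt.2 hn)
    rw [(powCut_eventuallyEq_rpow k n (hr v) (by linarith)).eq_of_nhds, bracket_rpow_two_mul]
  have hΦc : ∀ n, Continuous fun v : V => powCut k n (1 + ‖v‖ ^ 2) := fun n => by
    have := (contDiff_powCut k n).continuous
    fun_prop
  -- Only here is the integrability of the pairing used: the truncated weight never exceeds
  -- `⟨v⟩^{2k}`, so the pairing integrand itself dominates.
  have limP : Filter.Tendsto (fun n => ∫ v, Q γ f g v * (g v * powCut k n (1 + ‖v‖ ^ 2)))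
      Filter.atTop (nhds (pairing γ k f g)) := by
    have ae : ∀ n, (fun v => Q γ f g v * (g v * powCut k n (1 + ‖v‖ ^ 2))) = fun v =>
        pairingIntegrand γ k f g v * (powCut k n (1 + ‖v‖ ^ 2) * (bracket v ^ (2 * k))⁻¹) :=
      fun n => funext fun v => by
        rw [pairingIntegrand]
        have := (bracket_rpow_pos (2 * k) v).ne'
        field_simp
    refine tendsto_integral_of_dominated_convergence (fun v => ‖pairingIntegrand γ k f g v‖)
      (fun n => ?_) hg.pairing_integrable.norm (fun n => ae_of_all _ fun v => ?_)
      (ae_of_all _ fun v => ?_)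
    · rw [ae]
      refine hg.pairing_integrable.aestronglyMeasurable.mul ?_
      exact ((hΦc n).mul ((contDiff_bracket_rpow (2 * k)).continuous.inv₀
        fun v => (bracket_rpow_pos (2 * k) v).ne')).aestronglyMeasurable
    · rw [pairingIntegrand, norm_mul, norm_mul, norm_mul, norm_mul,
        Real.norm_of_nonneg (hΦ0 n v), Real.norm_of_nonneg (bracket_rpow_pos _ v).le]
      gcongr
      exact hΦ1 n v
    · exact ((hΦl v).const_mul _).const_mul _
  have hgr := continuous_grad (hg.smooth.of_le (by simp : (1 : WithTop ℕ∞) ≤ ∞))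
  have hbr := (contDiff_bracket_rpow γ).continuous
  obtain ⟨hH, hH'⟩ := integral_weight_grad hg.memH1dot
  have limH : Filter.Tendsto (fun n => ∫ v, powCut k n (1 + ‖v‖ ^ 2) *
      (bracket v ^ γ * ‖grad g v‖ ^ 2)) Filter.atTop (nhds (normSqH1dot (k + γ / 2) g)) := by
    rw [← hH']
    refine tendsto_integral_of_dominated_convergence _ (fun n =>
      ((hΦc n).mul (hbr.mul (hgr.norm.pow 2))).aestronglyMeasurable) hH
      (fun n => ae_of_all _ fun v => ?_) (ae_of_all _ fun v => ?_)
    · have := bracket_rpow_pos γ v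
      rw [Real.norm_of_nonneg (mul_nonneg (hΦ0 n v) (by positivity)), ← bracket_rpow_two_mul_mul,
        mul_assoc]
      exact mul_le_mul_of_nonneg_right (hΦ1 n v) (by positivity)
    · rw [← bracket_rpow_two_mul_mul, mul_assoc]
      exact (hΦl v).mul_const _
  -- The inequality is proved for each truncation, where the weak form and the ellipticity of `a *
  -- f` apply, and the three limits are taken together.
  refine le_of_tendsto_of_tendsto' limP ((limH.const_mul (-K)).add limZ) fun n => ?_
  have hvan := vanishesAbove_powCut k n
  rw [integral_Q_mul hγ₁ hγ₂ hf.smooth hf.moment_integrable hg.smooth (contDiff_powCut k n) hvan]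
  refine add_le_add ?_ (le_of_eq ?_)
  · have ha := contDiff_aBar hγ₁ hγ₂ hf.smooth hf.moment_integrable
    have hpg : ∀ i, Continuous (pd i g) := fun i => (contDiff_pd hg.smooth i).continuous
    rw [neg_mul, neg_le_neg_iff, ← integral_const_mul]
    refine integral_mono (Continuous.integrable_of_hasCompactSupport
      (continuous_const.mul ((hΦc n).mul (hbr.mul (hgr.norm.pow 2))))
      hvan.hasCompactSupport.mul_right.mul_left)
      (Continuous.integrable_of_hasCompactSupport ((hΦc n).mul (continuous_finsetSum _ fun i _ =>
        continuous_finsetSum _ fun j _ => ((ha i j).continuous.mul (hpg i)).mul (hpg j)))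
        hvan.hasCompactSupport.mul_right) fun v => ?_
    have := mul_le_mul_of_nonneg_left (hK v (grad g v)) (hΦ0 n v)
    simp only [grad_apply] at this
    simp only
    linarith
  · rw [integral_prod_symm _ (hZi n)]
    congr 1; funext w
    simp only [hZ]
    rw [integral_mul_const]

/-! ### The coercivity estimate -/

/-- The convolution `|·|^γ * f` is bounded below by `⟨v⟩^γ`. -/
lemma le_integral_norm_rpow_mul {γ : ℝ} (hγ₁ : -2 < γ) (hγ₂ : γ < 0) {m₀ E₀ H₀ E : ℝ}
    (hE : 0 < E) (hE₀ : E₀ ≤ E) (hm₀ : 0 < m₀) {f : V → ℝ} (hf : IsDensity m₀ E₀ H₀ f) (v : V) :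
    2 ^ (γ / 2) * (m₀ ^ 2 / E) * bracket v ^ γ ≤ ∫ w, ‖v - w‖ ^ γ * f w := by
  set s := m₀ / E with hs
  have hs0 : 0 < s := by positivity
  have hc : 0 < (2 : ℝ) ^ (γ / 2) * bracket v ^ γ :=
    mul_pos (Real.rpow_pos_of_pos two_pos _) (bracket_rpow_pos γ v)
  have hpt : ∀ w, w ≠ v → 2 ^ (γ / 2) * bracket v ^ γ *
      (2 * s * f w - s ^ 2 * (bracket w ^ 2 * f w)) ≤ ‖v - w‖ ^ γ * f w := fun w hw => by
    have hz : 0 < ‖v - w‖ := norm_pos_iff.2 (sub_ne_zero.2 hw.symm)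
    have h1 : 2 ^ (γ / 2) * bracket v ^ γ * bracket w ^ γ ≤ ‖v - w‖ ^ γ := by
      rw [norm_rpow_eq_sq_rpow, bracket_rpow_eq_sq_rpow, bracket_rpow_eq_sq_rpow γ w,
        ← Real.mul_rpow (by norm_num) (by positivity),
        ← Real.mul_rpow (by positivity) (by positivity)]
      exact Real.rpow_le_rpow_of_nonpos (by positivity) (norm_sub_sq_le v w) (by linarith)
    -- The convex function `1/x` lies above its tangent at `x = 1/s`; this bounds `⟨w⟩^{-2}` below
    -- by something integrable against `f` through mass and moment alone. The value `s = m₀/E`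
    -- maximizes `2 s m₀ - s² E`.
    have h2 : 2 * s - s ^ 2 * bracket w ^ 2 ≤ bracket w ^ γ := by
      have h3 := bracket_rpow_le hγ₁.le w
      rw [Real.rpow_neg (bracket_pos w).le, Real.rpow_two] at h3
      refine le_trans ?_ h3
      have hb : 0 < bracket w ^ 2 := by have := bracket_pos w; positivity
      rw [inv_eq_one_div, le_div_iff₀ hb]
      nlinarith [sq_nonneg (s * bracket w ^ 2 - 1)]
    calc _ = 2 ^ (γ / 2) * bracket v ^ γ * (2 * s - s ^ 2 * bracket w ^ 2) * f w := by ring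
      _ ≤ 2 ^ (γ / 2) * bracket v ^ γ * bracket w ^ γ * f w := by
          have := hf.nonneg w
          gcongr
      _ ≤ _ := mul_le_mul_of_nonneg_right h1 (hf.nonneg w)
  have i1 := hf.integrable.const_mul (2 * s)
  have i2 := hf.moment_integrable.const_mul (s ^ 2)
  have h := integral_mono_ae ((i1.sub i2).const_mul (2 ^ (γ / 2) * bracket v ^ γ))
    (integrable_norm_rpow_mul hγ₁ hγ₂ hf.continuous hf.integrable v)
    (by filter_upwards [ae_ne v] with w hw using hpt w hw)
  rw [integral_const_mul, integral_sub' i1 i2, integral_const_mul, integral_const_mul] at h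
  refine le_trans ?_ h
  rw [mul_right_comm]
  refine mul_le_mul_of_nonneg_left ?_ hc.le
  have h4 := mul_le_mul_of_nonneg_left hf.mass_ge (show 0 ≤ 2 * s by positivity)
  have h5 := mul_le_mul_of_nonneg_left (hf.moment_le.trans hE₀) (sq_nonneg s)
  have h6 : 2 * s * m₀ - s ^ 2 * E = m₀ ^ 2 / E := by rw [hs]; field_simp; ring
  linarith

/-! ### Upper bounds for the zeroth-order term in the two ranges of `k`. -/

lemma gramDet_div_mem (v w : V) :
    0 ≤ gramDet v w / bracket v ^ 4 ∧
      gramDet v w / bracket v ^ 4 ≤ bracket w ^ 2 / bracket v ^ 2 := by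
  have hb := bracket_pos v
  refine ⟨div_nonneg (gramDet_nonneg v w) (by positivity), ?_⟩
  rw [div_le_div_iff₀ (by positivity) (by positivity)]
  calc gramDet v w * bracket v ^ 2 ≤ bracket v ^ 2 * bracket w ^ 2 * bracket v ^ 2 := by
        gcongr; exact gramDet_le v w
    _ = _ := by ring

/-- Since `γ < 0` forces `k ≤ 3/2`, each of `γ + 3 - 2k`, `2k` and `2k(k-1)` is at most 3, which
makes the bound uniform in `k`. -/
lemma powTerm_le_of_le {γ k : ℝ} (hγ : γ < 0) (hk₀ : 0 ≤ k) (hk : k ≤ (γ + 3) / 2) (v w : V) :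
    powTerm γ k v w ≤ 6 * (bracket v ^ (2 * k) * (1 + bracket w ^ 2 / bracket v ^ 2)) := by
  obtain ⟨h1, h2⟩ := gramDet_div_mem v w
  have h3 := bracket_rpow_pos (2 * k) v
  rw [powTerm, mul_left_comm]
  refine mul_le_mul_of_nonneg_left ?_ h3.le
  set q := bracket w ^ 2 / bracket v ^ 2
  set d := gramDet v w / bracket v ^ 4
  have h4 : 2 * k * (k - 1) * d ≤ 3 * q := by
    have h5 : 2 * k * (k - 1) ≤ 3 := by
      nlinarith [mul_nonneg hk₀ (show 0 ≤ 3 / 2 - k by linarith)]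
    calc 2 * k * (k - 1) * d ≤ 3 * d := mul_le_mul_of_nonneg_right h5 h1
      _ ≤ 3 * q := by linarith
  nlinarith

/-- The leading term is kept with its negative sign; the other two lose a factor `⟨v⟩²` against
`⟨w⟩²`. The absolute value covers `k < 1`, which is possible when `γ < -1`. -/
lemma powTerm_le_of_lt {γ k : ℝ} (hk₀ : 0 ≤ k) (v w : V) :
    powTerm γ k v w ≤ -(2 * k - (γ + 3)) * bracket v ^ (2 * k) +
      (2 * k + 2 * k * |k - 1|) * ((bracket v ^ (k - 1)) ^ 2 * bracket w ^ 2) := by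
  obtain ⟨h1, h2⟩ := gramDet_div_mem v w
  have h3 := bracket_rpow_pos (2 * k) v
  have e : (bracket v ^ (k - 1)) ^ 2 = bracket v ^ (2 * k) / bracket v ^ 2 := by
    rw [← Real.rpow_natCast (bracket v ^ _), ← Real.rpow_mul (bracket_pos v).le,
      ← Real.rpow_natCast (bracket v), ← Real.rpow_sub (bracket_pos v)]
    congr 1; push_cast; ring
  rw [e, powTerm]
  set q := bracket w ^ 2 / bracket v ^ 2 with hq
  set d := gramDet v w / bracket v ^ 4
  have h4 : 2 * k * (k - 1) * d ≤ 2 * k * |k - 1| * q := by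
    calc 2 * k * (k - 1) * d ≤ 2 * k * |k - 1| * d := by gcongr; exact le_abs_self _
      _ ≤ _ := by gcongr
  have e2 : bracket v ^ (2 * k) / bracket v ^ 2 * bracket w ^ 2 = bracket v ^ (2 * k) * q := by
    rw [hq]; ring
  rw [e2]
  nlinarith

lemma normSqH1dot_mono {l l' : ℝ} (hl : l' ≤ l) {g : V → ℝ} (hg : ContDiff ℝ ∞ g)
    (h : ∀ i, MemLp (fun v : V => bracket v ^ l * pd i g v) 2) :
    normSqH1dot l' g ≤ normSqH1dot l g :=
  Finset.sum_le_sum fun i _ =>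
    integral_bracket_rpow_mul_sq_le hl (contDiff_pd hg i).continuous (h i)

lemma integral_powTerm_le_of_lt {γ : ℝ} (hγ₁ : -2 < γ) (hγ₂ : γ < 0) {m₀ E₀ H₀ E k : ℝ}
    (hE : 0 < E) (hE₀ : E₀ ≤ E) (hm₀ : 0 < m₀) (hk₀ : 0 ≤ k) (hk : (γ + 3) / 2 < k) {f g : V → ℝ}
    (hf : IsDensity m₀ E₀ H₀ f) (hg : IsAdmissible γ k f g)
    (hi : Integrable (fun p : V × V => ‖p.1 - p.2‖ ^ γ * (powTerm γ k p.1 p.2 * g p.1 ^ 2) * f p.2)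
      (volume.prod volume))
    (hi' : Integrable (fun p : V × V => ‖p.1 - p.2‖ ^ γ * (bracket p.1 ^ (k - 1) * g p.1) ^ 2 *
        (bracket p.2 ^ 2 * f p.2)) (volume.prod volume)) :
    ∫ p : V × V, ‖p.1 - p.2‖ ^ γ * (powTerm γ k p.1 p.2 * g p.1 ^ 2) * f p.2
        ∂(volume.prod volume) ≤
      -((2 * k - (γ + 3)) * (2 ^ (γ / 2) * (m₀ ^ 2 / E))) * normSqL2 (k + γ / 2) g +
      (2 * k + 2 * k * |k - 1|) * ∫ p : V × V, ‖p.1 - p.2‖ ^ γ *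
        (bracket p.1 ^ (k - 1) * g p.1) ^ 2 * (bracket p.2 ^ 2 * f p.2) ∂(volume.prod volume) := by
  obtain ⟨_, _, hmaj⟩ := exists_majorant_integral_le hγ₁ hγ₂ one_pos
  have hmaj := (hmaj (k + γ / 2) E₀ f g hg.smooth hf.continuous hf.nonneg hf.moment_integrable
    hf.moment_le hg.memL2 hg.memH1dot).1.const_mul (5 * 1)
  have hfm := hf.continuous.measurable
  have hgm := hg.smooth.continuous.measurable
  have hbm := continuous_bracket.measurable
  have i1 : Integrable (fun p : V × V => ‖p.1 - p.2‖ ^ γ * (bracket p.1 ^ (2 * k) * g p.1 ^ 2) *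
      f p.2) (volume.prod volume) := by
    refine hmaj.mono' (Measurable.aestronglyMeasurable (by fun_prop)) (ae_of_all _ fun p => ?_)
    have h0 := bracket_rpow_pos (2 * k) p.1
    have h1 := hf.nonneg p.2
    rw [Real.norm_of_nonneg (by positivity)]
    refine abs_le_majorant hγ₁ hγ₂ zero_le_one hf.nonneg p ?_
    rw [one_mul]
    refine le_mul_of_one_le_right h0.le ?_
    have : 0 ≤ bracket p.2 ^ 2 / bracket p.1 ^ 2 := by positivity
    linarith
  have hδ : 0 < 2 * k - (γ + 3) := by linarith
  have step1 : ∫ p : V × V, ‖p.1 - p.2‖ ^ γ * (powTerm γ k p.1 p.2 * g p.1 ^ 2) * f p.2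
        ∂(volume.prod volume) ≤
      -(2 * k - (γ + 3)) * (∫ p : V × V, ‖p.1 - p.2‖ ^ γ * (bracket p.1 ^ (2 * k) * g p.1 ^ 2) *
        f p.2 ∂(volume.prod volume)) +
      (2 * k + 2 * k * |k - 1|) * ∫ p : V × V, ‖p.1 - p.2‖ ^ γ *
        (bracket p.1 ^ (k - 1) * g p.1) ^ 2 * (bracket p.2 ^ 2 * f p.2) ∂(volume.prod volume) := by
    rw [← integral_const_mul, ← integral_const_mul,
      ← integral_add (i1.const_mul _) (hi'.const_mul _)]
    refine integral_mono hi ((i1.const_mul _).add (hi'.const_mul _)) fun p => ?_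
    have h1 := hf.nonneg p.2
    have h2 := powTerm_le_of_lt (γ := γ) hk₀ p.1 p.2
    calc ‖p.1 - p.2‖ ^ γ * (powTerm γ k p.1 p.2 * g p.1 ^ 2) * f p.2
        ≤ ‖p.1 - p.2‖ ^ γ * ((-(2 * k - (γ + 3)) * bracket p.1 ^ (2 * k) +
          (2 * k + 2 * k * |k - 1|) * ((bracket p.1 ^ (k - 1)) ^ 2 * bracket p.2 ^ 2)) *
            g p.1 ^ 2) * f p.2 := by gcongr
      _ = _ := by ring
  -- Integrating in `w` first exposes `|·|^γ * f`, whose lower bound turns the negative leading term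
  -- into damping with weight `⟨v⟩^{2k+γ}`.
  have step2 : 2 ^ (γ / 2) * (m₀ ^ 2 / E) * normSqL2 (k + γ / 2) g ≤
      ∫ p : V × V, ‖p.1 - p.2‖ ^ γ * (bracket p.1 ^ (2 * k) * g p.1 ^ 2) * f p.2
        ∂(volume.prod volume) := by
    rw [integral_prod _ i1, normSqL2, ← integral_const_mul]
    refine integral_mono (hg.memL2.integrable_sq.const_mul _) i1.integral_prod_left fun v => ?_
    have h1 := le_integral_norm_rpow_mul hγ₁ hγ₂ hE hE₀ hm₀ hf v
    have h2 := bracket_rpow_pos (2 * k) v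
    have e : ∫ w, ‖v - w‖ ^ γ * (bracket v ^ (2 * k) * g v ^ 2) * f w =
        (bracket v ^ (2 * k) * g v ^ 2) * ∫ w, ‖v - w‖ ^ γ * f w := by
      rw [← integral_const_mul]; congr 1; funext w; ring
    simp only
    rw [e, mul_pow, ← bracket_rpow_two_mul_mul]
    calc _ = (bracket v ^ (2 * k) * g v ^ 2) * (2 ^ (γ / 2) * (m₀ ^ 2 / E) * bracket v ^ γ) := by
          ring
      _ ≤ _ := by gcongr
  have := mul_le_mul_of_nonneg_left step2 hδ.le
  linarith

end Landau

/-! ### Choice of constants and absorption of the errors. -/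

theorem mainTheorem7 (γ : ℝ) (hγ₁ : -2 < γ) (hγ₂ : γ < 0)
    (m₀ E₀ H₀ : ℝ) (hm₀ : 0 < m₀) :
    ∃ K : ℝ, 0 < K ∧
      (∃ C : ℝ, 0 < C ∧ ∀ k : ℝ, 0 ≤ k → k ≤ (γ + 3) / 2 →
        ∀ f g : Landau.V → ℝ, Landau.IsDensity m₀ E₀ H₀ f → Landau.IsAdmissible γ k f g →
          Landau.pairing γ k f g ≤
            -K * Landau.normSqH1dot (k + γ / 2) g + C * Landau.normSqL2 (k + γ / 2) g) ∧
      (∀ k : ℝ, (γ + 3) / 2 < k →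
        ∃ K' C : ℝ, 0 < K' ∧ 0 < C ∧
        ∀ f g : Landau.V → ℝ, Landau.IsDensity m₀ E₀ H₀ f → Landau.IsAdmissible γ k f g →
          Landau.pairing γ k f g ≤
            -K * Landau.normSqH1dot (k + γ / 2) g - K' * Landau.normSqL2 (k + γ / 2) g
              + C * Landau.normSqL2 (k - 1) g) := by
  open Landau in
  obtain ⟨K₀, hK₀, hK⟩ := exists_aBar_ge hγ₁ hγ₂ hm₀ E₀ H₀
  set E : ℝ := |E₀| + 1
  have hE : 0 < E := by positivity
  have hE₀ : E₀ ≤ E := (le_abs_self E₀).trans (by simp [E])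
  refine ⟨K₀ / 2, by positivity, ?_, fun k hk => ?_⟩
  -- The gradient error is `5 · 6 · E · ε · 2 = 60 E ε` times the seminorm, hence exactly `K₀/2`.
  · set ε := K₀ / (120 * E) with hε
    have hε0 : 0 < ε := by positivity
    obtain ⟨C, hC0, hC⟩ := exists_majorant_integral_le hγ₁ hγ₂ hε0
    refine ⟨30 * E * (24 * ε + C), by positivity, fun k hk₀ hk f g hf hg => ?_⟩
    obtain ⟨h1, h2⟩ := pairing_le hγ₁ hγ₂ hf hg (hK f hf)
    obtain ⟨h3, h4⟩ := hC (k + γ / 2) E f g hg.smooth hf.continuous hf.nonneg hf.moment_integrable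
      (hf.moment_le.trans hE₀) hg.memL2 hg.memH1dot
    have h5 := integral_mono h1 (h3.const_mul (5 * 6)) fun p =>
      abs_le_majorant hγ₁ hγ₂ (by norm_num) hf.nonneg p (powTerm_le_of_le hγ₂ hk₀ hk p.1 p.2)
    rw [integral_const_mul] at h5
    have hL := normSqL2_nonneg (k + γ / 2) g
    -- The exponent lies in `(-1, 3/2)`, so differentiating the weight costs a constant independent
    -- of `k`.
    have hl : (k + γ / 2) ^ 2 ≤ 4 := by nlinarith
    have h6 : E * ε = K₀ / 120 := by rw [hε]; field_simp
    set H := normSqH1dot (k + γ / 2) g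
    set L := normSqL2 (k + γ / 2) g
    have h7 : E * (ε * (2 * H + 6 * (k + γ / 2) ^ 2 * L) + C * L) ≤
        K₀ / 60 * H + E * (24 * ε + C) * L := by
      have h8 : E * ε * (6 * (k + γ / 2) ^ 2 * L) ≤ E * ε * (6 * 4 * L) := by gcongr
      have h9 : E * ε * (2 * H) = K₀ / 60 * H := by rw [h6]; ring
      linarith
    linarith
  · have hk₀ : 0 < k := by linarith
    set A := 2 * k + 2 * k * |k - 1| with hA
    have hA0 : 0 < A := by positivity
    -- The gradient error is now `2 A E ε = K₀/2` times the seminorm with exponent `k - 1`, so the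
    -- same `K₀/2` survives for every `k`.
    set ε := K₀ / (4 * A * E) with hε
    have hε0 : 0 < ε := by positivity
    obtain ⟨C, hC0, hC⟩ := exists_integral_prod_norm_rpow_mul_le hγ₁ hγ₂ hε0
    have hδ : 0 < 2 * k - (γ + 3) := by linarith
    refine ⟨(2 * k - (γ + 3)) * (2 ^ (γ / 2) * (m₀ ^ 2 / E)),
      A * E * (6 * (k - 1) ^ 2 * ε + C), by positivity, by positivity, fun f g hf hg => ?_⟩
    obtain ⟨h1, h2⟩ := pairing_le hγ₁ hγ₂ hf hg (hK f hf)
    -- This is `γ ≥ -2`; it puts `g` in the spaces with exponent `k - 1` and lets the coercive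
    -- seminorm absorb the error.
    have hle : k - 1 ≤ k + γ / 2 := by linarith
    obtain ⟨h3, h4⟩ := hC (k - 1) E f g hg.smooth hf.continuous hf.nonneg hf.moment_integrable
      (hf.moment_le.trans hE₀) (memLp_bracket_rpow_mul_of_le hle hg.smooth.continuous hg.memL2)
      fun i => memLp_bracket_rpow_mul_of_le hle (contDiff_pd hg.smooth i).continuous (hg.memH1dot i)
    have h5 := integral_powTerm_le_of_lt hγ₁ hγ₂ hE hE₀ hm₀ hk₀.le hk hf hg h1 h3
    have h6 := normSqH1dot_mono hle hg.smooth hg.memH1dot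
    have h7 := mul_le_mul_of_nonneg_left h4 hA0.le
    have h8 : A * E * ε = K₀ / 4 := by rw [hε]; field_simp
    set H := normSqH1dot (k + γ / 2) g
    set H' := normSqH1dot (k - 1) g
    set L' := normSqL2 (k - 1) g
    have h9 : A * (E * (ε * (2 * H' + 6 * (k - 1) ^ 2 * L') + C * L')) =
        A * E * ε * (2 * H') + A * E * (6 * (k - 1) ^ 2 * ε + C) * L' := by ring
    have h10 : A * E * ε * (2 * H') ≤ K₀ / 2 * H := by rw [h8]; nlinarith
    linarith
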